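/- Let $d\ge 1$ and $N\ge 2$. An equation of Atkinson type on $[a,b]$ is $-(Py')'+Qy=\lambda Wy$, where $P^{-1},Q,W\in L^1((a,b),\mathbb C^{d\times d})$ are Hermitian matrix valued and there is a partition $a=a_0<b_0<a_1<b_1<\cdots<a_N<b_N=b$ such that $P^{-1}=0$ on $[a_i,b_i]$ and $\int_{a_i}^{b_i}W$ is positive definite for $0\le i\le N$, and $Q=W=0$ on $[b_{j-1},a_j]$ and $\int_{b_{j-1}}^{a_j}P^{-1}$ is invertible for $1\le j\le N$. Solutions are pairs $(u,v)=(y,Py')$ of absolutely continuous functions on $[a,b]$ with $u'=P^{-1}v$, $v'=(Q-\lambda W)u$ almost everywhere. Boundary conditions have the form $$A\begin{pmatrix}-y(a)\\ y(b)\end{pmatrix}+B\begin{pmatrix}(Py')(a)\\ (Py')(b)\end{pmatrix}=0,\qquad \operatorname{rank}(A,B)=2d,\quad AB^*=BA^*,$$ with $A,B\in\mathbb C^{2d\times 2d}$, and are regarded as points $\mathbf A=[A\,|\,B]$ of the space $\mathcal B$, the quotient of the set of all such $(A,B)$ by left multiplication by $GL(2d,\mathbb C)$, with the quotient topology. For $K\subseteq\{1,\dots,2d\}$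 let $E_K$ be the $4d\times 4d$ matrix obtained from $I_{4d}$ by multiplying column $k+2d$ by $-1$ and then exchanging columns $k$ and $k+2d$, for each $k\in K$. Let $\mathcal O_K=\{[(S\,|\,I_{2d})E_K]: S\in\mathbb C^{2d\times 2d}\text{ Hermitian}\}$, and write $S(\mathbf A)$ for the matrix $S$ that determines $\mathbf A\in\mathcal O_K$. For a Hermitian matrix $M$, let $r^0(M)$, $r^+(M)$, $r^-(M)$ be the total multiplicities of its zero, positive and negative eigenvalues. For $K\ne\emptyset$ let $\hat E_0$ be the matrix whose columns are the columns of $I_{2d}$ with index in $K$, put $S_K(\mathbf A)=\hat E_0^*S(\mathbf A)\hat E_0$, and for nonnegative integers with $r^0+r^++r^-=\sharp K$ put $$J_K^{(r^0,r^+,r^-)}=\{\mathbf A\in\mathcal O_K:\ r^0(S_K(\mathbf A))=r^0,\ r^\pm(S_K(\mathbf A))=r^\pm\}.$$ For $0\le k\le 2d$ let $\hat\Sigma_k=\{[A\,|\,B]\in\mathcal B:\ \dim\ker B=k\}$. Fix an equation of Atkinson type. For every $\mathbf A\in\mathcal B$ the set of $\lambda\in\mathbb C$ admitting a nontrivial solution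 is finite and consists of real numbers. Arrange these eigenvalues, repeated according to the dimension of their eigenspaces, as $\lambda_1(\mathbf A)\le\lambda_2(\mathbf A)\le\cdots$. (1) For $0\le k\le 2d$, every $\mathbf A\in\hat\Sigma_k$ has exactly $(N+1)d-k$ eigenvalues, and the restriction of $\lambda_n$ to $\hat\Sigma_k$ is continuous for $1\le n\le (N+1)d-k$. Every $\mathbf A\in\mathcal O_\emptyset$ has exactly $(N+1)d$ eigenvalues, and the restriction of $\lambda_n$ to $\mathcal O_\emptyset$ is continuous for $1\le n\le (N+1)d$. (2) Let $\emptyset\neq K\subseteq\{1,\dots,2d\}$, $r^0+r^++r^-=r_1^0+r_1^++r_1^-=\sharp K$, $0\le r^0<r_1^0$, $r^\pm\ge r_1^\pm$, and $\mathbf A\in J_K^{(r_1^0,r_1^+,r_1^-)}$. Then $\mathbf A$ lies in the closure of $J_K^{(r^0,r^+,r^-)}$, every point of $J_K^{(r^0,r^+,r^-)}$ has exactly $(N+1)d-r^0$ eigenvalues, $\mathbf A$ has exactly $(N+1)d-r_1^0$, and as $\mathbf B\to\mathbf A$ with $\mathbf B\in J_K^{(r^0,r^+,r^-)}$, $$\lambda_n(\mathbf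 B)\to-\infty\quad (1\le n\le r^+-r_1^+),$$ $$\lambda_n(\mathbf B)\to\lambda_{n-(r^+-r_1^+)}(\mathbf A)\quad (r^+-r_1^+<n\le (N+1)d-r^0-(r^--r_1^-)),$$ $$\lambda_n(\mathbf B)\to+\infty\quad ((N+1)d-r^0-(r^--r_1^-)<n\le (N+1)d-r^0).$$ (3) Consequently the singular set, that is, the set of $\mathbf A\in\mathcal B$ at which for some $n\ge1$ the function $\lambda_n$ (on the set of boundary conditions with at least $n$ eigenvalues) is defined and discontinuous, equals $\bigcup_{1\le k\le 2d}\hat\Sigma_k$. In particular it does not depend on the equation. -/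

import Mathlib

open Set Filter Topology MeasureTheory
open scoped Matrix ComplexOrder

noncomputable section

namespace AtkinsonSL

/-! ### The space of self-adjoint boundary conditions

The index set `{1, …, 2d}` is written `Fin d ⊕ Fin d`: the left summand is `{1, …, d}` (the end
`a`), the right summand is `{d + 1, …, 2d}` (the end `b`). -/

/-- The index set `{1, …, 2d}`. -/
abbrev Idx (d : ℕ) : Type := Fin d ⊕ Fin d

/-- The set of pairs `(A, B)` of `2d × 2d` matrices with `rank (A, B) = 2d` and `A B^* = B A^*`,
topologised as a subset of the space of matrices. -/
abbrev BoundaryPair (d : ℕ) : Type :=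
  {p : Matrix (Idx d) (Idx d) ℂ × Matrix (Idx d) (Idx d) ℂ //
    (Matrix.fromCols p.1 p.2).rank = 2 * d ∧ p.1 * p.2ᴴ = p.2 * p.1ᴴ}

/-- Two pairs are equivalent when `(A', B') = (T A, T B)` for an invertible matrix `T`. -/
instance boundarySetoid (d : ℕ) : Setoid (BoundaryPair d) where
  r p q := ∃ T : Matrix (Idx d) (Idx d) ℂ, IsUnit T ∧ q.1.1 = T * p.1.1 ∧ q.1.2 = T * p.1.2
  iseqv :=
    { refl := fun p => ⟨1, isUnit_one, by simp, by simp⟩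
      symm := by
        rintro p q ⟨T, hT, h1, h2⟩
        obtain ⟨U, rfl⟩ := hT
        exact ⟨(U⁻¹ : (Matrix (Idx d) (Idx d) ℂ)ˣ), Units.isUnit _,
          by rw [h1, ← mul_assoc, Units.inv_mul, one_mul],
          by rw [h2, ← mul_assoc, Units.inv_mul, one_mul]⟩
      trans := by
        rintro p q r ⟨T, hT, h1, h2⟩ ⟨U, hU, h3, h4⟩
        exact ⟨U * T, hU.mul hT, by rw [h3, h1, mul_assoc], by rw [h4, h2, mul_assoc]⟩ }

/-- The space of self-adjoint boundary conditions `[A | B]`: the quotient of the space of pairs by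
left multiplication by `GL(2d, ℂ)`. -/
def BoundarySpace (d : ℕ) : Type := Quotient (boundarySetoid d)

/-- The quotient topology. -/
instance (d : ℕ) : TopologicalSpace (BoundarySpace d) :=
  inferInstanceAs (TopologicalSpace (Quotient (boundarySetoid d)))

/-- The class `[A | B]` of a pair `(A, B)`. -/
def BoundarySpace.mk {d : ℕ} (p : BoundaryPair d) : BoundarySpace d :=
  Quotient.mk (boundarySetoid d) p

/-- The boundary values `x` (for `(-y(a), y(b))`) and `z` (for `((P y')(a), (P y')(b))`) satisfy
`A x + B z = 0`. -/
def BoundarySpace.Holds {d : ℕ} (κ : BoundarySpace d) (x z : Idx d → ℂ) : Prop :=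
  Quotient.liftOn κ (fun p => p.1.1 *ᵥ x + p.1.2 *ᵥ z = 0) (by
    rintro p q ⟨T, hT, h1, h2⟩
    obtain ⟨U, rfl⟩ := hT
    simp only [h1, h2, ← Matrix.mulVec_mulVec, ← Matrix.mulVec_add, eq_iff_iff]
    constructor
    · intro h
      rw [h, Matrix.mulVec_zero]
    · intro h
      have h' := congrArg (fun w => (U⁻¹ : (Matrix (Idx d) (Idx d) ℂ)ˣ).1 *ᵥ w) h
      simpa [Matrix.mulVec_mulVec] using h')

/-- `r⁰(B)` for `κ = [A | B]`: the dimension of the kernel of `B`. -/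
def BoundarySpace.nullityB {d : ℕ} (κ : BoundarySpace d) : ℕ :=
  Quotient.liftOn κ (fun p => Module.finrank ℂ (LinearMap.ker p.1.2.mulVecLin)) (by
    rintro p q ⟨T, hT, -, h2⟩
    obtain ⟨U, rfl⟩ := hT
    have : LinearMap.ker q.1.2.mulVecLin = LinearMap.ker p.1.2.mulVecLin := by
      ext x
      simp only [LinearMap.mem_ker, Matrix.mulVecLin_apply, h2, ← Matrix.mulVec_mulVec]
      constructor
      · intro h
        have h' := congrArg (fun w => (U⁻¹ : (Matrix (Idx d) (Idx d) ℂ)ˣ).1 *ᵥ w) h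
        simpa [Matrix.mulVec_mulVec] using h'
      · intro h
        rw [h, Matrix.mulVec_zero]
    change Module.finrank ℂ (LinearMap.ker p.1.2.mulVecLin) =
      Module.finrank ℂ (LinearMap.ker q.1.2.mulVecLin)
    rw [this])

/-- The `k`-th layer `{[A | B] : r⁰(B) = k}`. -/
def layer (d k : ℕ) : Set (BoundarySpace d) := {κ | κ.nullityB = k}

/-! ### The charts `O_K` -/

/-- The diagonal matrix `diag(E₁, E₂)`: its `i`-th diagonal entry is `0` if `i ∈ K`, else `1`. -/
def diagK {d : ℕ} (K : Finset (Idx d)) : Matrix (Idx d) (Idx d) ℂ :=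
  Matrix.diagonal fun i => if i ∈ K then 0 else 1

/-- The `4d × 4d` matrix `E_K`, obtained from the identity by multiplying the `(k + 2d)`-th column
by `-1` and then exchanging the `k`-th and the `(k + 2d)`-th columns, for each `k ∈ K`. -/
def matE {d : ℕ} (K : Finset (Idx d)) : Matrix (Idx d ⊕ Idx d) (Idx d ⊕ Idx d) ℂ :=
  Matrix.fromBlocks (diagK K) (1 - diagK K) (diagK K - 1) (diagK K)

theorem diagK_mul_self {d : ℕ} (K : Finset (Idx d)) : diagK K * diagK K = diagK K := by
  simp [diagK, Matrix.diagonal_mul_diagonal]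

theorem diagK_conjTranspose {d : ℕ} (K : Finset (Idx d)) : (diagK K)ᴴ = diagK K := by
  unfold diagK
  rw [Matrix.diagonal_conjTranspose]
  congr 1
  ext i
  by_cases h : i ∈ K <;> simp [h]

/-- The first half `A` of `(A, B) = (S, I) E_K`. -/
def chartA {d : ℕ} (K : Finset (Idx d)) (S : Matrix (Idx d) (Idx d) ℂ) :
    Matrix (Idx d) (Idx d) ℂ :=
  (Matrix.fromCols S (1 : Matrix (Idx d) (Idx d) ℂ) * matE K).toCols₁

/-- The second half `B` of `(A, B) = (S, I) E_K`. -/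
def chartB {d : ℕ} (K : Finset (Idx d)) (S : Matrix (Idx d) (Idx d) ℂ) :
    Matrix (Idx d) (Idx d) ℂ :=
  (Matrix.fromCols S (1 : Matrix (Idx d) (Idx d) ℂ) * matE K).toCols₂

theorem fromCols_chart {d : ℕ} (K : Finset (Idx d)) (S : Matrix (Idx d) (Idx d) ℂ) :
    Matrix.fromCols (chartA K S) (chartB K S) =
      Matrix.fromCols S (1 : Matrix (Idx d) (Idx d) ℂ) * matE K :=
  Matrix.fromCols_toCols _

theorem fromCols_chart_eq {d : ℕ} (K : Finset (Idx d)) (S : Matrix (Idx d) (Idx d) ℂ) :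
    Matrix.fromCols (chartA K S) (chartB K S) =
      Matrix.fromCols (S * diagK K + (diagK K - 1)) (S * (1 - diagK K) + diagK K) := by
  rw [fromCols_chart, matE, Matrix.fromCols_mul_fromBlocks, one_mul, one_mul]

theorem chartA_eq {d : ℕ} (K : Finset (Idx d)) (S : Matrix (Idx d) (Idx d) ℂ) :
    chartA K S = S * diagK K + (diagK K - 1) := by
  have h := congrArg Matrix.toCols₁ (fromCols_chart_eq K S)
  simpa using h

theorem chartB_eq {d : ℕ} (K : Finset (Idx d)) (S : Matrix (Idx d) (Idx d) ℂ) :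
    chartB K S = S * (1 - diagK K) + diagK K := by
  have h := congrArg Matrix.toCols₂ (fromCols_chart_eq K S)
  simpa using h

theorem matE_mul_conjTranspose {d : ℕ} (K : Finset (Idx d)) : matE K * (matE K)ᴴ = 1 := by
  have h := diagK_mul_self K
  have e : (1 : Matrix (Idx d ⊕ Idx d) (Idx d ⊕ Idx d) ℂ) = Matrix.fromBlocks 1 0 0 1 :=
    Matrix.fromBlocks_one.symm
  rw [e, matE, Matrix.fromBlocks_conjTranspose, Matrix.fromBlocks_multiply]
  simp only [Matrix.conjTranspose_sub, Matrix.conjTranspose_one, diagK_conjTranspose,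
    mul_sub, sub_mul, mul_one, one_mul, h]
  congr 1 <;> abel

theorem chart_rank {d : ℕ} (K : Finset (Idx d)) (S : Matrix (Idx d) (Idx d) ℂ) :
    (Matrix.fromCols (chartA K S) (chartB K S)).rank = 2 * d := by
  have hcard : Fintype.card (Idx d) = 2 * d := by simp [two_mul]
  apply le_antisymm
  · exact (Matrix.rank_le_card_height _).trans_eq hcard
  · -- `(S, I) E_K` has the right inverse `E_K^* (0, I)^T`.
    set R : Matrix (Idx d ⊕ Idx d) (Idx d) ℂ :=
      (matE K)ᴴ * (Matrix.fromRows 0 1 : Matrix (Idx d ⊕ Idx d) (Idx d) ℂ) with hR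
    have h1 : Matrix.fromCols (chartA K S) (chartB K S) * R = 1 := by
      rw [fromCols_chart, hR, Matrix.mul_assoc, ← Matrix.mul_assoc (matE K),
        matE_mul_conjTranspose, Matrix.one_mul, Matrix.fromCols_mul_fromRows]
      simp
    have h2 := Matrix.rank_mul_le_left (Matrix.fromCols (chartA K S) (chartB K S)) R
    rw [h1, Matrix.rank_one, hcard] at h2
    exact h2

theorem chart_symm {d : ℕ} (K : Finset (Idx d)) {S : Matrix (Idx d) (Idx d) ℂ}
    (hS : S.IsHermitian) : chartA K S * (chartB K S)ᴴ = chartB K S * (chartA K S)ᴴ := by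
  have h := diagK_mul_self K
  have h' : ∀ X : Matrix (Idx d) (Idx d) ℂ, diagK K * (diagK K * X) = diagK K * X := by
    intro X
    rw [← mul_assoc, h]
  rw [chartA_eq, chartB_eq]
  simp only [Matrix.conjTranspose_add, Matrix.conjTranspose_mul, Matrix.conjTranspose_sub,
    Matrix.conjTranspose_one, diagK_conjTranspose, hS.eq, mul_add, add_mul, mul_sub, sub_mul,
    mul_one, one_mul, mul_assoc, h, h']
  abel

/-- The boundary condition `[(S | I) E_K]` for a Hermitian matrix `S`. -/
def chart {d : ℕ} (K : Finset (Idx d)) (S : Matrix (Idx d) (Idx d) ℂ) (hS : S.IsHermitian) :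
    BoundarySpace d :=
  BoundarySpace.mk ⟨(chartA K S, chartB K S), chart_rank K S, chart_symm K hS⟩

/-- The coordinate domain `O_K = {[(S | I) E_K] : S Hermitian}`. -/
def chartDomain {d : ℕ} (K : Finset (Idx d)) : Set (BoundarySpace d) :=
  {κ | ∃ (S : Matrix (Idx d) (Idx d) ℂ) (hS : S.IsHermitian), κ = chart K S hS}

/-! ### Inertia and the areas `J_K` -/

/-- `r⁰(M)`: the total multiplicity of the eigenvalue zero of a Hermitian matrix. -/
def rZero {m : Type} [Fintype m] [DecidableEq m] {M : Matrix m m ℂ} (hM : M.IsHermitian) : ℕ :=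
  (Finset.univ.filter fun i => hM.eigenvalues i = 0).card

/-- `r⁺(M)`: the total multiplicity of the positive eigenvalues of a Hermitian matrix. -/
def rPos {m : Type} [Fintype m] [DecidableEq m] {M : Matrix m m ℂ} (hM : M.IsHermitian) : ℕ :=
  (Finset.univ.filter fun i => 0 < hM.eigenvalues i).card

/-- `r⁻(M)`: the total multiplicity of the negative eigenvalues of a Hermitian matrix. -/
def rNeg {m : Type} [Fintype m] [DecidableEq m] {M : Matrix m m ℂ} (hM : M.IsHermitian) : ℕ :=
  (Finset.univ.filter fun i => hM.eigenvalues i < 0).card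

/-- The matrix whose columns are the columns of the identity with index in `K`. -/
def colE {d : ℕ} (K : Finset (Idx d)) : Matrix (Idx d) {i // i ∈ K} ℂ :=
  (1 : Matrix (Idx d) (Idx d) ℂ).submatrix id Subtype.val

/-- The compression `Ê₀^* S Ê₀` of `S` to the indices in `K`. -/
def compress {d : ℕ} (K : Finset (Idx d)) (S : Matrix (Idx d) (Idx d) ℂ) :
    Matrix {i // i ∈ K} {i // i ∈ K} ℂ :=
  (colE K)ᴴ * S * colE K

theorem compress_isHermitian {d : ℕ} (K : Finset (Idx d)) {S : Matrix (Idx d) (Idx d) ℂ}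
    (hS : S.IsHermitian) : (compress K S).IsHermitian :=
  Matrix.isHermitian_conjTranspose_mul_mul (colE K) hS

/-- The area `J_K^{(r⁰, r⁺, r⁻)}` of `O_K`: the boundary conditions `[(S | I) E_K]` for which the
compression of `S` to `K` has inertia `(r⁰, r⁺, r⁻)`. -/
def area {d : ℕ} (K : Finset (Idx d)) (r₀ rp rm : ℕ) : Set (BoundarySpace d) :=
  {κ | ∃ (S : Matrix (Idx d) (Idx d) ℂ) (hS : S.IsHermitian), κ = chart K S hS ∧
    rZero (compress_isHermitian K hS) = r₀ ∧
    rPos (compress_isHermitian K hS) = rp ∧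
    rNeg (compress_isHermitian K hS) = rm}

/-! ### Sturm-Liouville equations of Atkinson type -/

/-- The entrywise integral of a matrix function over `[s, t]`. -/
def matIntegral {d : ℕ} (F : ℝ → Matrix (Fin d) (Fin d) ℂ) (s t : ℝ) :
    Matrix (Fin d) (Fin d) ℂ :=
  Matrix.of fun k l => ∫ x in s..t, F x k l

/-- A `d`-dimensional Sturm-Liouville equation `-(P y')' + Q y = λ W y` of Atkinson type with a
partition `a = a₀ < b₀ < a₁ < b₁ < ⋯ < a_N < b_N = b`, where `lo i = a_i` and `hi i = b_i`. The
datum `Pinv` is the integrable function `P⁻¹`. -/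
structure Equation (d N : ℕ) where
  lo : Fin (N + 1) → ℝ
  hi : Fin (N + 1) → ℝ
  lo_lt_hi : ∀ i, lo i < hi i
  hi_lt_lo : ∀ j : Fin N, hi j.castSucc < lo j.succ
  Pinv : ℝ → Matrix (Fin d) (Fin d) ℂ
  Q : ℝ → Matrix (Fin d) (Fin d) ℂ
  W : ℝ → Matrix (Fin d) (Fin d) ℂ
  Pinv_integrable : ∀ k l, IntegrableOn (fun x => Pinv x k l) (Icc (lo 0) (hi (Fin.last N)))
  Q_integrable : ∀ k l, IntegrableOn (fun x => Q x k l) (Icc (lo 0) (hi (Fin.last N)))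
  W_integrable : ∀ k l, IntegrableOn (fun x => W x k l) (Icc (lo 0) (hi (Fin.last N)))
  hermitian : ∀ᵐ x, x ∈ Icc (lo 0) (hi (Fin.last N)) →
    (Pinv x).IsHermitian ∧ (Q x).IsHermitian ∧ (W x).IsHermitian
  Pinv_zero : ∀ i, ∀ᵐ x, x ∈ Icc (lo i) (hi i) → Pinv x = 0
  W_posDef : ∀ i, (matIntegral W (lo i) (hi i)).PosDef
  QW_zero : ∀ j : Fin N, ∀ᵐ x, x ∈ Icc (hi j.castSucc) (lo j.succ) → Q x = 0 ∧ W x = 0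
  Pinv_invertible : ∀ j : Fin N, IsUnit (matIntegral Pinv (hi j.castSucc) (lo j.succ))

namespace Equation

variable {d N : ℕ} (ω : Equation d N)

/-- The left end of the interval. -/
def a : ℝ := ω.lo 0

/-- The right end of the interval. -/
def b : ℝ := ω.hi (Fin.last N)

theorem lo_le_lo (i j : Fin (N + 1)) (h : i ≤ j) : ω.lo i ≤ ω.lo j := by
  have hm : Monotone ω.lo :=
    Fin.monotone_iff_le_succ.2 fun j => ((ω.lo_lt_hi _).trans (ω.hi_lt_lo j)).le
  exact hm h

theorem a_le_b : ω.a ≤ ω.b :=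
  (ω.lo_le_lo 0 (Fin.last N) (Fin.zero_le _)).trans (ω.lo_lt_hi _).le

/-- The interval `[a, b]`. -/
abbrev Interval : Type := Icc ω.a ω.b

/-- A continuous vector function on `[a, b]`, as a function on the line (constant outside). -/
def ext (f : C(ω.Interval, Fin d → ℂ)) : ℝ → Fin d → ℂ := IccExtend ω.a_le_b f

/-- The left end as a point of `[a, b]`. -/
def aPt : ω.Interval := ⟨ω.a, left_mem_Icc.2 ω.a_le_b⟩

/-- The right end as a point of `[a, b]`. -/
def bPt : ω.Interval := ⟨ω.b, right_mem_Icc.2 ω.a_le_b⟩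

/-- The pair `(u, v) = (y, P y')` is a solution on `[a, b]` of `u' = P⁻¹ v`, `v' = (Q - λ W) u` in
the sense of Carathéodory: `u`, `v` are the indefinite integrals of the right-hand sides, which
means that they are absolutely continuous and satisfy the equations almost everywhere. -/
def IsSolution (z : ℂ) (u v : C(ω.Interval, Fin d → ℂ)) : Prop :=
  ∀ t : ω.Interval,
    u t = u ω.aPt + ∫ x in ω.a..t, ω.Pinv x *ᵥ ω.ext v x ∧
    v t = v ω.aPt + ∫ x in ω.a..t, (ω.Q x - z • ω.W x) *ᵥ ω.ext u x

theorem ext_continuous (f : C(ω.Interval, Fin d → ℂ)) : Continuous (ω.ext f) :=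
  f.continuous.Icc_extend'

theorem ext_add (f g : C(ω.Interval, Fin d → ℂ)) : ω.ext (f + g) = ω.ext f + ω.ext g := rfl

theorem ext_smul (c : ℂ) (f : C(ω.Interval, Fin d → ℂ)) : ω.ext (c • f) = c • ω.ext f := rfl

theorem intervalIntegrable_mulVec {F : ℝ → Matrix (Fin d) (Fin d) ℂ}
    (hF : ∀ k l, IntegrableOn (fun x => F x k l) (Icc ω.a ω.b))
    (f : C(ω.Interval, Fin d → ℂ)) (t : ω.Interval) :
    IntervalIntegrable (fun x => F x *ᵥ ω.ext f x) volume ω.a t := by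
  rw [intervalIntegrable_iff_integrableOn_Ioc_of_le t.2.1]
  have hsub : Ioc ω.a (t : ℝ) ⊆ Icc ω.a ω.b := fun x hx => ⟨hx.1.le, hx.2.trans t.2.2⟩
  refine IntegrableOn.mono_set ?_ hsub
  refine Integrable.of_eval fun k => ?_
  simp only [Matrix.mulVec, dotProduct]
  refine integrable_finsetSum _ fun l _ => ?_
  exact (hF k l).mul_continuousOn
    ((continuous_apply l).comp (ω.ext_continuous f)).continuousOn isCompact_Icc

theorem QW_integrable (z : ℂ) (k l : Fin d) :
    IntegrableOn (fun x => (ω.Q x - z • ω.W x) k l) (Icc ω.a ω.b) :=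
  (ω.Q_integrable k l).sub ((ω.W_integrable k l).const_mul z)

/-- The eigenspace of the problem `(ω, κ)` for `z ∈ ℂ`: the solutions `(u, v) = (y, P y')` on
`[a, b]` which satisfy the boundary condition
`A (-y(a), y(b))ᵀ + B ((P y')(a), (P y')(b))ᵀ = 0`. -/
def eigenspace (κ : BoundarySpace d) (z : ℂ) :
    Submodule ℂ (C(ω.Interval, Fin d → ℂ) × C(ω.Interval, Fin d → ℂ)) where
  carrier := {p | ω.IsSolution z p.1 p.2 ∧
    κ.Holds (Sum.elim (-p.1 ω.aPt) (p.1 ω.bPt)) (Sum.elim (p.2 ω.aPt) (p.2 ω.bPt))}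
  zero_mem' := by
    refine ⟨fun t => ?_, ?_⟩
    · have h : ω.ext 0 = 0 := rfl
      simp [h]
    · induction κ using Quotient.inductionOn with
      | h p =>
        change _ *ᵥ _ + _ *ᵥ _ = 0
        simp
  add_mem' := by
    rintro ⟨u, v⟩ ⟨u', v'⟩ ⟨h1, h2⟩ ⟨h3, h4⟩
    refine ⟨fun t => ⟨?_, ?_⟩, ?_⟩
    · have e := intervalIntegral.integral_add
        (ω.intervalIntegrable_mulVec ω.Pinv_integrable v t)
        (ω.intervalIntegrable_mulVec ω.Pinv_integrable v' t)
      simp only [Prod.fst_add, Prod.snd_add, ContinuousMap.add_apply, ext_add, Pi.add_apply,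
        Matrix.mulVec_add]
      rw [e, (h1 t).1, (h3 t).1]
      abel
    · have e := intervalIntegral.integral_add
        (ω.intervalIntegrable_mulVec (ω.QW_integrable z) u t)
        (ω.intervalIntegrable_mulVec (ω.QW_integrable z) u' t)
      simp only [Prod.fst_add, Prod.snd_add, ContinuousMap.add_apply, ext_add, Pi.add_apply,
        Matrix.mulVec_add]
      rw [e, (h1 t).2, (h3 t).2]
      abel
    · induction κ using Quotient.inductionOn with
      | h p =>
        change p.1.1 *ᵥ _ + p.1.2 *ᵥ _ = 0 at h2 h4
        change p.1.1 *ᵥ _ + p.1.2 *ᵥ _ = 0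
        have e1 : Sum.elim (-((u + u') ω.aPt)) ((u + u') ω.bPt) =
            Sum.elim (-u ω.aPt) (u ω.bPt) + Sum.elim (-u' ω.aPt) (u' ω.bPt) := by
          ext (i | i) <;> simp [add_comm]
        have e2 : Sum.elim ((v + v') ω.aPt) ((v + v') ω.bPt) =
            Sum.elim (v ω.aPt) (v ω.bPt) + Sum.elim (v' ω.aPt) (v' ω.bPt) := by
          ext (i | i) <;> simp
        simp only [Prod.fst_add, Prod.snd_add]
        rw [e1, e2, Matrix.mulVec_add, Matrix.mulVec_add, add_add_add_comm]
        simp only at h2 h4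
        rw [h2, h4, add_zero]
  smul_mem' := by
    rintro c ⟨u, v⟩ ⟨h1, h2⟩
    refine ⟨fun t => ⟨?_, ?_⟩, ?_⟩
    · simp only [Prod.smul_fst, Prod.smul_snd, ContinuousMap.smul_apply, ext_smul, Pi.smul_apply,
        Matrix.mulVec_smul, intervalIntegral.integral_smul]
      rw [(h1 t).1, smul_add]
    · simp only [Prod.smul_fst, Prod.smul_snd, ContinuousMap.smul_apply, ext_smul, Pi.smul_apply,
        Matrix.mulVec_smul, intervalIntegral.integral_smul]
      rw [(h1 t).2, smul_add]
    · induction κ using Quotient.inductionOn with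
      | h p =>
        change p.1.1 *ᵥ _ + p.1.2 *ᵥ _ = 0 at h2
        change p.1.1 *ᵥ _ + p.1.2 *ᵥ _ = 0
        have e1 : Sum.elim (-((c • u) ω.aPt)) ((c • u) ω.bPt) =
            c • Sum.elim (-u ω.aPt) (u ω.bPt) := by
          ext (i | i) <;> simp
        have e2 : Sum.elim ((c • v) ω.aPt) ((c • v) ω.bPt) =
            c • Sum.elim (v ω.aPt) (v ω.bPt) := by
          ext (i | i) <;> simp
        simp only [Prod.smul_fst, Prod.smul_snd]
        rw [e1, e2, Matrix.mulVec_smul, Matrix.mulVec_smul, ← smul_add]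
        simp only at h2
        rw [h2, smul_zero]

/-- The spectrum of `(ω, κ)`: the set of `z ∈ ℂ` for which there is a nontrivial solution. -/
def spectrum (κ : BoundarySpace d) : Set ℂ := {z | ω.eigenspace κ z ≠ ⊥}

/-- The multiplicity of `z`: the number of linearly independent eigenfunctions. -/
def multiplicity (κ : BoundarySpace d) (z : ℂ) : ℕ := Module.finrank ℂ (ω.eigenspace κ z)

/-- The multiset of the real eigenvalues, each one repeated according to its multiplicity. -/
def eigenvalues (κ : BoundarySpace d) : Multiset ℝ :=
  ∑ᶠ x : ℝ, Multiset.replicate (ω.multiplicity κ x) x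

/-- The number of eigenvalues, counting multiplicities. -/
def count (κ : BoundarySpace d) : ℕ := (ω.eigenvalues κ).card

/-- The `n`-th eigenvalue `λ_n`, `1 ≤ n ≤ count`, in the non-decreasing arrangement
`λ_1 ≤ λ_2 ≤ ⋯` of the eigenvalues (with the irrelevant value `0` for any other `n`). -/
def eigenvalue (n : ℕ) (κ : BoundarySpace d) : ℝ := ((ω.eigenvalues κ).sort).getD (n - 1) 0

/-- The singular set: the points `κ` at which `λ_n`, as a function on the set of all boundary
conditions with at least `n` eigenvalues, is defined and discontinuous for some `n ≥ 1`. -/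
def singularSet : Set (BoundarySpace d) :=
  {κ | ∃ n, 1 ≤ n ∧ n ≤ ω.count κ ∧
    ¬ ContinuousWithinAt (ω.eigenvalue n) {κ' | n ≤ ω.count κ'} κ}

end Equation

end AtkinsonSL

end

/-! The equation is finite-dimensional in disguise. On each `[a_i, b_i]` the function `u` is
constant and on each `[b_{j-1}, a_j]` the function `v` is constant, so a solution is determined by
its values at the nodes, and these satisfy difference equations. Eliminating the interior values of
`v` leaves `L u - z C^* C u = G^* y`, where `L` is Hermitian of size `(N + 1) d`, `C^* C` is the
block-diagonal matrix of the integrals of `W`, `G u = (-u_0, u_N)`, and `y` collects `v(a)` and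
`v(b)` (`Equation.nonempty_eigenspace_equiv`). A boundary condition is a Lagrangian relation between
`G u` and `y`. The resulting linear relation on `ℂ^{(N+1)d}` is self-adjoint, with multivalued part
of dimension `dim ker B`; its spectral theorem gives exactly `(N + 1) d - dim ker B` eigenvalues,
all real (`Pencil.exists_eigenvectors`).

The behaviour of `λ_n` is read off the counting function `below κ t`, the number of eigenvalues less
than `t`. In the chart `O_K` the components of `y` with index in `K` are kept as additional unknowns
and the others are eliminated by means of `S`. The eigenvalue equation at `t` becomes the kernel
equation of a Hermitian matrix `Pencil.bordered` of fixed size `(N + 1) d + #K` that depends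
continuously on `S`. The eigenvectors of the problem together with those of `S_K` diagonalise its
form, with weights `λ_i - t` and the eigenvalues of `S_K`. When the matrix is nonsingular, a
dimension count turns this into `below + r^-(S_K) + r^0(S_K) =` its negative index
(`Pencil.below_add_eq_rNeg`).

If `t` is not an eigenvalue at `κ`, the bordered matrix is nonsingular there and its inertia is
locally constant (`eventually_rNeg_eq`). As `r^- + r^0 = #K - r^+`, the counting function at `t`
changes near `κ` exactly by the change of `r^+(S_K)` (`Equation.eventually_below_area`). All limits
follow, because `λ_n < t` means `n ≤ below κ t`: the `r^+ - r_1^+` new eigenvalues at the bottom go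
to `-∞`, those in the middle converge with a shifted index, and the surplus at the top goes to `+∞`.

On a layer there is no shift, hence continuity. A point with `k = dim ker B ≥ 1` has a chart with
`#K = k` and `S_K = 0`; making one eigenvalue of `S_K` positive drives `λ_1` to `-∞`, so the point
is singular. For `k = 0` a whole neighbourhood lies in the layer, so the point is not. -/

noncomputable section

namespace AtkinsonSL

/-! ### Inertia of Hermitian matrices -/

section Inertia

variable {m : Type} [Fintype m]

/-- The real quadratic form `v ↦ v^* M v` of a matrix. -/
def quad (M : Matrix m m ℂ) (v : m → ℂ) : ℝ := (star v ⬝ᵥ M *ᵥ v).re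

theorem star_dotProduct_self_re (v : m → ℂ) : (star v ⬝ᵥ v).re = ∑ i, ‖v i‖ ^ 2 := by
  simp [dotProduct, ← Complex.normSq_eq_norm_sq, Complex.normSq_apply]

theorem quad_sub (M M' : Matrix m m ℂ) (v : m → ℂ) : quad (M - M') v = quad M v - quad M' v := by
  simp [quad, Matrix.sub_mulVec]

theorem abs_quad_le (M : Matrix m m ℂ) (v : m → ℂ) :
    |quad M v| ≤ (∑ i, ∑ j, ‖M i j‖) * ∑ i, ‖v i‖ ^ 2 := by
  have hle : ∀ i j, ‖v i‖ * ‖v j‖ ≤ ∑ k, ‖v k‖ ^ 2 := by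
    intro i j
    have hi := Finset.single_le_sum (f := fun k => ‖v k‖ ^ 2) (fun k _ => sq_nonneg _)
      (Finset.mem_univ i)
    have hj := Finset.single_le_sum (f := fun k => ‖v k‖ ^ 2) (fun k _ => sq_nonneg _)
      (Finset.mem_univ j)
    nlinarith [sq_nonneg (‖v i‖ - ‖v j‖)]
  calc |quad M v| ≤ ‖star v ⬝ᵥ M *ᵥ v‖ := Complex.abs_re_le_norm _
    _ ≤ ∑ i, ∑ j, ‖M i j‖ * (‖v i‖ * ‖v j‖) := by
        refine (norm_sum_le _ _).trans (Finset.sum_le_sum fun i _ => ?_)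
        rw [Matrix.mulVec, dotProduct, norm_mul, Pi.star_apply, norm_star]
        refine (mul_le_mul_of_nonneg_left (norm_sum_le _ _) (norm_nonneg _)).trans_eq ?_
        rw [Finset.mul_sum]
        refine Finset.sum_congr rfl fun j _ => ?_
        rw [norm_mul]
        ring
    _ ≤ ∑ i, ∑ j, ‖M i j‖ * ∑ k, ‖v k‖ ^ 2 :=
        Finset.sum_le_sum fun i _ => Finset.sum_le_sum fun j _ =>
          mul_le_mul_of_nonneg_left (hle i j) (norm_nonneg _)
    _ = _ := by simp [Finset.sum_mul]

variable [DecidableEq m]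

/-- The coordinates of a vector in the eigenbasis of a Hermitian matrix. -/
def eigenCoord {M : Matrix m m ℂ} (hM : M.IsHermitian) : (m → ℂ) →ₗ[ℂ] (m → ℂ) :=
  (star (hM.eigenvectorUnitary : Matrix m m ℂ)).mulVecLin

/-- The vector with given coordinates in the eigenbasis of a Hermitian matrix. -/
def ofEigenCoord {M : Matrix m m ℂ} (hM : M.IsHermitian) : (m → ℂ) →ₗ[ℂ] (m → ℂ) :=
  (hM.eigenvectorUnitary : Matrix m m ℂ).mulVecLin

theorem eigenCoord_ofEigenCoord {M : Matrix m m ℂ} (hM : M.IsHermitian) (c : m → ℂ) :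
    eigenCoord hM (ofEigenCoord hM c) = c := by
  simp [eigenCoord, ofEigenCoord, Matrix.mulVec_mulVec]

theorem ofEigenCoord_eigenCoord {M : Matrix m m ℂ} (hM : M.IsHermitian) (c : m → ℂ) :
    ofEigenCoord hM (eigenCoord hM c) = c := by
  simp [eigenCoord, ofEigenCoord, Matrix.mulVec_mulVec]

theorem star_dotProduct_eigenCoord {M : Matrix m m ℂ} (hM : M.IsHermitian) (v w : m → ℂ) :
    star (eigenCoord hM v) ⬝ᵥ eigenCoord hM w = star v ⬝ᵥ w := by
  simp only [eigenCoord, Matrix.mulVecLin_apply, Matrix.star_mulVec, Matrix.star_eq_conjTranspose,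
    Matrix.conjTranspose_conjTranspose, ← Matrix.dotProduct_mulVec, Matrix.mulVec_mulVec]
  rw [← Matrix.star_eq_conjTranspose]
  simp

theorem sum_norm_sq_eigenCoord {M : Matrix m m ℂ} (hM : M.IsHermitian) (v : m → ℂ) :
    ∑ i, ‖eigenCoord hM v i‖ ^ 2 = ∑ i, ‖v i‖ ^ 2 := by
  rw [← star_dotProduct_self_re, star_dotProduct_eigenCoord, star_dotProduct_self_re]

theorem eigenCoord_mulVec {M : Matrix m m ℂ} (hM : M.IsHermitian) (v : m → ℂ) (i : m) :
    eigenCoord hM (M *ᵥ v) i = (hM.eigenvalues i : ℂ) * eigenCoord hM v i := by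
  have h : star (hM.eigenvectorUnitary : Matrix m m ℂ) * M =
      Matrix.diagonal (RCLike.ofReal ∘ hM.eigenvalues) *
        star (hM.eigenvectorUnitary : Matrix m m ℂ) := by
    conv_lhs => enter [2]; rw [hM.spectral_theorem, Unitary.conjStarAlgAut_apply]
    rw [← mul_assoc, ← mul_assoc]
    simp
  simp only [eigenCoord, Matrix.mulVecLin_apply, Matrix.mulVec_mulVec, h]
  rw [← Matrix.mulVec_mulVec, Matrix.mulVec_diagonal]
  rfl

theorem quad_eq_sum {M : Matrix m m ℂ} (hM : M.IsHermitian) (v : m → ℂ) :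
    quad M v = ∑ i, hM.eigenvalues i * ‖eigenCoord hM v i‖ ^ 2 := by
  rw [quad, ← star_dotProduct_eigenCoord hM, dotProduct, Complex.re_sum]
  refine Finset.sum_congr rfl fun i _ => ?_
  rw [eigenCoord_mulVec, ← Complex.normSq_eq_norm_sq, Complex.normSq_apply]
  simp
  ring

/-- Following `A` by the projection to the eigencoordinates selected by `p` is injective, and
dimensions compare. The inertia bounds below are instances in which `h` is checked by a sign
argument. -/
theorem card_le_card_filter {M : Matrix m m ℂ} (hM : M.IsHermitian) {s : Type} [Fintype s]
    (A : (s → ℂ) →ₗ[ℂ] (m → ℂ)) (p : ℝ → Prop) [DecidablePred p]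
    (h : ∀ c, (∀ i, p (hM.eigenvalues i) → eigenCoord hM (A c) i = 0) → c = 0) :
    Fintype.card s ≤ (Finset.univ.filter fun i => p (hM.eigenvalues i)).card := by
  classical
  let f : (s → ℂ) →ₗ[ℂ] ({i // p (hM.eigenvalues i)} → ℂ) :=
    LinearMap.funLeft ℂ ℂ Subtype.val ∘ₗ eigenCoord hM ∘ₗ A
  have hf : Function.Injective f := by
    rw [← LinearMap.ker_eq_bot, LinearMap.ker_eq_bot']
    exact fun c hc => h c fun i hi => congrFun hc ⟨i, hi⟩
  have := LinearMap.finrank_le_finrank_of_injective hf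
  rwa [Module.finrank_fintype_fun_eq_card, Module.finrank_fintype_fun_eq_card,
    Fintype.card_subtype] at this

theorem card_le_rNeg {M : Matrix m m ℂ} (hM : M.IsHermitian) {s : Type} [Fintype s]
    (A : (s → ℂ) →ₗ[ℂ] (m → ℂ)) (h : ∀ c, c ≠ 0 → quad M (A c) < 0) :
    Fintype.card s ≤ rNeg hM := by
  refine card_le_card_filter hM A (fun x => x < 0) fun c hc => ?_
  by_contra h0
  refine (h c h0).not_ge ?_
  rw [quad_eq_sum hM]
  refine Finset.sum_nonneg fun i _ => ?_
  by_cases hi : hM.eigenvalues i < 0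
  · simp [hc i hi]
  · exact mul_nonneg (not_lt.1 hi) (sq_nonneg _)

theorem card_le_rPos {M : Matrix m m ℂ} (hM : M.IsHermitian) {s : Type} [Fintype s]
    (A : (s → ℂ) →ₗ[ℂ] (m → ℂ)) (h : ∀ c, c ≠ 0 → 0 < quad M (A c)) :
    Fintype.card s ≤ rPos hM := by
  refine card_le_card_filter hM A (fun x => 0 < x) fun c hc => ?_
  by_contra h0
  refine (h c h0).not_ge ?_
  rw [quad_eq_sum hM]
  refine Finset.sum_nonpos fun i _ => ?_
  by_cases hi : 0 < hM.eigenvalues i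
  · simp [hc i hi]
  · exact mul_nonpos_of_nonpos_of_nonneg (not_lt.1 hi) (sq_nonneg _)

theorem rPos_add_rNeg_add_rZero {M : Matrix m m ℂ} (hM : M.IsHermitian) :
    rPos hM + rNeg hM + rZero hM = Fintype.card m := by
  unfold rPos rNeg rZero
  rw [← Finset.card_union_of_disjoint, ← Finset.card_union_of_disjoint, ← Finset.card_univ]
  · congr 1
    ext i
    rcases lt_trichotomy (hM.eigenvalues i) 0 with h | h | h <;> simp [h]
  · rw [Finset.disjoint_left]
    intro i
    simp only [Finset.mem_union, Finset.mem_filter, Finset.mem_univ, true_and]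
    grind
  · rw [Finset.disjoint_left]
    intro i
    simp only [Finset.mem_filter, Finset.mem_univ, true_and]
    grind

theorem rZero_eq_zero_iff {M : Matrix m m ℂ} (hM : M.IsHermitian) :
    rZero hM = 0 ↔ ∀ i, hM.eigenvalues i ≠ 0 := by
  simp [rZero, Finset.filter_eq_empty_iff]

theorem rZero_eq_zero_of_mulVec {M : Matrix m m ℂ} (hM : M.IsHermitian)
    (h : ∀ v, M *ᵥ v = 0 → v = 0) : rZero hM = 0 := by
  rw [rZero_eq_zero_iff]
  intro i hi
  have h1 := hM.mulVec_eigenvectorBasis i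
  rw [hi, zero_smul] at h1
  exact hM.eigenvectorBasis.orthonormal.ne_zero i (by ext j; exact congrFun (h _ h1) j)

theorem rZero_eq_finrank_ker {M : Matrix m m ℂ} (hM : M.IsHermitian) :
    rZero hM = Module.finrank ℂ (LinearMap.ker M.mulVecLin) := by
  have h1 := LinearMap.finrank_range_add_finrank_ker M.mulVecLin
  have h2 := hM.rank_eq_card_non_zero_eigs
  rw [Matrix.rank] at h2
  rw [Module.finrank_fintype_fun_eq_card, h2, Fintype.card_subtype] at h1
  have h3 := Finset.card_filter_add_card_filter_not (s := Finset.univ)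
    (fun i => hM.eigenvalues i = 0)
  rw [Finset.card_univ] at h3
  unfold rZero
  simp only [ne_eq] at h1
  omega

/-- On the eigencoordinates outside `p` the form is definite, of the sign opposite to the one
assumed for `quad M v`. -/
theorem eq_zero_of_quad {M : Matrix m m ℂ} (hM : M.IsHermitian) (p : ℝ → Prop) (v : m → ℂ)
    (hp : ∀ i, p (hM.eigenvalues i) → eigenCoord hM v i = 0)
    (hq : (∀ x, ¬ p x → 0 < x) ∧ quad M v ≤ 0 ∨ (∀ x, ¬ p x → x < 0) ∧ 0 ≤ quad M v) :
    v = 0 := by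
  have key : ∀ i, eigenCoord hM v i = 0 := by
    rw [quad_eq_sum hM] at hq
    by_contra! hne
    obtain ⟨j, hj⟩ := hne
    have hpj : ¬ p (hM.eigenvalues j) := fun h => hj (hp j h)
    have hsq : 0 < ‖eigenCoord hM v j‖ ^ 2 := by positivity
    rcases hq with ⟨h1, h2⟩ | ⟨h1, h2⟩
    · refine h2.not_gt (Finset.sum_pos' (fun i _ => ?_) ⟨j, Finset.mem_univ j, ?_⟩)
      · by_cases hi : p (hM.eigenvalues i)
        · simp [hp i hi]
        · exact mul_nonneg (h1 _ hi).le (sq_nonneg _)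
      · exact mul_pos (h1 _ hpj) hsq
    · refine h2.not_gt (Finset.sum_neg' (fun i _ => ?_) ⟨j, Finset.mem_univ j, ?_⟩)
      · by_cases hi : p (hM.eigenvalues i)
        · simp [hp i hi]
        · exact mul_nonpos_of_nonpos_of_nonneg (h1 _ hi).le (sq_nonneg _)
      · exact mul_neg_of_neg_of_pos (h1 _ hpj) hsq
  rw [← ofEigenCoord_eigenCoord hM v, show eigenCoord hM v = 0 from funext key, map_zero]

/-- Nonsingularity is what allows a semidefinite subspace in place of a definite one: a vector
without negative eigencoordinates has only positive ones left. -/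
theorem card_le_of_quad_nonpos {M : Matrix m m ℂ} (hM : M.IsHermitian) (h0 : rZero hM = 0)
    {s : Type} [Fintype s] (A : (s → ℂ) →ₗ[ℂ] (m → ℂ)) (hA : Function.Injective A)
    (h : ∀ c, quad M (A c) ≤ 0) : Fintype.card s ≤ rNeg hM := by
  refine card_le_card_filter hM A (fun x => x < 0) fun c hc => hA ?_
  rw [map_zero]
  rw [rZero_eq_zero_iff] at h0
  refine eq_zero_of_quad hM (fun x => x ≤ 0) _ (fun i hi => hc i (lt_of_le_of_ne hi (h0 i)))
    (Or.inl ⟨fun x hx => not_le.1 hx, h c⟩)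

theorem card_le_of_quad_nonneg {M : Matrix m m ℂ} (hM : M.IsHermitian) (h0 : rZero hM = 0)
    {s : Type} [Fintype s] (A : (s → ℂ) →ₗ[ℂ] (m → ℂ)) (hA : Function.Injective A)
    (h : ∀ c, 0 ≤ quad M (A c)) : Fintype.card s ≤ rPos hM := by
  refine card_le_card_filter hM A (fun x => 0 < x) fun c hc => hA ?_
  rw [map_zero]
  rw [rZero_eq_zero_iff] at h0
  refine eq_zero_of_quad hM (fun x => 0 ≤ x) _
    (fun i hi => hc i (lt_of_le_of_ne hi (h0 i).symm)) (Or.inr ⟨fun x hx => not_le.1 hx, h c⟩)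

/-- Extension of a family on a subtype by zero. -/
def extendZero {q : Type} (p : q → Prop) : ({j // p j} → ℂ) →ₗ[ℂ] (q → ℂ) :=
  Function.ExtendByZero.linearMap ℂ Subtype.val

theorem extendZero_apply {q : Type} (p : q → Prop) (c : {j // p j} → ℂ) (j : {j // p j}) :
    extendZero p c j = c j := Subtype.val_injective.extend_apply _ _ _

theorem extendZero_apply_of_not {q : Type} (p : q → Prop) (c : {j // p j} → ℂ) (j : q)
    (hj : ¬ p j) : extendZero p c j = 0 :=
  Function.extend_apply' _ _ _ (by rintro ⟨a, rfl⟩; exact hj a.2)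

theorem extendZero_injective {q : Type} (p : q → Prop) : Function.Injective (extendZero p) := by
  intro c c' h
  ext j
  rw [← extendZero_apply p c, h, extendZero_apply]

/-- A form of Sylvester's law in which `A` need not be surjective and zero weights are allowed. A
zero weight counts here and again in `card_filter_nonneg_le`; this double count is what fixes the
inertia of the bordered matrix. -/
theorem card_filter_nonpos_le {M : Matrix m m ℂ} (hM : M.IsHermitian) (h0 : rZero hM = 0)
    {q : Type} [Fintype q] (A : (q → ℂ) →ₗ[ℂ] (m → ℂ)) (hA : Function.Injective A) (w : q → ℝ)
    (h : ∀ c, quad M (A c) = ∑ j, w j * ‖c j‖ ^ 2) :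
    (Finset.univ.filter fun j => w j ≤ 0).card ≤ rNeg hM := by
  classical
  rw [← Fintype.card_subtype]
  refine card_le_of_quad_nonpos hM h0 (A ∘ₗ extendZero fun j => w j ≤ 0)
    (hA.comp (extendZero_injective _)) fun c => ?_
  rw [LinearMap.comp_apply, h]
  refine Finset.sum_nonpos fun j _ => ?_
  by_cases hj : w j ≤ 0
  · exact mul_nonpos_of_nonpos_of_nonneg hj (sq_nonneg _)
  · simp [extendZero_apply_of_not (fun j => w j ≤ 0) c j hj]

theorem card_filter_nonneg_le {M : Matrix m m ℂ} (hM : M.IsHermitian) (h0 : rZero hM = 0)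
    {q : Type} [Fintype q] (A : (q → ℂ) →ₗ[ℂ] (m → ℂ)) (hA : Function.Injective A) (w : q → ℝ)
    (h : ∀ c, quad M (A c) = ∑ j, w j * ‖c j‖ ^ 2) :
    (Finset.univ.filter fun j => 0 ≤ w j).card ≤ rPos hM := by
  classical
  rw [← Fintype.card_subtype]
  refine card_le_of_quad_nonneg hM h0 (A ∘ₗ extendZero fun j => 0 ≤ w j)
    (hA.comp (extendZero_injective _)) fun c => ?_
  rw [LinearMap.comp_apply, h]
  refine Finset.sum_nonneg fun j _ => ?_
  by_cases hj : 0 ≤ w j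
  · exact mul_nonneg hj (sq_nonneg _)
  · simp [extendZero_apply_of_not (fun j => 0 ≤ w j) c j hj]

theorem quad_ofEigenCoord_extendZero {M : Matrix m m ℂ} (hM : M.IsHermitian) (p : m → Prop)
    (c : {j // p j} → ℂ) :
    quad M (ofEigenCoord hM (extendZero p c)) =
      ∑ i, hM.eigenvalues i * ‖extendZero p c i‖ ^ 2 := by
  simp [quad_eq_sum hM, eigenCoord_ofEigenCoord]

/-- The inertia is locally constant at nonsingular Hermitian matrices. -/
theorem eventually_rNeg_eq {M : Matrix m m ℂ} (hM : M.IsHermitian) (h0 : rZero hM = 0) :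
    ∀ᶠ M' in 𝓝 M, ∀ hM' : M'.IsHermitian, rNeg hM' = rNeg hM ∧ rZero hM' = 0 := by
  classical
  rw [rZero_eq_zero_iff] at h0
  -- `ε` bounds the spectrum away from zero. A perturbation whose form is smaller than `ε ‖v‖²`
  -- cannot change the sign of the form on the positive or on the negative spectral subspace.
  obtain ⟨ε, hε, hεM⟩ : ∃ ε > 0, ∀ i, ε ≤ |hM.eigenvalues i| := by
    rcases isEmpty_or_nonempty m with h | h
    · exact ⟨1, one_pos, fun i => h.elim i⟩
    · obtain ⟨i, hi⟩ := Finite.exists_min fun i => |hM.eigenvalues i|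
      exact ⟨_, abs_pos.2 (h0 i), hi⟩
  have hcont : Tendsto (fun M' : Matrix m m ℂ => ∑ i, ∑ j, ‖(M' - M) i j‖) (𝓝 M) (𝓝 0) := by
    have : Continuous fun M' : Matrix m m ℂ => ∑ i, ∑ j, ‖(M' - M) i j‖ := by
      refine continuous_finsetSum _ fun i _ => continuous_finsetSum _ fun j _ => ?_
      exact (((continuous_id.sub continuous_const).matrix_elem i j)).norm
    simpa using this.tendsto M
  filter_upwards [hcont.eventually (gt_mem_nhds hε)] with M' hM'lt hM'
  have hclose : ∀ v, v ≠ 0 → |quad M' v - quad M v| < ε * ∑ i, ‖v i‖ ^ 2 := by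
    intro v hv
    rw [← quad_sub]
    refine (abs_quad_le _ _).trans_lt (mul_lt_mul_of_pos_right hM'lt ?_)
    obtain ⟨i, hi⟩ := Function.ne_iff.1 hv
    have : ‖v i‖ ≠ 0 := norm_ne_zero_iff.2 hi
    exact Finset.sum_pos' (fun _ _ => sq_nonneg _) ⟨i, Finset.mem_univ i, by positivity⟩
  have hnorm : ∀ (p : m → Prop) (c : {j // p j} → ℂ),
      ∑ i, ‖ofEigenCoord hM (extendZero p c) i‖ ^ 2 = ∑ i, ‖extendZero p c i‖ ^ 2 := by
    intro p c
    rw [← sum_norm_sq_eigenCoord hM, eigenCoord_ofEigenCoord]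
  have hne : ∀ (p : m → Prop) (c : {j // p j} → ℂ), c ≠ 0 →
      ofEigenCoord hM (extendZero p c) ≠ 0 := by
    intro p c hc h
    have h' := congrArg (eigenCoord hM) h
    rw [eigenCoord_ofEigenCoord, map_zero, ← map_zero (extendZero p)] at h'
    exact hc (extendZero_injective p h')
  have h1 : rNeg hM ≤ rNeg hM' := by
    rw [rNeg, ← Fintype.card_subtype]
    refine card_le_rNeg hM' (ofEigenCoord hM ∘ₗ extendZero _) fun c hc => ?_
    have h2 := hclose _ (hne _ c hc)
    rw [hnorm, quad_ofEigenCoord_extendZero, abs_lt, Finset.mul_sum] at h2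
    have h3 : ∑ i, hM.eigenvalues i * ‖extendZero (fun i => hM.eigenvalues i < 0) c i‖ ^ 2 ≤
        - ∑ i, ε * ‖extendZero (fun i => hM.eigenvalues i < 0) c i‖ ^ 2 := by
      rw [← Finset.sum_neg_distrib]
      refine Finset.sum_le_sum fun i _ => ?_
      by_cases hi : hM.eigenvalues i < 0
      · have := hεM i
        rw [abs_of_neg hi] at this
        nlinarith [sq_nonneg ‖extendZero (fun i => hM.eigenvalues i < 0) c i‖]
      · simp [extendZero_apply_of_not (fun i => hM.eigenvalues i < 0) c i hi]
    rw [LinearMap.comp_apply]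
    linarith [h2.2]
  have h2 : rPos hM ≤ rPos hM' := by
    rw [rPos, ← Fintype.card_subtype]
    refine card_le_rPos hM' (ofEigenCoord hM ∘ₗ extendZero _) fun c hc => ?_
    have h2 := hclose _ (hne _ c hc)
    rw [hnorm, quad_ofEigenCoord_extendZero, abs_lt, Finset.mul_sum] at h2
    have h3 : ∑ i, ε * ‖extendZero (fun i => 0 < hM.eigenvalues i) c i‖ ^ 2 ≤
        ∑ i, hM.eigenvalues i * ‖extendZero (fun i => 0 < hM.eigenvalues i) c i‖ ^ 2 := by
      refine Finset.sum_le_sum fun i _ => ?_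
      by_cases hi : 0 < hM.eigenvalues i
      · have := hεM i
        rw [abs_of_pos hi] at this
        exact mul_le_mul_of_nonneg_right this (sq_nonneg _)
      · simp [extendZero_apply_of_not (fun i => 0 < hM.eigenvalues i) c i hi]
    rw [LinearMap.comp_apply]
    linarith [h2.1]
  -- Neither index can drop, and the indices of `M` already add up to the full dimension, so both
  -- are equal and nothing remains for the kernel of `M'`.
  have h3 := rPos_add_rNeg_add_rZero hM
  have h4 := rPos_add_rNeg_add_rZero hM'
  have h5 := (rZero_eq_zero_iff hM).2 h0
  omega

/-- The inertia of `U diag(w) U^*` for the eigenvector matrix `U` of a Hermitian matrix. -/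
theorem exists_eigenvalues_perturbation {M : Matrix m m ℂ} (hM : M.IsHermitian) (w : m → ℝ) :
    ∃ D : Matrix m m ℂ, D.IsHermitian ∧ ∀ ε : ℝ, ∀ h : (M + (ε : ℂ) • D).IsHermitian,
      ∀ (p : ℝ → Prop) [DecidablePred p],
        (Finset.univ.filter fun i => p (h.eigenvalues i)).card =
          (Finset.univ.filter fun i => p (hM.eigenvalues i + ε * w i)).card := by
  set U := hM.eigenvectorUnitary
  refine ⟨U * Matrix.diagonal (fun i => (w i : ℂ)) * star (U : Matrix m m ℂ), ?_, ?_⟩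
  · refine Matrix.isHermitian_mul_mul_conjTranspose _ ?_
    rw [Matrix.isHermitian_diagonal_iff]
    intro i
    simp [IsSelfAdjoint]
  · intro ε h p _
    have h1 : M + (ε : ℂ) • (U * Matrix.diagonal (fun i => (w i : ℂ)) * star (U : Matrix m m ℂ)) =
        U * Matrix.diagonal (fun i => ((hM.eigenvalues i + ε * w i : ℝ) : ℂ)) *
          star (U : Matrix m m ℂ) := by
      conv_lhs => enter [1]; rw [hM.spectral_theorem, Unitary.conjStarAlgAut_apply]
      rw [← Matrix.smul_mul, ← Matrix.mul_smul, ← add_mul, ← mul_add, ← Matrix.diagonal_smul,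
        Matrix.diagonal_add]
      congr 3
      ext i
      simp
    -- The enumeration of the new eigenvalues is unrelated to the index `i` of `hM.eigenvalues i + ε
    -- * w i`. Only the multisets agree, as roots of the characteristic polynomial, hence a
    -- conclusion about cardinalities.
    have h2 := h.roots_charpoly_eq_eigenvalues
    have h3 : (M + (ε : ℂ) • (U * Matrix.diagonal (fun i => (w i : ℂ)) *
        star (U : Matrix m m ℂ))).charpoly =
        (Matrix.diagonal (fun i => ((hM.eigenvalues i + ε * w i : ℝ) : ℂ))).charpoly := by
      rw [h1, Matrix.charpoly_mul_comm, ← mul_assoc]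
      simp
    rw [h3, Matrix.charpoly_diagonal, Polynomial.roots_prod _ _
      (Finset.prod_ne_zero_iff.2 fun i _ => Polynomial.X_sub_C_ne_zero _)] at h2
    simp only [Polynomial.roots_X_sub_C, Multiset.bind_singleton] at h2
    have h4 := congrArg (fun s => (s.map Complex.re).countP p) h2
    simpa [Multiset.countP_map, Finset.card_def] using h4.symm

end Inertia

/-! ### Eigenvectors of self-adjoint linear relations -/

section Relation

variable {V E : Type*} [AddCommGroup V] [Module ℂ V] [FiniteDimensional ℂ V]
  [NormedAddCommGroup E] [InnerProductSpace ℂ E] [FiniteDimensional ℂ E]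

open Module in
/-- The spectral theorem for the self-adjoint linear relation `{(U v, F v)}`. -/
theorem exists_eigenvectors_of_selfAdjoint_relation (U F : V →ₗ[ℂ] E)
    (hsymm : ∀ v w, inner ℂ (U v) (F w) = inner ℂ (F v) (U w))
    (hinj : ∀ v, U v = 0 → F v = 0 → v = 0) (hdim : finrank ℂ V = finrank ℂ E) :
    ∃ (k : ℕ) (e : Fin k → ℝ) (v : Fin k → V), k + finrank ℂ (LinearMap.ker U) = finrank ℂ V ∧
      Orthonormal ℂ (U ∘ v) ∧ (∀ i, F (v i) = (e i : ℂ) • U (v i)) ∧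
      ∀ z : ℂ, finrank ℂ (LinearMap.ker (F - z • U)) =
        (Finset.univ.filter fun i => (e i : ℂ) = z).card := by
  classical
  -- `D` is the domain of the relation, and its multivalued part `F (ker U)` will turn out to be
  -- `Dᗮ`. On `V₀ = F⁻¹ D` the map `U` is a bijection onto `D`, and `F U⁻¹` is an ordinary symmetric
  -- operator on `D`.
  set D := LinearMap.range U with hD
  set V₀ := D.comap F with hV₀
  have hperp : ∀ w, U w = 0 → F w ∈ Dᗮ := by
    intro w hw
    rw [Submodule.mem_orthogonal]
    rintro _ ⟨v, rfl⟩
    rw [hsymm, hw, inner_zero_right]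
  have hUinj : ∀ v ∈ V₀, U v = 0 → v = 0 := by
    intro v hv h0
    refine hinj v h0 ?_
    have h2 : F v ∈ D ⊓ Dᗮ := ⟨hv, hperp v h0⟩
    rwa [Submodule.inf_orthogonal_eq_bot, Submodule.mem_bot] at h2
  -- Here maximality enters: `F` is injective on `ker U`, whose dimension is `dim V - dim D = dim E
  -- - dim D`.
  have hker : (LinearMap.ker U).map F = Dᗮ := by
    refine Submodule.eq_of_le_of_finrank_eq ?_ ?_
    · rintro _ ⟨w, hw, rfl⟩
      exact hperp w hw
    · have h1 : finrank ℂ ((LinearMap.ker U).map F) = finrank ℂ (LinearMap.ker U) := by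
        rw [← LinearMap.range_domRestrict]
        refine LinearMap.finrank_range_of_inj ?_
        rw [← LinearMap.ker_eq_bot, LinearMap.ker_eq_bot']
        rintro ⟨w, hw⟩ h
        exact Subtype.ext (hinj w hw h)
      have h2 := LinearMap.finrank_range_add_finrank_ker U
      have h3 := Submodule.finrank_add_finrank_orthogonal D
      rw [← hD] at h2
      omega
  -- The component of `F v` in `Dᗮ` equals `F w` for some `w ∈ ker U`; subtracting `w` removes it
  -- without changing `U v`.
  have hsurj : ∀ v, ∃ v₀ ∈ V₀, U v₀ = U v := by
    intro v
    have h1 : Dᗮ.starProjection (F v) ∈ (LinearMap.ker U).map F := by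
      rw [hker]
      exact Submodule.starProjection_apply_mem _ _
    obtain ⟨w, hw, hw'⟩ := h1
    refine ⟨v - w, ?_, ?_⟩
    · rw [hV₀, Submodule.mem_comap, map_sub, hw']
      have h2 := DFunLike.congr_fun
        (Submodule.id_eq_sum_starProjection_self_orthogonalComplement (K := D)) (F v)
      rw [ContinuousLinearMap.id_apply, add_apply, ← sub_eq_iff_eq_add] at h2
      rw [h2]
      exact Submodule.starProjection_apply_mem _ _
    · rw [map_sub, LinearMap.mem_ker.1 hw, sub_zero]
  let U₀ : V₀ →ₗ[ℂ] D := U.rangeRestrict ∘ₗ V₀.subtype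
  have hU₀ : Function.Bijective U₀ := by
    constructor
    · rw [← LinearMap.ker_eq_bot, LinearMap.ker_eq_bot']
      rintro ⟨v, hv⟩ h
      exact Subtype.ext (hUinj v hv (congrArg Subtype.val h))
    · rintro ⟨_, v, rfl⟩
      obtain ⟨v₀, h1, h2⟩ := hsurj v
      exact ⟨⟨v₀, h1⟩, Subtype.ext h2⟩
  let φ : V₀ ≃ₗ[ℂ] D := LinearEquiv.ofBijective U₀ hU₀
  have hφ : ∀ x : D, U (φ.symm x) = x := fun x => congrArg Subtype.val (φ.apply_symm_apply x)
  let T : D →ₗ[ℂ] D := (F.restrict (p := V₀) (q := D) fun v hv => hv) ∘ₗ φ.symm.toLinearMap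
  have hTF : ∀ x : D, (T x : E) = F (φ.symm x) := fun x => rfl
  have hT : T.IsSymmetric := by
    intro x y
    rw [Submodule.coe_inner, Submodule.coe_inner, hTF, hTF, ← hφ x, ← hφ y]
    simpa using (hsymm _ _).symm
  let b := hT.eigenvectorBasis rfl
  let e := hT.eigenvalues rfl
  let v : Fin (finrank ℂ D) → V := fun i => φ.symm (b i)
  have hUv : ∀ i, U (v i) = b i := fun i => hφ _
  have hortho : Orthonormal ℂ (U ∘ v) := by
    have : U ∘ v = D.subtypeₗᵢ ∘ b := by
      ext i
      exact hUv i
    rw [this]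
    exact b.orthonormal.comp_linearIsometry _
  have hFv : ∀ i, F (v i) = (e i : ℂ) • U (v i) := by
    intro i
    have h := congrArg Subtype.val (hT.apply_eigenvectorBasis rfl i)
    rw [hUv]
    exact h
  refine ⟨finrank ℂ D, e, v, LinearMap.finrank_range_add_finrank_ker U, hortho, hFv, ?_⟩
  intro z
  have hli : LinearIndependent ℂ v := LinearIndependent.of_comp U hortho.linearIndependent
  -- A vector with `F x = z U x` lies in `V₀` automatically, and symmetry kills its components along
  -- the `v i` with `e i ≠ z`. For nonreal `z` the span is zero.
  have hspan : LinearMap.ker (F - z • U) =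
      Submodule.span ℂ (Set.range fun i : {i // (e i : ℂ) = z} => v i) := by
    refine le_antisymm (fun x hx => ?_) ?_
    · rw [LinearMap.mem_ker, LinearMap.sub_apply, LinearMap.smul_apply, sub_eq_zero] at hx
      have hxV : x ∈ V₀ := by
        rw [hV₀, Submodule.mem_comap, hx]
        exact D.smul_mem _ ⟨x, rfl⟩
      have hc : ∀ i, inner ℂ (U (v i)) (U x) ≠ 0 → (e i : ℂ) = z := by
        intro i hi
        have h1 := hsymm (v i) x
        rw [hx, hFv, inner_smul_left, inner_smul_right, Complex.conj_ofReal] at h1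
        exact (mul_right_cancel₀ hi h1).symm
      have hsum : x = ∑ i, inner ℂ (U (v i)) (U x) • v i := by
        rw [← sub_eq_zero]
        refine hUinj _ (V₀.sub_mem hxV (V₀.sum_mem fun i _ => V₀.smul_mem _ (φ.symm (b i)).2)) ?_
        have h1 := congrArg Subtype.val (b.sum_repr' ⟨U x, x, rfl⟩)
        rw [map_sub, map_sum, sub_eq_zero]
        simp only [map_smul, hUv]
        simpa using h1.symm
      rw [hsum]
      refine Submodule.sum_mem _ fun i _ => ?_
      by_cases hi : inner ℂ (U (v i)) (U x) = 0
      · rw [hi, zero_smul]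
        exact Submodule.zero_mem _
      · exact Submodule.smul_mem _ _ (Submodule.subset_span ⟨⟨i, hc i hi⟩, rfl⟩)
    · rw [Submodule.span_le]
      rintro _ ⟨⟨i, hi⟩, rfl⟩
      rw [SetLike.mem_coe, LinearMap.mem_ker, LinearMap.sub_apply, LinearMap.smul_apply, hFv, hi,
        sub_self]
  rw [hspan, ← Fintype.card_subtype]
  exact finrank_span_eq_card (hli.comp _ Subtype.val_injective)

end Relation

/-! ### The topology of the space of boundary conditions -/

section Boundary

variable {d : ℕ}

theorem BoundarySpace.exists_rep (κ : BoundarySpace d) : ∃ p, BoundarySpace.mk p = κ :=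
  Quotient.exists_rep κ

theorem BoundarySpace.mk_eq_mk_iff {p q : BoundaryPair d} :
    BoundarySpace.mk p = BoundarySpace.mk q ↔
      ∃ T : Matrix (Idx d) (Idx d) ℂ, IsUnit T ∧ q.1.1 = T * p.1.1 ∧ q.1.2 = T * p.1.2 :=
  Quotient.eq

theorem BoundarySpace.continuous_mk : Continuous (BoundarySpace.mk (d := d)) :=
  continuous_quotient_mk'

/-- The action of `GL(2d, ℂ)` on pairs. -/
def BoundaryPair.act (T : (Matrix (Idx d) (Idx d) ℂ)ˣ) (p : BoundaryPair d) : BoundaryPair d :=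
  ⟨(T * p.1.1, T * p.1.2), by
    have h : Matrix.fromCols ((T : Matrix (Idx d) (Idx d) ℂ) * p.1.1)
        ((T : Matrix (Idx d) (Idx d) ℂ) * p.1.2) =
        (T : Matrix (Idx d) (Idx d) ℂ) * Matrix.fromCols p.1.1 p.1.2 :=
      (Matrix.mul_fromCols _ _ _).symm
    rw [h, Matrix.rank_mul_eq_right_of_isUnit_det _ _
      ((Matrix.isUnit_iff_isUnit_det _).1 T.isUnit)]
    exact p.2.1, by
    simp only [Matrix.conjTranspose_mul, mul_assoc]
    rw [← mul_assoc p.1.1, p.2.2, mul_assoc]⟩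

theorem BoundaryPair.continuous_act (T : (Matrix (Idx d) (Idx d) ℂ)ˣ) :
    Continuous (BoundaryPair.act T) := by
  refine Continuous.subtype_mk ?_ _
  exact (continuous_const.matrix_mul (continuous_fst.comp continuous_subtype_val)).prodMk
    (continuous_const.matrix_mul (continuous_snd.comp continuous_subtype_val))

/-- The saturation of an open set is a union of its preimages under the homeomorphisms given by
`GL(2d, ℂ)`. Openness lets neighbourhoods in the quotient be tested on representatives. -/
theorem BoundarySpace.isOpenMap_mk : IsOpenMap (BoundarySpace.mk (d := d)) := by
  intro s hs
  have h : BoundarySpace.mk ⁻¹' (BoundarySpace.mk '' s) =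
      ⋃ T : (Matrix (Idx d) (Idx d) ℂ)ˣ, BoundaryPair.act T ⁻¹' s := by
    ext p
    simp only [mem_preimage, mem_image, mem_iUnion]
    constructor
    · rintro ⟨q, hq, hqp⟩
      obtain ⟨T, ⟨U, rfl⟩, h1, h2⟩ := BoundarySpace.mk_eq_mk_iff.1 hqp.symm
      have : BoundaryPair.act U p = q := Subtype.ext (Prod.ext h1.symm h2.symm)
      exact ⟨U, this ▸ hq⟩
    · rintro ⟨T, hT⟩
      exact ⟨_, hT, (BoundarySpace.mk_eq_mk_iff.2 ⟨T, T.isUnit, rfl, rfl⟩).symm⟩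
  change IsOpen (BoundarySpace.mk ⁻¹' (BoundarySpace.mk '' s))
  rw [h]
  exact isOpen_iUnion fun T => hs.preimage (BoundaryPair.continuous_act T)

theorem BoundarySpace.nhds_mk (p : BoundaryPair d) :
    𝓝 (BoundarySpace.mk p) = map BoundarySpace.mk (𝓝 p) :=
  (BoundarySpace.isOpenMap_mk.nhds_le p).antisymm BoundarySpace.continuous_mk.continuousAt

/-! ### Boundary conditions as Lagrangian subspaces -/

theorem BoundarySpace.holds_mk (p : BoundaryPair d) (x z : Idx d → ℂ) :
    (BoundarySpace.mk p).Holds x z ↔ p.1.1 *ᵥ x + p.1.2 *ᵥ z = 0 := Iff.rfl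

/-- The pairs of boundary values that satisfy a boundary condition. -/
def BoundarySpace.lagrangian (κ : BoundarySpace d) :
    Submodule ℂ ((Idx d → ℂ) × (Idx d → ℂ)) where
  carrier := {p | κ.Holds p.1 p.2}
  zero_mem' := by
    obtain ⟨p, rfl⟩ := κ.exists_rep
    simp [BoundarySpace.holds_mk]
  add_mem' := by
    obtain ⟨p, rfl⟩ := κ.exists_rep
    rintro ⟨x, z⟩ ⟨x', z'⟩ h h'
    simp only [mem_ofPred_eq, BoundarySpace.holds_mk] at h h'
    simp only [mem_ofPred_eq, BoundarySpace.holds_mk, Prod.mk_add_mk, Matrix.mulVec_add]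
    rw [add_add_add_comm, h, h', add_zero]
  smul_mem' := by
    obtain ⟨p, rfl⟩ := κ.exists_rep
    rintro c ⟨x, z⟩ h
    simp only [mem_ofPred_eq, BoundarySpace.holds_mk] at h
    simp only [mem_ofPred_eq, BoundarySpace.holds_mk, Prod.smul_mk, Matrix.mulVec_smul]
    rw [← smul_add, h, smul_zero]

theorem card_idx : Fintype.card (Idx d) = 2 * d := by simp [two_mul]

/-- The linear map `(x, z) ↦ A x + B z`. -/
def BoundaryPair.toLin (p : BoundaryPair d) :
    ((Idx d → ℂ) × (Idx d → ℂ)) →ₗ[ℂ] (Idx d → ℂ) :=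
  p.1.1.mulVecLin.coprod p.1.2.mulVecLin

theorem BoundaryPair.toLin_apply (p : BoundaryPair d) (x z : Idx d → ℂ) :
    p.toLin (x, z) = p.1.1 *ᵥ x + p.1.2 *ᵥ z := by
  simp [BoundaryPair.toLin]

theorem BoundaryPair.range_toLin (p : BoundaryPair d) : LinearMap.range p.toLin = ⊤ := by
  apply Submodule.eq_top_of_finrank_eq
  have h : LinearMap.range p.toLin =
      LinearMap.range (Matrix.fromCols p.1.1 p.1.2).mulVecLin := by
    ext y
    simp only [LinearMap.mem_range, Prod.exists, BoundaryPair.toLin_apply,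
      Matrix.mulVecLin_apply]
    constructor
    · rintro ⟨x, z, rfl⟩
      exact ⟨Sum.elim x z, by rw [Matrix.fromCols_mulVec]; rfl⟩
    · rintro ⟨v, rfl⟩
      exact ⟨v ∘ Sum.inl, v ∘ Sum.inr, by rw [Matrix.fromCols_mulVec]⟩
  rw [h, Module.finrank_fintype_fun_eq_card, card_idx]
  exact p.2.1

theorem BoundaryPair.eq_zero_of_conjTranspose_mulVec (p : BoundaryPair d) (y : Idx d → ℂ)
    (h1 : p.1.1ᴴ *ᵥ y = 0) (h2 : p.1.2ᴴ *ᵥ y = 0) : y = 0 := by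
  obtain ⟨⟨x, z⟩, hxz⟩ : y ∈ LinearMap.range p.toLin := by simp [p.range_toLin]
  rw [BoundaryPair.toLin_apply] at hxz
  rw [← dotProduct_star_self_eq_zero (v := y)]
  have h1' : star y ᵥ* p.1.1 = 0 := by simpa [Matrix.star_mulVec] using congrArg star h1
  have h2' : star y ᵥ* p.1.2 = 0 := by simpa [Matrix.star_mulVec] using congrArg star h2
  conv_lhs => enter [2]; rw [← hxz]
  rw [dotProduct_add, Matrix.dotProduct_mulVec, Matrix.dotProduct_mulVec, h1', h2']
  simp

/-- The map `y ↦ (B^* y, -A^* y)` goes into `ker (A, B)` because `A B^* = B A^*`, and it is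
injective because of the rank condition. Both spaces have dimension `2d`. -/
theorem BoundarySpace.holds_mk_iff_exists (p : BoundaryPair d) (x z : Idx d → ℂ) :
    (BoundarySpace.mk p).Holds x z ↔ ∃ y, x = p.1.2ᴴ *ᵥ y ∧ z = -(p.1.1ᴴ *ᵥ y) := by
  let f : (Idx d → ℂ) →ₗ[ℂ] ((Idx d → ℂ) × (Idx d → ℂ)) :=
    p.1.2ᴴ.mulVecLin.prod (-p.1.1ᴴ.mulVecLin)
  have hf : ∀ y, f y = (p.1.2ᴴ *ᵥ y, -(p.1.1ᴴ *ᵥ y)) := fun y => rfl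
  have hle : LinearMap.range f ≤ LinearMap.ker p.toLin := by
    rintro _ ⟨y, rfl⟩
    rw [LinearMap.mem_ker, hf, BoundaryPair.toLin_apply, Matrix.mulVec_neg, Matrix.mulVec_mulVec,
      Matrix.mulVec_mulVec, p.2.2, add_neg_cancel]
  have hinj : Function.Injective f := by
    rw [← LinearMap.ker_eq_bot, LinearMap.ker_eq_bot']
    intro y hy
    rw [hf, Prod.mk_eq_zero, neg_eq_zero] at hy
    exact p.eq_zero_of_conjTranspose_mulVec y hy.2 hy.1
  have heq : LinearMap.range f = LinearMap.ker p.toLin := by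
    refine Submodule.eq_of_le_of_finrank_eq hle ?_
    have h1 := LinearMap.finrank_range_add_finrank_ker p.toLin
    rw [p.range_toLin, finrank_top, Module.finrank_prod] at h1
    rw [LinearMap.finrank_range_of_inj hinj]
    omega
  have h2 : (x, z) ∈ LinearMap.ker p.toLin ↔ (BoundarySpace.mk p).Holds x z := by
    rw [LinearMap.mem_ker, BoundaryPair.toLin_apply, BoundarySpace.holds_mk]
  rw [← h2, ← heq, LinearMap.mem_range]
  simp only [hf, Prod.mk.injEq, eq_comm]

/-- The boundary conditions are isotropic. -/
theorem BoundarySpace.Holds.isotropic {κ : BoundarySpace d} {x z x' z' : Idx d → ℂ}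
    (h : κ.Holds x z) (h' : κ.Holds x' z') : star x ⬝ᵥ z' = star z ⬝ᵥ x' := by
  obtain ⟨p, rfl⟩ := κ.exists_rep
  obtain ⟨y, rfl, rfl⟩ := (BoundarySpace.holds_mk_iff_exists p x z).1 h
  obtain ⟨y', rfl, rfl⟩ := (BoundarySpace.holds_mk_iff_exists p x' z').1 h'
  simp only [star_neg, Matrix.star_mulVec, Matrix.conjTranspose_conjTranspose, dotProduct_neg,
    neg_dotProduct, ← Matrix.dotProduct_mulVec, Matrix.mulVec_mulVec, p.2.2]

/-- The kernel of `B` is the intersection of the Lagrangian subspace with `{0} × ℂ^{2d}`, a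
description free of representatives. -/
theorem BoundarySpace.nullityB_eq_finrank (κ : BoundarySpace d) (N : Submodule ℂ (Idx d → ℂ))
    (hN : ∀ z, z ∈ N ↔ κ.Holds 0 z) : κ.nullityB = Module.finrank ℂ N := by
  obtain ⟨p, rfl⟩ := κ.exists_rep
  have h : LinearMap.ker p.1.2.mulVecLin = N := by
    ext z
    rw [hN, BoundarySpace.holds_mk]
    simp
  rw [← h]
  rfl

/-! ### Charts -/

theorem diagK_mulVec (K : Finset (Idx d)) (x : Idx d → ℂ) (i : Idx d) :
    (diagK K *ᵥ x) i = if i ∈ K then 0 else x i := by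
  rw [diagK, Matrix.mulVec_diagonal]
  split_ifs <;> simp

/-- `E_K` exchanges, up to sign, the roles of `x i` and `z i` for `i ∈ K`. In the exchanged
coordinates the Lagrangian subspace is the graph of `-S`, with the sign absorbed on `K`. -/
theorem chart_holds_iff (K : Finset (Idx d)) {S : Matrix (Idx d) (Idx d) ℂ} (hS : S.IsHermitian)
    (x z : Idx d → ℂ) : (chart K S hS).Holds x z ↔
      ∀ i, (S *ᵥ fun j => if j ∈ K then z j else x j) i = if i ∈ K then x i else - z i := by
  have h1 : (fun j => if j ∈ K then z j else x j) = diagK K *ᵥ x + (z - diagK K *ᵥ z) := by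
    ext j
    simp only [Pi.add_apply, Pi.sub_apply, diagK_mulVec]
    split_ifs <;> simp
  rw [chart, BoundarySpace.holds_mk, h1, funext_iff]
  refine forall_congr' fun i => ?_
  simp only [chartA_eq, chartB_eq, Matrix.add_mulVec, Matrix.sub_mulVec, Matrix.one_mulVec,
    ← Matrix.mulVec_mulVec, Matrix.mulVec_add, Matrix.mulVec_sub, Pi.add_apply, Pi.sub_apply,
    diagK_mulVec, Pi.zero_apply]
  rw [← sub_eq_zero (b := if i ∈ K then x i else - z i)]
  split_ifs
  · ring_nf
  · ring_nf

/-- `E_K` is unitary and can be moved to the other side. The unknown `T` is then visible as the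
second block, which gives the coordinate formula `S = T⁻¹ (T S)`. -/
theorem chart_eq_mk_iff (K : Finset (Idx d)) {S : Matrix (Idx d) (Idx d) ℂ} (hS : S.IsHermitian)
    (p : BoundaryPair d) : BoundarySpace.mk p = chart K S hS ↔
      ∃ T : Matrix (Idx d) (Idx d) ℂ, IsUnit T ∧
        (Matrix.fromCols p.1.1 p.1.2) * (matE K)ᴴ = Matrix.fromCols (T * S) T := by
  have hE : (matE K)ᴴ * matE K = 1 := mul_eq_one_comm.1 (matE_mul_conjTranspose K)
  rw [eq_comm, chart, BoundarySpace.mk_eq_mk_iff]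
  refine exists_congr fun T => and_congr_right fun _ => ?_
  have h1 : Matrix.fromCols (T * S) T = T * Matrix.fromCols S 1 := by
    rw [Matrix.mul_fromCols, mul_one]
  constructor
  · rintro ⟨h2, h3⟩
    simp only at h2 h3
    rw [h2, h3, ← Matrix.mul_fromCols, fromCols_chart, h1, Matrix.mul_assoc, Matrix.mul_assoc,
      matE_mul_conjTranspose, Matrix.mul_one]
  · intro h
    have h2 : Matrix.fromCols p.1.1 p.1.2 = T * Matrix.fromCols (chartA K S) (chartB K S) := by
      rw [fromCols_chart, ← Matrix.mul_assoc, ← h1, ← h, Matrix.mul_assoc, hE, Matrix.mul_one]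
    rw [Matrix.mul_fromCols] at h2
    exact ⟨by simpa using congrArg Matrix.toCols₁ h2, by simpa using congrArg Matrix.toCols₂ h2⟩

/-- The matrix `S` of a boundary condition in the chart `O_K`, as a function of `(A, B)`. -/
def BoundaryPair.coord (K : Finset (Idx d)) (p : BoundaryPair d) : Matrix (Idx d) (Idx d) ℂ :=
  ((Matrix.fromCols p.1.1 p.1.2) * (matE K)ᴴ).toCols₂⁻¹ *
    ((Matrix.fromCols p.1.1 p.1.2) * (matE K)ᴴ).toCols₁

theorem BoundaryPair.coord_eq {K : Finset (Idx d)} {S : Matrix (Idx d) (Idx d) ℂ}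
    {hS : S.IsHermitian} {p : BoundaryPair d} (h : BoundarySpace.mk p = chart K S hS) :
    p.coord K = S := by
  obtain ⟨T, hT, h⟩ := (chart_eq_mk_iff K hS p).1 h
  rw [BoundaryPair.coord, h, Matrix.toCols₁_fromCols, Matrix.toCols₂_fromCols, ← mul_assoc,
    Matrix.nonsing_inv_mul _ ((Matrix.isUnit_iff_isUnit_det _).1 hT), one_mul]

theorem continuousAt_inv_mul {X m : Type*} [TopologicalSpace X] [Fintype m] [DecidableEq m]
    {f g : X → Matrix m m ℂ} {x : X} (hf : ContinuousAt f x) (hg : ContinuousAt g x)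
    (hu : IsUnit (f x)) : Tendsto (fun y => (f y)⁻¹ * g y) (𝓝 x) (𝓝 ((f x)⁻¹ * g x)) := by
  have h1 : ContinuousAt (fun M : Matrix m m ℂ => M⁻¹) (f x) := by
    refine continuousAt_matrix_inv _ ?_
    rw [Ring.inverse_eq_inv']
    exact continuousAt_inv₀ ((Matrix.isUnit_iff_isUnit_det _).1 hu).ne_zero
  have h2 : Tendsto (fun y => (f y)⁻¹) (𝓝 x) (𝓝 (f x)⁻¹) := Tendsto.comp h1 hf
  exact h2.mul hg

theorem BoundaryPair.continuous_fromCols_mul (K : Finset (Idx d)) :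
    Continuous fun q : BoundaryPair d => (Matrix.fromCols q.1.1 q.1.2) * (matE K)ᴴ := by
  refine Continuous.matrix_mul ?_ continuous_const
  refine continuous_matrix fun i j => ?_
  rcases j with j | j
  · exact (continuous_fst.comp continuous_subtype_val).matrix_elem i j
  · exact (continuous_snd.comp continuous_subtype_val).matrix_elem i j

theorem BoundaryPair.continuous_toCols₂ (K : Finset (Idx d)) : Continuous fun p : BoundaryPair d =>
    ((Matrix.fromCols p.1.1 p.1.2) * (matE K)ᴴ).toCols₂ :=
  continuous_matrix fun i j => (BoundaryPair.continuous_fromCols_mul K).matrix_elem i (Sum.inr j)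

theorem BoundaryPair.continuousAt_coord {K : Finset (Idx d)} {S : Matrix (Idx d) (Idx d) ℂ}
    {hS : S.IsHermitian} {p : BoundaryPair d} (h : BoundarySpace.mk p = chart K S hS) :
    ContinuousAt (BoundaryPair.coord K) p := by
  obtain ⟨T, hT, h⟩ := (chart_eq_mk_iff K hS p).1 h
  have h1 : Continuous fun q : BoundaryPair d =>
      ((Matrix.fromCols q.1.1 q.1.2) * (matE K)ᴴ).toCols₁ :=
    continuous_matrix fun i j => (BoundaryPair.continuous_fromCols_mul K).matrix_elem i (Sum.inl j)
  refine continuousAt_inv_mul (BoundaryPair.continuous_toCols₂ K).continuousAt h1.continuousAt ?_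
  rw [h, Matrix.toCols₂_fromCols]
  exact hT

/-- Continuity of the inverse chart: `coord` is continuous on representatives, and the quotient map
carries their neighbourhoods to neighbourhoods. -/
theorem eventually_chart {K : Finset (Idx d)} {S : Matrix (Idx d) (Idx d) ℂ} (hS : S.IsHermitian)
    {P : Matrix (Idx d) (Idx d) ℂ → Prop} (hP : ∀ᶠ S' in 𝓝 S, P S') :
    ∀ᶠ κ in 𝓝 (chart K S hS), ∀ S' hS', κ = chart K S' hS' → P S' := by
  obtain ⟨p, hp⟩ := (chart K S hS).exists_rep
  rw [← hp, BoundarySpace.nhds_mk, eventually_map]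
  have h := BoundaryPair.continuousAt_coord hp
  rw [ContinuousAt, BoundaryPair.coord_eq hp] at h
  filter_upwards [h.eventually hP] with q hq S' hS' hqS'
  rwa [BoundaryPair.coord_eq hqS'] at hq

theorem BoundaryPair.toCols₂_eq (K : Finset (Idx d)) (p : BoundaryPair d) :
    ((Matrix.fromCols p.1.1 p.1.2) * (matE K)ᴴ).toCols₂ =
      p.1.1 * (diagK K - 1) + p.1.2 * diagK K := by
  rw [matE, Matrix.fromBlocks_conjTranspose, Matrix.fromCols_mul_fromBlocks,
    Matrix.toCols₂_fromCols]
  simp only [Matrix.conjTranspose_sub, Matrix.conjTranspose_one, diagK_conjTranspose]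

/-- Multiplication by `E_K^*` preserves the relation `A B^* = B A^*`. For the new pair `(X, Y)` with
`Y` invertible this relation says that `Y⁻¹ X` is Hermitian. -/
theorem exists_eq_chart_of_isUnit (K : Finset (Idx d)) (p : BoundaryPair d)
    (hY : IsUnit ((Matrix.fromCols p.1.1 p.1.2) * (matE K)ᴴ).toCols₂) :
    ∃ (S : Matrix (Idx d) (Idx d) ℂ) (hS : S.IsHermitian), BoundarySpace.mk p = chart K S hS := by
  have hD := diagK_mul_self K
  have hD' : ∀ X : Matrix (Idx d) (Idx d) ℂ, diagK K * (diagK K * X) = diagK K * X := by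
    intro X
    rw [← mul_assoc, hD]
  rw [BoundaryPair.toCols₂_eq] at hY
  set X := p.1.1 * diagK K + p.1.2 * (1 - diagK K) with hX
  set Y := p.1.1 * (diagK K - 1) + p.1.2 * diagK K with hYdef
  have hXY : (Matrix.fromCols p.1.1 p.1.2) * (matE K)ᴴ = Matrix.fromCols X Y := by
    rw [matE, Matrix.fromBlocks_conjTranspose, Matrix.fromCols_mul_fromBlocks]
    simp only [Matrix.conjTranspose_sub, Matrix.conjTranspose_one, diagK_conjTranspose, hX, hYdef]
  have hsymm : X * Yᴴ = Y * Xᴴ := by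
    have e := p.2.2
    rw [← sub_eq_zero] at e ⊢
    rw [← e, hX, hYdef]
    simp only [Matrix.conjTranspose_add, Matrix.conjTranspose_mul, Matrix.conjTranspose_sub,
      diagK_conjTranspose, mul_add, add_mul, mul_sub, sub_mul, mul_one, mul_assoc, hD']
    abel
  have hdet := (Matrix.isUnit_iff_isUnit_det _).1 hY
  have hS : (Y⁻¹ * X).IsHermitian := by
    rw [Matrix.IsHermitian, Matrix.conjTranspose_mul, Matrix.conjTranspose_nonsing_inv]
    have h1 : Yᴴ * (Yᴴ)⁻¹ = 1 := by
      rw [← Matrix.conjTranspose_nonsing_inv, ← Matrix.conjTranspose_mul,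
        Matrix.nonsing_inv_mul _ hdet, Matrix.conjTranspose_one]
    calc Xᴴ * (Yᴴ)⁻¹ = Y⁻¹ * (Y * Xᴴ) * (Yᴴ)⁻¹ := by
          rw [← mul_assoc, Matrix.nonsing_inv_mul _ hdet, one_mul]
      _ = Y⁻¹ * X := by rw [← hsymm, mul_assoc, mul_assoc X, h1, mul_one]
  refine ⟨Y⁻¹ * X, hS, (chart_eq_mk_iff K hS p).2 ⟨Y, hY, ?_⟩⟩
  rw [hXY, ← mul_assoc, Matrix.mul_nonsing_inv _ hdet, one_mul]

/-- The hypothesis is transversality to the coordinate Lagrangian of the `(x, z)` with `x` supported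
on `K` and `z` off `K`. A kernel vector `y` of the second block would give such a pair, its
restrictions `-y` to `K` and `y` off `K`. -/
theorem exists_eq_chart (K : Finset (Idx d)) (κ : BoundarySpace d)
    (h : ∀ x z, κ.Holds x z → (∀ i ∉ K, x i = 0) → (∀ i ∈ K, z i = 0) → x = 0 ∧ z = 0) :
    ∃ (S : Matrix (Idx d) (Idx d) ℂ) (hS : S.IsHermitian), κ = chart K S hS := by
  obtain ⟨p, rfl⟩ := κ.exists_rep
  refine exists_eq_chart_of_isUnit K p ?_
  rw [BoundaryPair.toCols₂_eq]
  set Y := p.1.1 * (diagK K - 1) + p.1.2 * diagK K with hY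
  rw [← Matrix.mulVec_injective_iff_isUnit]
  change Function.Injective Y.mulVecLin
  rw [← LinearMap.ker_eq_bot, LinearMap.ker_eq_bot']
  intro y hy
  rw [Matrix.mulVecLin_apply, hY, Matrix.add_mulVec, ← Matrix.mulVec_mulVec,
    ← Matrix.mulVec_mulVec] at hy
  have h1 := h _ _ hy (fun i hi => by simp [Matrix.sub_mulVec, diagK_mulVec, hi])
    (fun i hi => by simp [diagK_mulVec, hi])
  have h2 : y = diagK K *ᵥ y - (diagK K - 1) *ᵥ y := by
    rw [Matrix.sub_mulVec, Matrix.one_mulVec]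
    abel
  rw [h2, h1.1, h1.2, sub_zero]

theorem chartDomain_mem_nhds {K : Finset (Idx d)} {S : Matrix (Idx d) (Idx d) ℂ}
    (hS : S.IsHermitian) : chartDomain K ∈ 𝓝 (chart K S hS) := by
  obtain ⟨p, hp⟩ := (chart K S hS).exists_rep
  obtain ⟨T, hT, h⟩ := (chart_eq_mk_iff K hS p).1 hp
  have h1 := (BoundaryPair.continuous_toCols₂ K).matrix_det.continuousAt (x := p)
  have h2 : ∀ᶠ q : BoundaryPair d in 𝓝 p,
      ((Matrix.fromCols q.1.1 q.1.2) * (matE K)ᴴ).toCols₂.det ≠ 0 := by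
    refine h1.eventually_ne ?_
    rw [h, Matrix.toCols₂_fromCols]
    exact ((Matrix.isUnit_iff_isUnit_det _).1 hT).ne_zero
  rw [← hp, BoundarySpace.nhds_mk, mem_map]
  filter_upwards [h2] with q hq
  exact exists_eq_chart_of_isUnit K q ((Matrix.isUnit_iff_isUnit_det _).2 (isUnit_iff_ne_zero.2 hq))

theorem compress_eq (K : Finset (Idx d)) (S : Matrix (Idx d) (Idx d) ℂ) :
    compress K S = S.submatrix Subtype.val Subtype.val := by
  ext i j
  simp [compress, colE, Matrix.mul_apply, Matrix.one_apply]

theorem colE_mulVec (K : Finset (Idx d)) (ζ : {i // i ∈ K} → ℂ) (i : Idx d) :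
    (colE K *ᵥ ζ) i = if h : i ∈ K then ζ ⟨i, h⟩ else 0 := by
  simp only [colE, Matrix.mulVec, dotProduct, Matrix.submatrix_apply, id, Matrix.one_apply]
  split_ifs with h
  · rw [Finset.sum_eq_single ⟨i, h⟩]
    · simp
    · intro j _ hj
      rw [if_neg (fun e => hj (Subtype.ext e.symm)), zero_mul]
    · simp
  · refine Finset.sum_eq_zero fun j _ => ?_
    rw [if_neg (fun e => h (by rw [e]; exact j.2)), zero_mul]

theorem colE_conjTranspose_mulVec (K : Finset (Idx d)) (x : Idx d → ℂ) (i : {i // i ∈ K}) :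
    ((colE K)ᴴ *ᵥ x) i = x i := by
  simp [colE, Matrix.mulVec, dotProduct, Matrix.one_apply]

/-- For a pair `(0, z)` in the Lagrangian subspace, the restriction of `z` to `K` lies in the kernel
of `S_K`, and it determines `z` off `K` as `-S` applied to it. The map `f` is this reconstruction.
-/
theorem nullityB_chart (K : Finset (Idx d)) {S : Matrix (Idx d) (Idx d) ℂ} (hS : S.IsHermitian) :
    (chart K S hS).nullityB = rZero (compress_isHermitian K hS) := by
  rw [rZero_eq_finrank_ker]
  let f : ({i // i ∈ K} → ℂ) →ₗ[ℂ] (Idx d → ℂ) :=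
    (colE K).mulVecLin - (diagK K * S * colE K).mulVecLin
  have hf : ∀ ζ, f ζ = colE K *ᵥ ζ - diagK K *ᵥ (S *ᵥ (colE K *ᵥ ζ)) := by
    intro ζ
    simp [f, Matrix.mulVec_mulVec]
  have hfK : ∀ ζ (i : {i // i ∈ K}), f ζ i = ζ i := by
    rintro ζ ⟨i, hi⟩
    rw [hf, Pi.sub_apply, colE_mulVec, dif_pos hi, diagK_mulVec, if_pos hi, sub_zero]
  have hfinj : Function.Injective f := by
    intro ζ ζ' h
    ext i
    rw [← hfK ζ, h, hfK]
  have hcomp : ∀ ζ (i : {i // i ∈ K}), (compress K S *ᵥ ζ) i = (S *ᵥ (colE K *ᵥ ζ)) i := by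
    intro ζ i
    rw [compress, ← Matrix.mulVec_mulVec, ← Matrix.mulVec_mulVec, colE_conjTranspose_mulVec]
  rw [BoundarySpace.nullityB_eq_finrank _ ((LinearMap.ker (compress K S).mulVecLin).map f)]
  · exact LinearEquiv.finrank_eq (Submodule.equivMapOfInjective f hfinj _).symm
  · intro z
    rw [chart_holds_iff, Submodule.mem_map]
    constructor
    · rintro ⟨ζ, hζ, rfl⟩ i
      have h1 : (fun j => if j ∈ K then f ζ j else (0 : Idx d → ℂ) j) = colE K *ᵥ ζ := by
        ext j
        rw [colE_mulVec]
        split_ifs with hj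
        · exact hfK ζ ⟨j, hj⟩
        · rfl
      rw [h1]
      split_ifs with hi
      · have := congrFun (LinearMap.mem_ker.1 hζ) ⟨i, hi⟩
        rw [Matrix.mulVecLin_apply, hcomp] at this
        exact this
      · rw [hf, Pi.sub_apply, colE_mulVec, dif_neg hi, diagK_mulVec, if_neg hi, zero_sub, neg_neg]
    · intro h
      have h1 : (fun j => if j ∈ K then z j else (0 : Idx d → ℂ) j) =
          colE K *ᵥ fun i => z i.1 := by
        ext j
        rw [colE_mulVec]
        split_ifs <;> rfl
      rw [h1] at h
      refine ⟨fun i => z i.1, ?_, ?_⟩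
      · rw [LinearMap.mem_ker, Matrix.mulVecLin_apply]
        ext i
        rw [hcomp, h, if_pos i.2]
        rfl
      · ext i
        by_cases hi : i ∈ K
        · exact hfK _ ⟨i, hi⟩
        · rw [hf, Pi.sub_apply, colE_mulVec, dif_neg hi, diagK_mulVec, if_neg hi, h, if_neg hi]
          ring

theorem nullityB_le (κ : BoundarySpace d) : κ.nullityB ≤ 2 * d := by
  obtain ⟨p, rfl⟩ := κ.exists_rep
  change Module.finrank ℂ (LinearMap.ker p.1.2.mulVecLin) ≤ _
  refine (Submodule.finrank_le _).trans ?_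
  rw [Module.finrank_fintype_fun_eq_card, card_idx]

/-- A boundary condition of the `k`-th layer has the coordinate `S` with `S_K = 0` in some chart
`O_K` with `#K = k`. -/
theorem exists_chart_compress_eq_zero (κ : BoundarySpace d) :
    ∃ (K : Finset (Idx d)) (S : Matrix (Idx d) (Idx d) ℂ) (hS : S.IsHermitian),
      K.card = κ.nullityB ∧ κ = chart K S hS ∧ compress K S = 0 := by
  classical
  obtain ⟨p, rfl⟩ := κ.exists_rep
  -- The image of `a` indexes a basis of the column space of `B` chosen among the columns, and `K`
  -- is the set of the remaining indices. Thus `#K = dim ker B`.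
  obtain ⟨τ, a, ha, hspan, hli⟩ := exists_linearIndependent' ℂ (fun i => p.1.2.col i)
  have : Finite τ := Finite.of_injective a ha
  have : Fintype τ := Fintype.ofFinite τ
  set K : Finset (Idx d) := (Finset.univ.image a)ᶜ with hK
  have hmemK : ∀ i, i ∉ K ↔ ∃ t, a t = i := by
    intro i
    simp [hK]
  have hmul : ∀ z : Idx d → ℂ, p.1.2 *ᵥ z = ∑ i, z i • p.1.2.col i := by
    intro z
    ext j
    simp [Matrix.mulVec, dotProduct, mul_comm]
  have hcard : K.card = (BoundarySpace.mk p).nullityB := by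
    change _ = Module.finrank ℂ (LinearMap.ker p.1.2.mulVecLin)
    have h1 := LinearMap.finrank_range_add_finrank_ker p.1.2.mulVecLin
    have h2 : LinearMap.range p.1.2.mulVecLin = Submodule.span ℂ (Set.range p.1.2.col) :=
      Matrix.range_mulVecLin _
    have h3 := finrank_span_eq_card hli
    rw [hspan] at h3
    change Module.finrank ℂ (Submodule.span ℂ (Set.range p.1.2.col)) = _ at h3
    rw [h2, h3, Module.finrank_fintype_fun_eq_card] at h1
    rw [hK, Finset.card_compl, Finset.card_image_of_injective _ ha, Finset.card_univ]
    omega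
  obtain ⟨S, hS, hκ⟩ := exists_eq_chart K (BoundarySpace.mk p) (by
    intro x z hxz hx hz
    have hsupp : ∀ w : Idx d → ℂ, (∀ i ∈ K, w i = 0) → p.1.2 *ᵥ w = 0 → w = 0 := by
      intro w hw hBw
      have h1 : ∑ t, w (a t) • p.1.2.col (a t) = 0 := by
        rw [← hBw, hmul]
        refine Fintype.sum_of_injective a ha _ _ (fun i hi => ?_) fun t => rfl
        rw [hw i, zero_smul]
        by_contra hi'
        exact hi ((hmemK i).1 hi')
      have h2 := Fintype.linearIndependent_iff.1 hli (fun t => w (a t)) h1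
      ext i
      by_cases hi : i ∈ K
      · exact hw i hi
      · obtain ⟨t, rfl⟩ := (hmemK i).1 hi
        exact h2 t
    -- Each column with index in `K` is a combination of basis columns. The resulting `ζ ∈ ker B`
    -- pairs with `x` to `x i`, and isotropy makes this zero.
    have hext : ∀ i ∈ K, ∃ ζ, p.1.2 *ᵥ ζ = 0 ∧ ∀ j ∈ K, ζ j = if j = i then 1 else 0 := by
      intro i hi
      have h1 : p.1.2.col i ∈ Submodule.span ℂ (Set.range ((fun i => p.1.2.col i) ∘ a)) := by
        rw [hspan]
        exact Submodule.subset_span ⟨i, rfl⟩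
      obtain ⟨c, hc⟩ := (Submodule.mem_span_range_iff_exists_fun ℂ).1 h1
      have haK : ∀ j ∈ K, ∀ t, a t ≠ j := fun j hj t e => (hmemK j).2 ⟨t, e⟩ hj
      refine ⟨Pi.single i 1 - ∑ t, c t • Pi.single (a t) 1, ?_, ?_⟩
      · rw [Matrix.mulVec_sub, Matrix.mulVec_sum, Matrix.mulVec_single_one, ← hc, sub_eq_zero]
        refine Finset.sum_congr rfl fun t _ => ?_
        rw [Matrix.mulVec_smul, Matrix.mulVec_single_one]
        rfl
      · intro j hj
        have h2 : (∑ t, c t • (Pi.single (a t) 1 : Idx d → ℂ)) j = 0 := by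
          rw [Finset.sum_apply]
          refine Finset.sum_eq_zero fun t _ => ?_
          rw [Pi.smul_apply, Pi.single_eq_of_ne (haK j hj t).symm, smul_zero]
        rw [Pi.sub_apply, h2, sub_zero, Pi.single_apply]
    have hx0 : x = 0 := by
      ext i
      by_cases hi : i ∈ K
      · obtain ⟨ζ, h1, h2⟩ := hext i hi
        have h3 : (BoundarySpace.mk p).Holds 0 ζ := by
          rw [BoundarySpace.holds_mk, h1]
          simp
        have h4 := h3.isotropic hxz
        rw [star_zero, zero_dotProduct, dotProduct, Finset.sum_eq_single i] at h4
        · rw [Pi.star_apply, h2 i hi, if_pos rfl, star_one, one_mul] at h4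
          exact h4.symm
        · intro j _ hj
          by_cases hjK : j ∈ K
          · rw [Pi.star_apply, h2 j hjK, if_neg hj, star_zero, zero_mul]
          · rw [hx j hjK, mul_zero]
        · simp
      · exact hx i hi
    refine ⟨hx0, hsupp z hz ?_⟩
    rw [BoundarySpace.holds_mk, hx0] at hxz
    simpa using hxz)
  refine ⟨K, S, hS, hcard, hκ, ?_⟩
  rw [hκ, nullityB_chart, rZero_eq_finrank_ker] at hcard
  -- The nullity of `S_K` equals its size `#K`, which forces `S_K = 0`.
  have htop : LinearMap.ker (compress K S).mulVecLin = ⊤ := by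
    apply Submodule.eq_top_of_finrank_eq
    rw [← hcard, Module.finrank_fintype_fun_eq_card, Fintype.card_coe]
  rw [LinearMap.ker_eq_top] at htop
  exact Matrix.toLin'.injective (by simpa [Matrix.toLin'_apply'] using htop)

end Boundary

/-! ### Closure relations between the areas of a chart. -/

section Closure

variable {d : ℕ}

theorem colE_conjTranspose_mul_colE (K : Finset (Idx d)) : (colE K)ᴴ * colE K = 1 := by
  have h := compress_eq K 1
  rw [compress, Matrix.mul_one, Matrix.submatrix_one _ Subtype.val_injective] at h
  exact h

theorem continuous_chart {X : Type*} [TopologicalSpace X] (K : Finset (Idx d))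
    {S : X → Matrix (Idx d) (Idx d) ℂ} (hS : ∀ x, (S x).IsHermitian) (hc : Continuous S) :
    Continuous fun x => chart K (S x) (hS x) := by
  refine BoundarySpace.continuous_mk.comp (Continuous.subtype_mk (Continuous.prodMk ?_ ?_) _)
  · simp only [chartA_eq]
    exact (hc.matrix_mul continuous_const).add continuous_const
  · simp only [chartB_eq]
    exact (hc.matrix_mul continuous_const).add continuous_const

/-- Of the `s₀` zero eigenvalues of `S_K`, move `rp - sp` to `ε` and `rm - sm` to `-ε`; the equal
totals leave `r₀` of them at zero. The perturbation is confined to the block of `S` indexed by `K`,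
and `ε` tends to `0` from the right. -/
theorem mem_closure_area (K : Finset (Idx d)) {r₀ rp rm s₀ sp sm : ℕ}
    (hr : r₀ + rp + rm = K.card) (hs : s₀ + sp + sm = K.card) (hp : sp ≤ rp)
    (hm : sm ≤ rm) {κ : BoundarySpace d} (hκ : κ ∈ area K s₀ sp sm) :
    κ ∈ closure (area K r₀ rp rm) := by
  classical
  obtain ⟨S, hS, rfl, h0, h1, h2⟩ := hκ
  set hM := compress_isHermitian K hS
  set Z := Finset.univ.filter fun i => hM.eigenvalues i = 0 with hZ
  have hZcard : Z.card = s₀ := h0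
  obtain ⟨Zp, hZp, hZpc⟩ := Finset.exists_subset_card_eq (s := Z) (n := rp - sp) (by omega)
  obtain ⟨Zm, hZm, hZmc⟩ := Finset.exists_subset_card_eq (s := Z \ Zp) (n := rm - sm) (by
    rw [Finset.card_sdiff_of_subset hZp]
    omega)
  have hdisj : ∀ i ∈ Zp, i ∉ Zm := fun i hi hi' => (Finset.mem_sdiff.1 (hZm hi')).2 hi
  have hZp0 : ∀ i ∈ Zp, hM.eigenvalues i = 0 := fun i hi => (Finset.mem_filter.1 (hZp hi)).2
  have hZm0 : ∀ i ∈ Zm, hM.eigenvalues i = 0 := fun i hi =>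
    (Finset.mem_filter.1 (Finset.mem_sdiff.1 (hZm hi)).1).2
  obtain ⟨D, hD, hDε⟩ := exists_eigenvalues_perturbation hM
    fun i => if i ∈ Zp then 1 else if i ∈ Zm then -1 else 0
  set S' : ℝ → Matrix (Idx d) (Idx d) ℂ := fun ε => S + (ε : ℂ) • (colE K * D * (colE K)ᴴ) with hS'
  have hS'h : ∀ ε, (S' ε).IsHermitian := by
    intro ε
    refine hS.add ?_
    rw [Matrix.IsHermitian, Matrix.conjTranspose_smul,
      (Matrix.isHermitian_mul_mul_conjTranspose (colE K) hD).eq]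
    simp
  have hcomp : ∀ ε, compress K (S' ε) = compress K S + (ε : ℂ) • D := by
    intro ε
    have e := colE_conjTranspose_mul_colE K
    simp only [compress, hS', Matrix.mul_add, Matrix.add_mul, Matrix.mul_smul, Matrix.smul_mul]
    congr 2
    rw [Matrix.mul_assoc (colE K), ← Matrix.mul_assoc (colE K)ᴴ, e, Matrix.one_mul,
      Matrix.mul_assoc, e, Matrix.mul_one]
  have hcont : Continuous fun ε => chart K (S' ε) (hS'h ε) := by
    refine continuous_chart K hS'h (continuous_const.add ?_)
    exact Complex.continuous_ofReal.smul continuous_const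
  have hlim : Tendsto (fun ε => chart K (S' ε) (hS'h ε)) (𝓝[>] 0) (𝓝 (chart K S hS)) := by
    have h := hcont.tendsto 0
    have e : chart K (S' 0) (hS'h 0) = chart K S hS := by
      have : S' 0 = S := by simp [hS']
      congr 1
    rw [e] at h
    exact h.mono_left nhdsWithin_le_nhds
  refine mem_closure_of_tendsto hlim ?_
  filter_upwards [self_mem_nhdsWithin] with ε hε
  rw [mem_Ioi] at hε
  refine ⟨S' ε, hS'h ε, rfl, ?_⟩
  have hcount : ∀ (p : ℝ → Prop) [DecidablePred p],
      (Finset.univ.filter fun i =>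
        p ((compress_isHermitian K (hS'h ε)).eigenvalues i)).card =
      (Finset.univ.filter fun i => p (hM.eigenvalues i +
        ε * if i ∈ Zp then 1 else if i ∈ Zm then -1 else 0)).card := by
    intro p _
    have hh : ∀ (X : Matrix {i // i ∈ K} {i // i ∈ K} ℂ) (hX : X.IsHermitian),
        X = compress K S + (ε : ℂ) • D → (Finset.univ.filter fun i => p (hX.eigenvalues i)).card =
        (Finset.univ.filter fun i => p (hM.eigenvalues i +
          ε * if i ∈ Zp then 1 else if i ∈ Zm then -1 else 0)).card := by
      rintro X hX rfl
      exact hDε ε hX p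
    exact hh _ _ (hcomp ε)
  have e1 : rPos (compress_isHermitian K (hS'h ε)) = rp := by
    rw [rPos, hcount fun x => 0 < x]
    have : (Finset.univ.filter fun i => 0 < hM.eigenvalues i +
        ε * if i ∈ Zp then 1 else if i ∈ Zm then -1 else 0) =
        (Finset.univ.filter fun i => 0 < hM.eigenvalues i) ∪ Zp := by
      ext i
      simp only [Finset.mem_filter, Finset.mem_univ, true_and, Finset.mem_union]
      split_ifs with h h'
      · simp [h, hZp0 i h, hε]
      · simp [h, hZm0 i h', hε.le]
      · simp [h]
    rw [this, Finset.card_union_of_disjoint, hZpc]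
    · change rPos hM + _ = _
      omega
    · rw [Finset.disjoint_left]
      intro i hi hi'
      simp [hZp0 i hi'] at hi
  have e2 : rNeg (compress_isHermitian K (hS'h ε)) = rm := by
    rw [rNeg, hcount fun x => x < 0]
    have : (Finset.univ.filter fun i => hM.eigenvalues i +
        ε * (if i ∈ Zp then 1 else if i ∈ Zm then -1 else 0) < 0) =
        (Finset.univ.filter fun i => hM.eigenvalues i < 0) ∪ Zm := by
      ext i
      simp only [Finset.mem_filter, Finset.mem_univ, true_and, Finset.mem_union]
      split_ifs with h h'
      · simp [hdisj i h, hZp0 i h, hε.le]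
      · simp [h', hZm0 i h', hε]
      · simp [h']
    rw [this, Finset.card_union_of_disjoint, hZmc]
    · change rNeg hM + _ = _
      omega
    · rw [Finset.disjoint_left]
      intro i hi hi'
      simp [hZm0 i hi'] at hi
  refine ⟨?_, e1, e2⟩
  have := rPos_add_rNeg_add_rZero (compress_isHermitian K (hS'h ε))
  rw [e1, e2, Fintype.card_coe] at this
  omega

end Closure

/-! ### Finite-dimensional pencils with boundary conditions -/

/-- A Hermitian pencil `L - z C^* C` with a boundary operator `G`. -/
structure Pencil (d : ℕ) (ι : Type) [Fintype ι] [DecidableEq ι] where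
  L : Matrix ι ι ℂ
  C : Matrix ι ι ℂ
  G : Matrix (Idx d) ι ℂ
  hermitian : L.IsHermitian
  isUnit : IsUnit C
  G_mul : G * Gᴴ = 1

namespace Pencil

variable {d : ℕ} {ι : Type} [Fintype ι] [DecidableEq ι] (π : Pencil d ι)

/-- The vectors with boundary values in the Lagrangian subspace of `κ`. -/
def domain (κ : BoundarySpace d) : Submodule ℂ ((ι → ℂ) × (Idx d → ℂ)) :=
  κ.lagrangian.comap (π.G.mulVecLin.prodMap LinearMap.id)

theorem mem_domain {κ : BoundarySpace d} {p : (ι → ℂ) × (Idx d → ℂ)} :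
    p ∈ π.domain κ ↔ κ.Holds (π.G *ᵥ p.1) p.2 := Iff.rfl

/-- The map `(u, z) ↦ L u - G^* z - t C^* C u`. -/
def residual (t : ℂ) : ((ι → ℂ) × (Idx d → ℂ)) →ₗ[ℂ] (ι → ℂ) :=
  (π.L - t • (π.Cᴴ * π.C)).mulVecLin.coprod (-π.Gᴴ.mulVecLin)

theorem residual_apply (t : ℂ) (p : (ι → ℂ) × (Idx d → ℂ)) :
    π.residual t p = π.L *ᵥ p.1 - t • (π.Cᴴ *ᵥ (π.C *ᵥ p.1)) - π.Gᴴ *ᵥ p.2 := by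
  simp only [residual, LinearMap.coprod_apply, Matrix.mulVecLin_apply, Matrix.sub_mulVec,
    Matrix.smul_mulVec, LinearMap.neg_apply, Matrix.mulVec_mulVec]
  exact (sub_eq_add_neg _ _).symm

/-- The eigenspace of the pencil with the boundary condition `κ`. -/
def eigenspace (κ : BoundarySpace d) (t : ℂ) : Submodule ℂ ((ι → ℂ) × (Idx d → ℂ)) :=
  π.domain κ ⊓ LinearMap.ker (π.residual t)

theorem mem_eigenspace {κ : BoundarySpace d} {t : ℂ} {p : (ι → ℂ) × (Idx d → ℂ)} :
    p ∈ π.eigenspace κ t ↔ κ.Holds (π.G *ᵥ p.1) p.2 ∧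
      π.L *ᵥ p.1 - t • (π.Cᴴ *ᵥ (π.C *ᵥ p.1)) = π.Gᴴ *ᵥ p.2 := by
  rw [eigenspace, Submodule.mem_inf, mem_domain, LinearMap.mem_ker, residual_apply, sub_eq_zero]

theorem conjTranspose_G_mulVec_injective {z : Idx d → ℂ} (h : π.Gᴴ *ᵥ z = 0) : z = 0 := by
  have := congrArg (π.G *ᵥ ·) h
  simpa [Matrix.mulVec_mulVec, π.G_mul] using this

theorem C_mulVec_injective {u : ι → ℂ} (h : π.C *ᵥ u = 0) : u = 0 := by
  have := Matrix.mulVec_injective_iff_isUnit.2 π.isUnit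
  exact this (by rw [h, Matrix.mulVec_zero])

/-- As `G G^* = 1`, the map `(u, z) ↦ (G u, z)` is onto, so the boundary condition imposes `2d`
independent conditions on a space of dimension `card ι + 2d`. This is the dimension hypothesis of
the spectral theorem for relations. -/
theorem finrank_domain (κ : BoundarySpace d) :
    Module.finrank ℂ (π.domain κ) = Fintype.card ι := by
  obtain ⟨p, rfl⟩ := κ.exists_rep
  let f : ((ι → ℂ) × (Idx d → ℂ)) →ₗ[ℂ] (Idx d → ℂ) :=
    p.toLin ∘ₗ (π.G.mulVecLin.prodMap LinearMap.id)
  have hf : π.domain (BoundarySpace.mk p) = LinearMap.ker f := by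
    ext ⟨u, z⟩
    rw [mem_domain, LinearMap.mem_ker, LinearMap.comp_apply, BoundarySpace.holds_mk]
    simp [BoundaryPair.toLin_apply]
  have hr : LinearMap.range f = ⊤ := by
    have h1 : LinearMap.range (π.G.mulVecLin.prodMap
        (LinearMap.id : (Idx d → ℂ) →ₗ[ℂ] (Idx d → ℂ))) = ⊤ := by
      rw [LinearMap.range_eq_top]
      rintro ⟨x, z⟩
      refine ⟨(π.Gᴴ *ᵥ x, z), ?_⟩
      simp [Matrix.mulVec_mulVec, π.G_mul]
    rw [LinearMap.range_comp, h1, Submodule.map_top, p.range_toLin]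
  have h2 := LinearMap.finrank_range_add_finrank_ker f
  rw [hr, finrank_top, Module.finrank_prod] at h2
  rw [hf]
  simp only [Module.finrank_fintype_fun_eq_card] at h2
  omega

/-- Green's formula: the boundary terms cancel because the boundary condition is isotropic. -/
theorem dotProduct_residual {κ : BoundarySpace d} (t : ℝ) {p q : (ι → ℂ) × (Idx d → ℂ)}
    (hp : p ∈ π.domain κ) (hq : q ∈ π.domain κ) :
    star p.1 ⬝ᵥ π.residual t q = star (π.residual t p) ⬝ᵥ q.1 := by
  have h := (π.mem_domain.1 hp).isotropic (π.mem_domain.1 hq)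
  rw [Matrix.star_mulVec, ← Matrix.dotProduct_mulVec] at h
  simp only [residual_apply, dotProduct_sub, star_sub, sub_dotProduct, star_smul,
    Matrix.star_mulVec, Matrix.conjTranspose_conjTranspose, dotProduct_smul, smul_dotProduct,
    ← Matrix.dotProduct_mulVec, π.hermitian.eq]
  rw [h]
  simp

/-- The eigenvalues and the eigenvectors of a pencil with a boundary condition. -/
theorem exists_eigenvectors (κ : BoundarySpace d) :
    ∃ (k : ℕ) (e : Fin k → ℝ) (v : Fin k → (ι → ℂ) × (Idx d → ℂ)),
      k + κ.nullityB = Fintype.card ι ∧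
      (∀ i j, star (π.C *ᵥ (v i).1) ⬝ᵥ (π.C *ᵥ (v j).1) = if i = j then 1 else 0) ∧
      (∀ i, v i ∈ π.eigenspace κ (e i)) ∧
      ∀ z : ℂ, Module.finrank ℂ (π.eigenspace κ z) =
        (Finset.univ.filter fun i => (e i : ℂ) = z).card := by
  have hdet := (Matrix.isUnit_iff_isUnit_det _).1 π.isUnit
  have hC : π.Cᴴ * (π.C⁻¹)ᴴ = 1 := by
    rw [← Matrix.conjTranspose_mul, Matrix.nonsing_inv_mul _ hdet, Matrix.conjTranspose_one]
  have hC' : (π.C⁻¹)ᴴ * π.Cᴴ = 1 := by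
    rw [← Matrix.conjTranspose_mul, Matrix.mul_nonsing_inv _ hdet, Matrix.conjTranspose_one]
  let toE : (ι → ℂ) ≃ₗ[ℂ] EuclideanSpace ℂ ι := (WithLp.linearEquiv 2 ℂ (ι → ℂ)).symm
  have hinner : ∀ x y, inner ℂ (toE x) (toE y) = star x ⬝ᵥ y := by
    intro x y
    rw [EuclideanSpace.inner_eq_star_dotProduct, dotProduct_comm]
    rfl
  -- The relation is `{(C u, C^{-*} (L u - G^* z))}`: conjugation by `C` turns the weight `C^* C`
  -- into the identity.
  let U : π.domain κ →ₗ[ℂ] EuclideanSpace ℂ ι :=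
    toE.toLinearMap ∘ₗ π.C.mulVecLin ∘ₗ LinearMap.fst ℂ _ _ ∘ₗ (π.domain κ).subtype
  let F : π.domain κ →ₗ[ℂ] EuclideanSpace ℂ ι :=
    toE.toLinearMap ∘ₗ (π.C⁻¹)ᴴ.mulVecLin ∘ₗ π.residual 0 ∘ₗ (π.domain κ).subtype
  have hU : ∀ p, U p = toE (π.C *ᵥ p.1.1) := fun p => rfl
  have hF : ∀ p, F p = toE ((π.C⁻¹)ᴴ *ᵥ π.residual 0 p) := fun p => rfl
  have hres0 : ∀ p : π.domain κ, U p = 0 → p.1.1 = 0 := by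
    intro p hp
    rw [hU, LinearEquiv.map_eq_zero_iff] at hp
    exact π.C_mulVec_injective hp
  have hkerF : ∀ (p : π.domain κ) (z : ℂ), F p = z • U p ↔ p.1 ∈ π.eigenspace κ z := by
    intro p z
    rw [mem_eigenspace, and_iff_right (π.mem_domain.1 p.2), hF, hU, ← map_smul,
      toE.injective.eq_iff, residual_apply]
    constructor
    · intro h
      have h1 := congrArg (π.Cᴴ *ᵥ ·) h
      simp only [Matrix.mulVec_mulVec, hC, Matrix.one_mulVec, Matrix.mulVec_smul] at h1
      rw [zero_smul, sub_zero, sub_eq_iff_eq_add] at h1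
      rw [h1, Matrix.mulVec_mulVec]
      abel
    · intro h
      rw [zero_smul, sub_zero, ← h, sub_sub_cancel, Matrix.mulVec_smul, Matrix.mulVec_mulVec, hC',
        Matrix.one_mulVec]
  obtain ⟨k, e, v, h1, h2, h3, h4⟩ := exists_eigenvectors_of_selfAdjoint_relation U F
    (by
      intro p q
      rw [hU, hF, hF, hU, hinner, hinner]
      have h := π.dotProduct_residual 0 p.2 q.2
      rw [Complex.ofReal_zero] at h
      rw [Matrix.star_mulVec, ← Matrix.dotProduct_mulVec, Matrix.mulVec_mulVec, hC,
        Matrix.one_mulVec, h, Matrix.star_mulVec, ← Matrix.dotProduct_mulVec,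
        Matrix.conjTranspose_conjTranspose, Matrix.mulVec_mulVec, Matrix.nonsing_inv_mul _ hdet,
        Matrix.one_mulVec])
    (by
      intro p hp hp'
      have h0 := hres0 p hp
      have h5 : p.1 ∈ π.eigenspace κ 0 := by
        rw [← hkerF, hp', zero_smul]
      have h6 := (π.mem_eigenspace.1 h5).2
      rw [h0] at h6
      simp only [Matrix.mulVec_zero, smul_zero, sub_zero] at h6
      exact Subtype.ext (Prod.ext h0 (π.conjTranspose_G_mulVec_injective h6.symm)))
    (by rw [finrank_domain, finrank_euclideanSpace])
  refine ⟨k, e, fun i => v i, ?_, ?_, ?_, ?_⟩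
  · rw [finrank_domain] at h1
    rw [← h1]
    congr 1
    -- The kernel of `U` consists of the pairs `(0, z)` in the domain, so `z` identifies it with
    -- `ker B`.
    let g : LinearMap.ker U →ₗ[ℂ] (Idx d → ℂ) :=
      LinearMap.snd ℂ _ _ ∘ₗ (π.domain κ).subtype ∘ₗ (LinearMap.ker U).subtype
    have hg : Function.Injective g := by
      rintro ⟨p, hp⟩ ⟨q, hq⟩ h
      exact Subtype.ext (Subtype.ext (Prod.ext ((hres0 p hp).trans (hres0 q hq).symm) h))
    rw [← LinearMap.finrank_range_of_inj hg]
    refine κ.nullityB_eq_finrank _ fun z => ⟨?_, fun hz => ?_⟩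
    · rintro ⟨⟨p, hp⟩, rfl⟩
      have h5 := π.mem_domain.1 p.2
      rw [hres0 p hp, Matrix.mulVec_zero] at h5
      exact h5
    · refine ⟨⟨⟨(0, z), ?_⟩, ?_⟩, rfl⟩
      · rw [mem_domain]
        simpa using hz
      · rw [LinearMap.mem_ker, hU]
        simp
  · intro i j
    rw [← hinner]
    exact orthonormal_iff_ite.1 h2 i j
  · intro i
    exact (hkerF _ _).1 (h3 i)
  · intro z
    rw [← h4]
    have h5 : π.eigenspace κ z = (LinearMap.ker (F - z • U)).map (π.domain κ).subtype := by
      ext p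
      simp only [Submodule.mem_map, LinearMap.mem_ker, LinearMap.sub_apply, LinearMap.smul_apply,
        sub_eq_zero]
      constructor
      · intro hp
        exact ⟨⟨p, hp.1⟩, (hkerF _ _).2 hp, rfl⟩
      · rintro ⟨q, hq, rfl⟩
        exact (hkerF _ _).1 hq
    rw [h5, Submodule.finrank_map_subtype_eq]

end Pencil

/-! ### The bordered matrix in a chart and the counting of eigenvalues. -/

namespace Pencil

variable {d : ℕ} {ι : Type} [Fintype ι] [DecidableEq ι] (π : Pencil d ι)

/-- The operator `(u, ζ) ↦ ξ`, where `ξ` is `ζ` on `K` and `G u` off `K`. -/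
def border (K : Finset (Idx d)) : Matrix (Idx d) (ι ⊕ {i // i ∈ K}) ℂ :=
  Matrix.fromCols (diagK K * π.G) (colE K)

/-- The bordered Hermitian matrix of the pencil with the boundary condition `[(S | I) E_K]`. -/
def bordered (K : Finset (Idx d)) (t : ℂ) (S : Matrix (Idx d) (Idx d) ℂ) :
    Matrix (ι ⊕ {i // i ∈ K}) (ι ⊕ {i // i ∈ K}) ℂ :=
  (π.border K)ᴴ * S * π.border K +
    Matrix.fromBlocks (π.L - t • (π.Cᴴ * π.C)) (-(π.Gᴴ * colE K)) (-((colE K)ᴴ * π.G)) 0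

theorem bordered_isHermitian (K : Finset (Idx d)) (t : ℝ) {S : Matrix (Idx d) (Idx d) ℂ}
    (hS : S.IsHermitian) : (π.bordered K t S).IsHermitian := by
  refine (Matrix.isHermitian_conjTranspose_mul_mul _ hS).add ?_
  rw [Matrix.IsHermitian, Matrix.fromBlocks_conjTranspose]
  simp [π.hermitian.eq]

theorem continuous_bordered (K : Finset (Idx d)) (t : ℂ) : Continuous (π.bordered K t) :=
  ((continuous_const.matrix_mul continuous_id).matrix_mul continuous_const).add continuous_const

/-- With `ξ` equal to `ζ` on `K` and to `G u` off `K`, put `z = ζ` on `K` and `z = -S ξ` off `K`.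
The first row is then the pencil residual at `(u, z)`, and the second is the remaining condition `S
ξ = G u` on `K`. -/
theorem bordered_mulVec (K : Finset (Idx d)) (t : ℂ) (S : Matrix (Idx d) (Idx d) ℂ) (u : ι → ℂ)
    (ζ : {i // i ∈ K} → ℂ) : π.bordered K t S *ᵥ Sum.elim u ζ =
      Sum.elim (π.L *ᵥ u - t • (π.Cᴴ *ᵥ (π.C *ᵥ u)) +
          π.Gᴴ *ᵥ (diagK K *ᵥ (S *ᵥ (diagK K *ᵥ (π.G *ᵥ u) + colE K *ᵥ ζ)) - colE K *ᵥ ζ))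
        ((colE K)ᴴ *ᵥ (S *ᵥ (diagK K *ᵥ (π.G *ᵥ u) + colE K *ᵥ ζ) - π.G *ᵥ u)) := by
  have h1 : ∀ ξ, (π.border K)ᴴ *ᵥ ξ = Sum.elim (π.Gᴴ *ᵥ (diagK K *ᵥ ξ)) ((colE K)ᴴ *ᵥ ξ) := by
    intro ξ
    rw [border, Matrix.conjTranspose_fromCols_eq_fromRows_conjTranspose, Matrix.fromRows_mulVec,
      Matrix.conjTranspose_mul, diagK_conjTranspose, Matrix.mulVec_mulVec]
  rw [bordered, Matrix.add_mulVec, ← Matrix.mulVec_mulVec, ← Matrix.mulVec_mulVec, h1,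
    Matrix.fromBlocks_mulVec, border, Matrix.fromCols_mulVec]
  simp only [Sum.elim_comp_inl, Sum.elim_comp_inr, Matrix.mulVec_sub, Matrix.sub_mulVec,
    Matrix.neg_mulVec, Matrix.smul_mulVec, ← Matrix.mulVec_mulVec, Matrix.zero_mulVec, add_zero]
  ext (i | i)
  · simp only [Pi.add_apply, Sum.elim_inl, Pi.sub_apply, Pi.neg_apply]
    ring
  · simp only [Pi.add_apply, Sum.elim_inr, Pi.sub_apply, Pi.neg_apply]
    ring

theorem diagK_add_colE (K : Finset (Idx d)) (x z : Idx d → ℂ) :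
    diagK K *ᵥ x + colE K *ᵥ ((colE K)ᴴ *ᵥ z) = fun j => if j ∈ K then z j else x j := by
  ext j
  rw [Pi.add_apply, diagK_mulVec, colE_mulVec]
  by_cases hj : j ∈ K
  · rw [if_pos hj, dif_pos hj, colE_conjTranspose_mulVec, zero_add, if_pos hj]
  · rw [if_neg hj, dif_neg hj, add_zero, if_neg hj]

theorem bordered_mulVec_of_mem {K : Finset (Idx d)} (t : ℂ) {S : Matrix (Idx d) (Idx d) ℂ}
    {hS : S.IsHermitian} {p : (ι → ℂ) × (Idx d → ℂ)} (hp : p ∈ π.domain (chart K S hS)) :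
    π.bordered K t S *ᵥ Sum.elim p.1 ((colE K)ᴴ *ᵥ p.2) = Sum.elim (π.residual t p) 0 := by
  rw [bordered_mulVec, diagK_add_colE, residual_apply]
  have h := (chart_holds_iff K hS _ _).1 (π.mem_domain.1 hp)
  congr 1
  · rw [sub_eq_add_neg _ (π.Gᴴ *ᵥ p.2), ← Matrix.mulVec_neg]
    congr 2
    ext i
    rw [Pi.sub_apply, diagK_mulVec, colE_mulVec, h]
    by_cases hi : i ∈ K
    · rw [if_pos hi, dif_pos hi, colE_conjTranspose_mulVec, zero_sub, Pi.neg_apply]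
    · rw [if_neg hi, dif_neg hi, if_neg hi, sub_zero, Pi.neg_apply]
  · ext i
    rw [colE_conjTranspose_mulVec, Pi.sub_apply, h, if_pos i.2, sub_self, Pi.zero_apply]

/-- From a kernel vector `(u, ζ)` the full boundary value `z` is rebuilt by the elimination formula.
The second row puts `(u, z)` into the domain and the first makes it an eigenvector. -/
theorem eq_zero_of_bordered_mulVec {K : Finset (Idx d)} {t : ℂ} {S : Matrix (Idx d) (Idx d) ℂ}
    (hS : S.IsHermitian) (h : π.eigenspace (chart K S hS) t = ⊥) (w : ι ⊕ {i // i ∈ K} → ℂ)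
    (hw : π.bordered K t S *ᵥ w = 0) : w = 0 := by
  obtain ⟨u, ζ, rfl⟩ : ∃ u ζ, w = Sum.elim u ζ :=
    ⟨w ∘ Sum.inl, w ∘ Sum.inr, (Sum.elim_comp_inl_inr w).symm⟩
  set z : Idx d → ℂ :=
    colE K *ᵥ ζ - diagK K *ᵥ (S *ᵥ (diagK K *ᵥ (π.G *ᵥ u) + colE K *ᵥ ζ)) with hz
  have hζ : (colE K)ᴴ *ᵥ z = ζ := by
    ext i
    rw [colE_conjTranspose_mulVec, hz, Pi.sub_apply, colE_mulVec, dif_pos i.2, diagK_mulVec,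
      if_pos i.2, sub_zero]
  have hdom : (u, z) ∈ π.domain (chart K S hS) := by
    rw [mem_domain, chart_holds_iff, ← diagK_add_colE, hζ]
    intro i
    by_cases hi : i ∈ K
    · have h1 := congrFun hw (Sum.inr ⟨i, hi⟩)
      rw [bordered_mulVec, Sum.elim_inr, colE_conjTranspose_mulVec, Pi.sub_apply, Pi.zero_apply,
        sub_eq_zero] at h1
      rw [if_pos hi]
      exact h1
    · rw [if_neg hi]
      change (S *ᵥ (diagK K *ᵥ (π.G *ᵥ u) + colE K *ᵥ ζ)) i = -(z i)
      rw [hz, Pi.sub_apply, colE_mulVec, dif_neg hi, diagK_mulVec, if_neg hi, zero_sub, neg_neg]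
  have h2 := π.bordered_mulVec_of_mem t hdom
  simp only at h2
  rw [hζ, hw] at h2
  have h3 : (u, z) ∈ π.eigenspace (chart K S hS) t := by
    refine ⟨hdom, LinearMap.mem_ker.2 ?_⟩
    ext i
    exact (congrFun h2 (Sum.inl i)).symm
  rw [h, Submodule.mem_bot, Prod.mk_eq_zero] at h3
  rw [← hζ, h3.1, h3.2, Matrix.mulVec_zero]
  ext (i | i) <;> rfl

/-- The number of eigenvalues of the pencil with the boundary condition `κ`. -/
def numEigenvalues (κ : BoundarySpace d) : ℕ := (π.exists_eigenvectors κ).choose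

/-- The eigenvalues of the pencil with the boundary condition `κ`. -/
def eigenvalue (κ : BoundarySpace d) : Fin (π.numEigenvalues κ) → ℝ :=
  (π.exists_eigenvectors κ).choose_spec.choose

/-- Eigenvectors of the pencil with the boundary condition `κ`. -/
def eigenvector (κ : BoundarySpace d) : Fin (π.numEigenvalues κ) → (ι → ℂ) × (Idx d → ℂ) :=
  (π.exists_eigenvectors κ).choose_spec.choose_spec.choose

theorem numEigenvalues_add (κ : BoundarySpace d) :
    π.numEigenvalues κ + κ.nullityB = Fintype.card ι :=
  (π.exists_eigenvectors κ).choose_spec.choose_spec.choose_spec.1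

theorem eigenvector_orthonormal (κ : BoundarySpace d) (i j : Fin (π.numEigenvalues κ)) :
    star (π.C *ᵥ (π.eigenvector κ i).1) ⬝ᵥ (π.C *ᵥ (π.eigenvector κ j).1) =
      if i = j then 1 else 0 :=
  (π.exists_eigenvectors κ).choose_spec.choose_spec.choose_spec.2.1 i j

theorem eigenvector_mem (κ : BoundarySpace d) (i : Fin (π.numEigenvalues κ)) :
    π.eigenvector κ i ∈ π.eigenspace κ (π.eigenvalue κ i) :=
  (π.exists_eigenvectors κ).choose_spec.choose_spec.choose_spec.2.2.1 i

theorem finrank_eigenspace (κ : BoundarySpace d) (z : ℂ) :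
    Module.finrank ℂ (π.eigenspace κ z) =
      (Finset.univ.filter fun i => (π.eigenvalue κ i : ℂ) = z).card :=
  (π.exists_eigenvectors κ).choose_spec.choose_spec.choose_spec.2.2.2 z

/-- The number of eigenvalues less than `t`. -/
def below (κ : BoundarySpace d) (t : ℝ) : ℕ :=
  (Finset.univ.filter fun i => π.eigenvalue κ i < t).card

theorem eigenspace_eq_bot {κ : BoundarySpace d} {t : ℝ} (h : ∀ i, π.eigenvalue κ i ≠ t) :
    π.eigenspace κ t = ⊥ := by
  rw [← Submodule.finrank_eq_zero, finrank_eigenspace, Finset.card_eq_zero,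
    Finset.filter_eq_empty_iff]
  intro i _ hi
  exact h i (by exact_mod_cast hi)

/-- The combination of the eigenvectors with given coefficients. -/
def combination (κ : BoundarySpace d) :
    (Fin (π.numEigenvalues κ) → ℂ) →ₗ[ℂ] (ι → ℂ) × (Idx d → ℂ) :=
  Fintype.linearCombination ℂ (π.eigenvector κ)

theorem combination_apply (κ : BoundarySpace d) (c : Fin (π.numEigenvalues κ) → ℂ) :
    π.combination κ c = ∑ i, c i • π.eigenvector κ i :=
  Fintype.linearCombination_apply _ _ _

theorem combination_mem (κ : BoundarySpace d) (c : Fin (π.numEigenvalues κ) → ℂ) :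
    π.combination κ c ∈ π.domain κ := by
  rw [combination_apply]
  exact Submodule.sum_mem _ fun i _ => Submodule.smul_mem _ _ (π.eigenvector_mem κ i).1

theorem star_dotProduct_C_combination (κ : BoundarySpace d)
    (c : Fin (π.numEigenvalues κ) → ℂ) (i : Fin (π.numEigenvalues κ)) :
    star (π.C *ᵥ (π.eigenvector κ i).1) ⬝ᵥ (π.C *ᵥ (π.combination κ c).1) = c i := by
  rw [combination_apply, Prod.fst_sum, Matrix.mulVec_sum, dotProduct_sum]
  simp [Matrix.mulVec_smul, eigenvector_orthonormal]

theorem residual_eigenvector (κ : BoundarySpace d) (t : ℂ) (i : Fin (π.numEigenvalues κ)) :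
    π.residual t (π.eigenvector κ i) =
      ((π.eigenvalue κ i : ℂ) - t) • (π.Cᴴ *ᵥ (π.C *ᵥ (π.eigenvector κ i).1)) := by
  have h := (π.mem_eigenspace.1 (π.eigenvector_mem κ i)).2
  rw [residual_apply, ← h, sub_smul]
  abel

theorem re_star_dotProduct_residual_combination (κ : BoundarySpace d) (t : ℝ)
    (c : Fin (π.numEigenvalues κ) → ℂ) :
    (star (π.combination κ c).1 ⬝ᵥ π.residual t (π.combination κ c)).re =
      ∑ i, (π.eigenvalue κ i - t) * ‖c i‖ ^ 2 := by
  have h1 : π.residual t (π.combination κ c) =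
      ∑ i, (c i * ((π.eigenvalue κ i : ℂ) - t)) •
        (π.Cᴴ *ᵥ (π.C *ᵥ (π.eigenvector κ i).1)) := by
    rw [combination_apply, map_sum]
    refine Finset.sum_congr rfl fun i _ => ?_
    rw [map_smul, residual_eigenvector, smul_smul]
  rw [h1, dotProduct_sum, Complex.re_sum]
  refine Finset.sum_congr rfl fun i _ => ?_
  have h2 : star (π.combination κ c).1 ⬝ᵥ (π.Cᴴ *ᵥ (π.C *ᵥ (π.eigenvector κ i).1)) =
      star (c i) := by
    rw [Matrix.dotProduct_mulVec, ← Matrix.star_mulVec, ← π.star_dotProduct_C_combination κ c i,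
      Matrix.star_dotProduct]
  rw [dotProduct_smul, h2, ← Complex.normSq_eq_norm_sq, Complex.normSq_apply]
  simp
  ring

/-- The map that diagonalises the form of the bordered matrix. -/
def diagonalizer (K : Finset (Idx d)) {S : Matrix (Idx d) (Idx d) ℂ} (hS : S.IsHermitian) :
    (Fin (π.numEigenvalues (chart K S hS)) ⊕ {i // i ∈ K} → ℂ) →ₗ[ℂ]
      (ι ⊕ {i // i ∈ K} → ℂ) where
  toFun c := Sum.elim (π.combination (chart K S hS) (c ∘ Sum.inl)).1
    ((colE K)ᴴ *ᵥ (π.combination (chart K S hS) (c ∘ Sum.inl)).2) +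
      Sum.elim (0 : ι → ℂ) (ofEigenCoord (compress_isHermitian K hS) (c ∘ Sum.inr))
  map_add' c c' := by
    have h1 : (c + c') ∘ Sum.inl = (c ∘ Sum.inl : _ → ℂ) + c' ∘ Sum.inl := rfl
    have h2 : (c + c') ∘ Sum.inr = (c ∘ Sum.inr : _ → ℂ) + c' ∘ Sum.inr := rfl
    rw [h1, h2, map_add, map_add, Prod.fst_add, Prod.snd_add, Matrix.mulVec_add]
    ext (i | i)
    · simp
    · simp only [Pi.add_apply, Sum.elim_inr]
      ring
  map_smul' a c := by
    have h1 : (a • c) ∘ Sum.inl = a • (c ∘ Sum.inl : _ → ℂ) := rfl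
    have h2 : (a • c) ∘ Sum.inr = a • (c ∘ Sum.inr : _ → ℂ) := rfl
    rw [h1, h2, map_smul, map_smul, Prod.smul_fst, Prod.smul_snd, Matrix.mulVec_smul]
    ext (i | i)
    · simp
    · simp [mul_add]

theorem diagonalizer_apply (K : Finset (Idx d)) {S : Matrix (Idx d) (Idx d) ℂ}
    (hS : S.IsHermitian) (c : Fin (π.numEigenvalues (chart K S hS)) ⊕ {i // i ∈ K} → ℂ) :
    π.diagonalizer K hS c = Sum.elim (π.combination (chart K S hS) (c ∘ Sum.inl)).1
    ((colE K)ᴴ *ᵥ (π.combination (chart K S hS) (c ∘ Sum.inl)).2) +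
      Sum.elim (0 : ι → ℂ) (ofEigenCoord (compress_isHermitian K hS) (c ∘ Sum.inr)) := rfl

/-- Orthonormality of the vectors `C u_i` recovers the coefficients of the eigenvectors from the
first component alone; the second then recovers the rest. -/
theorem diagonalizer_injective (K : Finset (Idx d)) {S : Matrix (Idx d) (Idx d) ℂ}
    (hS : S.IsHermitian) : Function.Injective (π.diagonalizer K hS) := by
  rw [← LinearMap.ker_eq_bot, LinearMap.ker_eq_bot']
  intro c hc
  rw [diagonalizer_apply] at hc
  have h1 : (π.combination (chart K S hS) (c ∘ Sum.inl)).1 = 0 := by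
    ext i
    simpa using congrFun hc (Sum.inl i)
  have h2 : c ∘ Sum.inl = 0 := by
    ext i
    rw [← π.star_dotProduct_C_combination (chart K S hS) (c ∘ Sum.inl) i, h1]
    simp
  have h3 : ofEigenCoord (compress_isHermitian K hS) (c ∘ Sum.inr) = 0 := by
    ext i
    have h4 := congrFun hc (Sum.inr i)
    rw [h2, map_zero] at h4
    simpa using h4
  have h4 : c ∘ Sum.inr = 0 := by
    rw [← eigenCoord_ofEigenCoord (compress_isHermitian K hS) (c ∘ Sum.inr), h3, map_zero]
  ext (i | i)
  · exact congrFun h2 i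
  · exact congrFun h4 i

theorem sumElim_dotProduct_sumElim {m n : Type*} [Fintype m] [Fintype n] (a : m → ℂ) (b : n → ℂ)
    (a' : m → ℂ) (b' : n → ℂ) :
    star (Sum.elim a b) ⬝ᵥ Sum.elim a' b' = star a ⬝ᵥ a' + star b ⬝ᵥ b' := by
  simp [dotProduct]

/-- On vectors coming from the domain the second row of the bordered matrix vanishes, so they are
orthogonal for its form to every `(0, η)`. The two diagonal parts are `∑ (λ_i - t) |c_i|²` and the
form of `S_K`. -/
theorem quad_diagonalizer (K : Finset (Idx d)) (t : ℝ) {S : Matrix (Idx d) (Idx d) ℂ}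
    (hS : S.IsHermitian) (c : Fin (π.numEigenvalues (chart K S hS)) ⊕ {i // i ∈ K} → ℂ) :
    quad (π.bordered K t S) (π.diagonalizer K hS c) =
      ∑ j, Sum.elim (fun i => π.eigenvalue (chart K S hS) i - t)
        (compress_isHermitian K hS).eigenvalues j * ‖c j‖ ^ 2 := by
  rw [diagonalizer_apply]
  set p := π.combination (chart K S hS) (c ∘ Sum.inl) with hp
  set η := ofEigenCoord (compress_isHermitian K hS) (c ∘ Sum.inr) with hη
  have hpd : p ∈ π.domain (chart K S hS) := π.combination_mem _ _
  have h1 := π.bordered_mulVec_of_mem t hpd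
  have h2 : star (Sum.elim p.1 ((colE K)ᴴ *ᵥ p.2)) ⬝ᵥ
      (π.bordered K t S *ᵥ Sum.elim (0 : ι → ℂ) η) = 0 := by
    rw [Matrix.dotProduct_mulVec]
    have h3 : star (Sum.elim p.1 ((colE K)ᴴ *ᵥ p.2)) ᵥ* π.bordered K t S =
        star (Sum.elim (π.residual t p) 0) := by
      rw [← h1, Matrix.star_mulVec, (π.bordered_isHermitian K t hS).eq]
    rw [h3, sumElim_dotProduct_sumElim]
    simp
  have h4 : star (Sum.elim (0 : ι → ℂ) η) ⬝ᵥ (π.bordered K t S *ᵥ Sum.elim (0 : ι → ℂ) η) =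
      star η ⬝ᵥ (compress K S *ᵥ η) := by
    rw [bordered_mulVec, sumElim_dotProduct_sumElim, compress]
    simp [Matrix.mulVec_mulVec, Matrix.mul_assoc]
  rw [quad, Matrix.mulVec_add, star_add, add_dotProduct, dotProduct_add, dotProduct_add, h1, h2,
    h4, sumElim_dotProduct_sumElim, sumElim_dotProduct_sumElim]
  have h5 := π.re_star_dotProduct_residual_combination (chart K S hS) t (c ∘ Sum.inl)
  rw [← hp] at h5
  have h6 := quad_eq_sum (compress_isHermitian K hS) η
  rw [hη, eigenCoord_ofEigenCoord, ← hη, quad] at h6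
  simp [h5, h6]

theorem card_filter_sum {m n : Type*} [Fintype m] [Fintype n] (p : m ⊕ n → Prop)
    [DecidablePred p] : (Finset.univ.filter p).card =
      (Finset.univ.filter fun i => p (Sum.inl i)).card +
        (Finset.univ.filter fun i => p (Sum.inr i)).card := by
  simp only [Finset.card_filter, Fintype.sum_sum_type]

/-- The inertia of the bordered matrix. -/
theorem below_add_eq_rNeg (K : Finset (Idx d)) (t : ℝ) {S : Matrix (Idx d) (Idx d) ℂ}
    (hS : S.IsHermitian) (h0 : rZero (π.bordered_isHermitian K t hS) = 0) :
    π.below (chart K S hS) t + rNeg (compress_isHermitian K hS) +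
      rZero (compress_isHermitian K hS) = rNeg (π.bordered_isHermitian K t hS) := by
  -- There are `card ι - r^0 + #K` weights, and each of the `r^0` zero eigenvalues of `S_K` enters
  -- both bounds. The two left sides thus add up to at least `card ι + #K`, the size of the matrix,
  -- and both bounds are equalities.
  have h1 := card_filter_nonpos_le _ h0 _ (π.diagonalizer_injective K hS) _
    (π.quad_diagonalizer K t hS)
  have h2 := card_filter_nonneg_le _ h0 _ (π.diagonalizer_injective K hS) _
    (π.quad_diagonalizer K t hS)
  rw [card_filter_sum] at h1 h2
  replace h1 : (Finset.univ.filter fun i => π.eigenvalue (chart K S hS) i - t ≤ 0).card +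
      (Finset.univ.filter fun i => (compress_isHermitian K hS).eigenvalues i ≤ 0).card ≤ _ := h1
  replace h2 : (Finset.univ.filter fun i => 0 ≤ π.eigenvalue (chart K S hS) i - t).card +
      (Finset.univ.filter fun i => 0 ≤ (compress_isHermitian K hS).eigenvalues i).card ≤ _ := h2
  have h3 := rPos_add_rNeg_add_rZero (π.bordered_isHermitian K t hS)
  have h4 := rPos_add_rNeg_add_rZero (compress_isHermitian K hS)
  have h5 := π.numEigenvalues_add (chart K S hS)
  rw [nullityB_chart] at h5
  rw [Fintype.card_sum] at h3
  have h6 : π.below (chart K S hS) t ≤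
      (Finset.univ.filter fun i => π.eigenvalue (chart K S hS) i - t ≤ 0).card := by
    refine Finset.card_le_card fun i hi => ?_
    simp only [Finset.mem_filter, Finset.mem_univ, true_and] at hi ⊢
    linarith
  have h7 : π.below (chart K S hS) t +
      (Finset.univ.filter fun i => 0 ≤ π.eigenvalue (chart K S hS) i - t).card =
      π.numEigenvalues (chart K S hS) := by
    have h8 := Finset.card_filter_add_card_filter_not (s := Finset.univ)
      (fun i => π.eigenvalue (chart K S hS) i < t)
    rw [Finset.card_univ, Fintype.card_fin] at h8
    refine Eq.trans ?_ h8
    simp [below]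
  have h8 : (Finset.univ.filter fun i => (compress_isHermitian K hS).eigenvalues i ≤ 0).card =
      rNeg (compress_isHermitian K hS) + rZero (compress_isHermitian K hS) := by
    have h9 := Finset.card_filter_add_card_filter_not (s := Finset.univ)
      (fun i => (compress_isHermitian K hS).eigenvalues i ≤ 0)
    simp only [not_le] at h9
    change _ + rPos (compress_isHermitian K hS) = _ at h9
    rw [Finset.card_univ] at h9
    omega
  have h9 : (Finset.univ.filter fun i => 0 ≤ (compress_isHermitian K hS).eigenvalues i).card =
      rPos (compress_isHermitian K hS) + rZero (compress_isHermitian K hS) := by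
    have h9 := Finset.card_filter_add_card_filter_not (s := Finset.univ)
      (fun i => 0 ≤ (compress_isHermitian K hS).eigenvalues i)
    simp only [not_le] at h9
    change _ + rNeg (compress_isHermitian K hS) = _ at h9
    rw [Finset.card_univ] at h9
    omega
  omega

/-- Near a boundary condition for which `t` is not an eigenvalue, the number of eigenvalues below
`t` is determined by the inertia of the coordinate. -/
theorem eventually_below_add_eq (K : Finset (Idx d)) {t : ℝ} {S : Matrix (Idx d) (Idx d) ℂ}
    (hS : S.IsHermitian) (ht : ∀ i, π.eigenvalue (chart K S hS) i ≠ t) :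
    ∀ᶠ κ in 𝓝 (chart K S hS), ∀ S' hS', κ = chart K S' hS' →
      π.below κ t + rNeg (compress_isHermitian K hS') + rZero (compress_isHermitian K hS') =
        π.below (chart K S hS) t + rNeg (compress_isHermitian K hS) +
          rZero (compress_isHermitian K hS) := by
  have h0 : rZero (π.bordered_isHermitian K t hS) = 0 :=
    rZero_eq_zero_of_mulVec _ (π.eq_zero_of_bordered_mulVec hS (π.eigenspace_eq_bot ht))
  have h1 := (π.continuous_bordered K t).continuousAt.eventually
    (eventually_rNeg_eq (π.bordered_isHermitian K t hS) h0)
  filter_upwards [eventually_chart hS h1] with κ hκ S' hS' hκS'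
  subst hκS'
  obtain ⟨h2, h3⟩ := hκ S' hS' rfl (π.bordered_isHermitian K t hS')
  rw [π.below_add_eq_rNeg K t hS' h3, h2, π.below_add_eq_rNeg K t hS h0]

end Pencil

/-! ### Solutions of an equation of Atkinson type and their nodal values -/

section StepIntegrand

variable {d : ℕ} {σ : Type*} [Fintype σ]

/-- The sum of the functions `x ↦ F x c_j`, each one restricted to the set `I_j`. -/
def stepIntegrand (F : ℝ → Matrix (Fin d) (Fin d) ℂ) (I : σ → Set ℝ) (c : σ → Fin d → ℂ)
    (x : ℝ) : Fin d → ℂ := ∑ j, (I j).indicator (fun x => F x *ᵥ c j) x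

theorem stepIntegrand_of_mem (F : ℝ → Matrix (Fin d) (Fin d) ℂ) {I : σ → Set ℝ}
    (hI : ∀ x j j', x ∈ I j → x ∈ I j' → j = j') (c : σ → Fin d → ℂ) {x : ℝ} {j : σ}
    (hx : x ∈ I j) : stepIntegrand F I c x = F x *ᵥ c j := by
  rw [stepIntegrand, Finset.sum_eq_single j, indicator_of_mem hx]
  · intro j' _ hj'
    exact indicator_of_notMem (fun h => hj' (hI x j' j h hx)) _
  · simp

theorem stepIntegrand_of_eq_zero {F : ℝ → Matrix (Fin d) (Fin d) ℂ} (I : σ → Set ℝ)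
    (c : σ → Fin d → ℂ) {x : ℝ} (hx : F x = 0) : stepIntegrand F I c x = 0 := by
  refine Finset.sum_eq_zero fun j _ => ?_
  by_cases h : x ∈ I j
  · rw [indicator_of_mem h, hx, Matrix.zero_mulVec]
  · rw [indicator_of_notMem h]

theorem stepIntegrand_zero (F : ℝ → Matrix (Fin d) (Fin d) ℂ) (I : σ → Set ℝ) (x : ℝ) :
    stepIntegrand F I 0 x = 0 := by
  simp [stepIntegrand]

theorem integrableOn_mulVec {F : ℝ → Matrix (Fin d) (Fin d) ℂ} {s : Set ℝ}
    (hF : ∀ k l, IntegrableOn (fun x => F x k l) s) (c : Fin d → ℂ) :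
    IntegrableOn (fun x => F x *ᵥ c) s := by
  refine Integrable.of_eval fun k => ?_
  simp only [Matrix.mulVec, dotProduct]
  exact integrable_finsetSum _ fun l _ => (hF k l).mul_const _

theorem integrable_stepIntegrand {F : ℝ → Matrix (Fin d) (Fin d) ℂ} {s : Set ℝ}
    (hF : ∀ k l, IntegrableOn (fun x => F x k l) s) {I : σ → Set ℝ}
    (hI : ∀ j, MeasurableSet (I j)) (hIs : ∀ j, I j ⊆ s) (c : σ → Fin d → ℂ) :
    Integrable (stepIntegrand F I c) := by
  unfold stepIntegrand
  refine integrable_finsetSum _ fun j _ => ?_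
  rw [integrable_indicator_iff (hI j)]
  exact (integrableOn_mulVec hF (c j)).mono_set (hIs j)

theorem matIntegral_mulVec {F : ℝ → Matrix (Fin d) (Fin d) ℂ} {s t : ℝ} (hst : s ≤ t)
    (hF : ∀ k l, IntegrableOn (fun x => F x k l) (Icc s t)) (c : Fin d → ℂ) :
    ∫ x in s..t, F x *ᵥ c = matIntegral F s t *ᵥ c := by
  have hF' : ∀ k l, IntegrableOn (fun x => F x k l) (Ioc s t) :=
    fun k l => (hF k l).mono_set Ioc_subset_Icc_self
  ext k
  simp only [matIntegral, Matrix.mulVec, dotProduct, Matrix.of_apply,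
    intervalIntegral.integral_of_le hst]
  rw [eval_integral fun k => (integrableOn_mulVec hF' c).eval k]
  simp only [Matrix.mulVec, dotProduct]
  rw [integral_finsetSum _ fun l _ => (hF' k l).mul_const _]
  simp only [integral_mul_const]

theorem matIntegral_isHermitian {F : ℝ → Matrix (Fin d) (Fin d) ℂ} {s t : ℝ} (hst : s ≤ t)
    (hF : ∀ᵐ x, x ∈ Icc s t → (F x).IsHermitian) : (matIntegral F s t).IsHermitian := by
  ext k l
  simp only [matIntegral, Matrix.conjTranspose_apply, Matrix.of_apply,
    intervalIntegral.integral_of_le hst]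
  refine (integral_conj (f := fun x => F x l k)).symm.trans ?_
  refine integral_congr_ae ?_
  rw [EventuallyEq, ae_restrict_iff' measurableSet_Ioc]
  filter_upwards [hF] with x hx hxs
  exact (hx (Ioc_subset_Icc_self hxs)).apply k l

end StepIntegrand

namespace Equation

variable {d N : ℕ} (ω : Equation d N)

/-- The interval `[a_i, b_i]`. -/
def seg (i : Fin (N + 1)) : Set ℝ := Icc (ω.lo i) (ω.hi i)

/-- The interval `[b_{j-1}, a_j]`. -/
def gap (j : Fin N) : Set ℝ := Icc (ω.hi j.castSucc) (ω.lo j.succ)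

theorem hi_le_hi (i j : Fin (N + 1)) (h : i ≤ j) : ω.hi i ≤ ω.hi j := by
  have hm : Monotone ω.hi :=
    Fin.monotone_iff_le_succ.2 fun j => ((ω.hi_lt_lo j).trans (ω.lo_lt_hi _)).le
  exact hm h

theorem a_le_lo (i : Fin (N + 1)) : ω.a ≤ ω.lo i := ω.lo_le_lo 0 i (Fin.zero_le _)

theorem hi_le_b (i : Fin (N + 1)) : ω.hi i ≤ ω.b := ω.hi_le_hi i _ (Fin.le_last _)

theorem seg_subset (i : Fin (N + 1)) : ω.seg i ⊆ Icc ω.a ω.b :=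
  Icc_subset_Icc (ω.a_le_lo i) (ω.hi_le_b i)

theorem a_le_hi (i : Fin (N + 1)) : ω.a ≤ ω.hi i := (ω.a_le_lo i).trans (ω.lo_lt_hi i).le

theorem lo_le_b (i : Fin (N + 1)) : ω.lo i ≤ ω.b := (ω.lo_lt_hi i).le.trans (ω.hi_le_b i)

theorem gap_subset (j : Fin N) : ω.gap j ⊆ Icc ω.a ω.b :=
  Icc_subset_Icc (ω.a_le_hi _) (ω.lo_le_b _)

/-- The point `a_i` of `[a, b]`. -/
def loPt (i : Fin (N + 1)) : ω.Interval := ⟨ω.lo i, ω.a_le_lo i, ω.lo_le_b i⟩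

/-- The point `b_i` of `[a, b]`. -/
def hiPt (i : Fin (N + 1)) : ω.Interval := ⟨ω.hi i, ω.a_le_hi i, ω.hi_le_b i⟩

theorem hi_lt_lo_of_lt {i i' : Fin (N + 1)} (h : i < i') : ω.hi i < ω.lo i' := by
  obtain ⟨j, rfl⟩ := Fin.exists_castSucc_eq.2 (Fin.ne_last_of_lt h)
  exact (ω.hi_lt_lo j).trans_le (ω.lo_le_lo _ _ (Fin.castSucc_lt_iff_succ_le.1 h))

theorem seg_unique (x : ℝ) (i i' : Fin (N + 1)) (h : x ∈ ω.seg i) (h' : x ∈ ω.seg i') :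
    i = i' := by
  rcases lt_trichotomy i i' with hlt | heq | hlt
  · exact absurd (h.2.trans_lt (ω.hi_lt_lo_of_lt hlt)) h'.1.not_gt
  · exact heq
  · exact absurd (h'.2.trans_lt (ω.hi_lt_lo_of_lt hlt)) h.1.not_gt

theorem gap_unique (x : ℝ) (j j' : Fin N) (h : x ∈ ω.gap j) (h' : x ∈ ω.gap j') : j = j' := by
  have key : ∀ j j' : Fin N, j < j' → x ∈ ω.gap j → x ∈ ω.gap j' → False := by
    intro j j' hlt h h'
    have h1 : j.succ ≤ j'.castSucc := Fin.castSucc_lt_iff_succ_le.1 hlt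
    have h2 := (ω.lo_le_lo _ _ h1).trans_lt (ω.lo_lt_hi j'.castSucc)
    exact (h.2.trans_lt h2).not_ge h'.1
  rcases lt_trichotomy j j' with hlt | heq | hlt
  · exact (key j j' hlt h h').elim
  · exact heq
  · exact (key j' j hlt h' h).elim

theorem mem_seg_or_mem_gap {x : ℝ} (hx : x ∈ Icc ω.a ω.b) :
    (∃ i, x ∈ ω.seg i) ∨ ∃ j, x ∈ ω.gap j := by
  have key : ∀ i : Fin (N + 1), x ≤ ω.hi i → (∃ i, x ∈ ω.seg i) ∨ ∃ j, x ∈ ω.gap j := by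
    intro i
    induction i using Fin.induction with
    | zero => exact fun h => Or.inl ⟨0, hx.1, h⟩
    | succ j ih =>
      intro h
      rcases le_total x (ω.hi j.castSucc) with h1 | h1
      · exact ih h1
      · rcases le_total x (ω.lo j.succ) with h2 | h2
        · exact Or.inr ⟨j, h1, h2⟩
        · exact Or.inl ⟨_, h2, h⟩
  exact key _ hx.2

/-- The coefficient `Q - z W`. -/
def QW (z : ℂ) (x : ℝ) : Matrix (Fin d) (Fin d) ℂ := ω.Q x - z • ω.W x

theorem ae_Pinv_eq_zero : ∀ᵐ x, ∀ i, x ∈ ω.seg i → ω.Pinv x = 0 := ae_all_iff.2 ω.Pinv_zero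

theorem ae_QW_eq_zero (z : ℂ) : ∀ᵐ x, ∀ j, x ∈ ω.gap j → ω.QW z x = 0 := by
  refine ae_all_iff.2 fun j => ?_
  filter_upwards [ω.QW_zero j] with x hx hxj
  rw [QW, (hx hxj).1, (hx hxj).2, smul_zero, sub_zero]

/-- Values of `v` outside the gaps do not matter, since `P⁻¹` vanishes there almost everywhere. The
right-hand side of the equation thus depends on finitely many vectors only. -/
theorem Pinv_mulVec_eq {c : Fin N → Fin d → ℂ} {v : ℝ → Fin d → ℂ}
    (hv : ∀ j, ∀ x ∈ ω.gap j, v x = c j) :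
    ∀ᵐ x, x ∈ Icc ω.a ω.b → ω.Pinv x *ᵥ v x = stepIntegrand ω.Pinv ω.gap c x := by
  filter_upwards [ω.ae_Pinv_eq_zero] with x hx hxab
  rcases ω.mem_seg_or_mem_gap hxab with ⟨i, hi⟩ | ⟨j, hj⟩
  · rw [stepIntegrand_of_eq_zero _ _ (hx i hi), hx i hi, Matrix.zero_mulVec]
  · rw [stepIntegrand_of_mem _ ω.gap_unique _ hj, hv j x hj]

theorem QW_mulVec_eq (z : ℂ) {c : Fin (N + 1) → Fin d → ℂ} {u : ℝ → Fin d → ℂ}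
    (hu : ∀ i, ∀ x ∈ ω.seg i, u x = c i) :
    ∀ᵐ x, x ∈ Icc ω.a ω.b → ω.QW z x *ᵥ u x = stepIntegrand (ω.QW z) ω.seg c x := by
  filter_upwards [ω.ae_QW_eq_zero z] with x hx hxab
  rcases ω.mem_seg_or_mem_gap hxab with ⟨i, hi⟩ | ⟨j, hj⟩
  · rw [stepIntegrand_of_mem _ ω.seg_unique _ hi, hu i x hi]
  · rw [stepIntegrand_of_eq_zero _ _ (hx j hj), hx j hj, Matrix.zero_mulVec]

theorem integrable_Pinv_step (c : Fin N → Fin d → ℂ) :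
    Integrable (stepIntegrand ω.Pinv ω.gap c) :=
  integrable_stepIntegrand ω.Pinv_integrable (fun _ => measurableSet_Icc) ω.gap_subset c

theorem integrable_QW_step (z : ℂ) (c : Fin (N + 1) → Fin d → ℂ) :
    Integrable (stepIntegrand (ω.QW z) ω.seg c) :=
  integrable_stepIntegrand (ω.QW_integrable z) (fun _ => measurableSet_Icc) ω.seg_subset c

theorem integral_Pinv_step_seg (c : Fin N → Fin d → ℂ) {i : Fin (N + 1)} {s t : ℝ}
    (hs : s ∈ ω.seg i) (ht : t ∈ ω.seg i) :
    ∫ x in s..t, stepIntegrand ω.Pinv ω.gap c x = 0 := by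
  rw [← intervalIntegral.integral_zero (a := s) (b := t) (μ := volume)]
  refine intervalIntegral.integral_congr_ae ?_
  filter_upwards [ω.ae_Pinv_eq_zero] with x hx hxst
  exact stepIntegrand_of_eq_zero _ _
    (hx i (ordConnected_Icc.uIcc_subset hs ht (uIoc_subset_uIcc hxst)))

theorem integral_QW_step_gap (z : ℂ) (c : Fin (N + 1) → Fin d → ℂ) {j : Fin N} {s t : ℝ}
    (hs : s ∈ ω.gap j) (ht : t ∈ ω.gap j) :
    ∫ x in s..t, stepIntegrand (ω.QW z) ω.seg c x = 0 := by
  rw [← intervalIntegral.integral_zero (a := s) (b := t) (μ := volume)]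
  refine intervalIntegral.integral_congr_ae ?_
  filter_upwards [ω.ae_QW_eq_zero z] with x hx hxst
  exact stepIntegrand_of_eq_zero _ _
    (hx j (ordConnected_Icc.uIcc_subset hs ht (uIoc_subset_uIcc hxst)))

theorem integral_Pinv_step_gap (c : Fin N → Fin d → ℂ) (j : Fin N) :
    ∫ x in ω.hi j.castSucc..ω.lo j.succ, stepIntegrand ω.Pinv ω.gap c x =
      matIntegral ω.Pinv (ω.hi j.castSucc) (ω.lo j.succ) *ᵥ c j := by
  rw [← matIntegral_mulVec (ω.hi_lt_lo j).le fun k l =>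
    (ω.Pinv_integrable k l).mono_set (ω.gap_subset j)]
  refine intervalIntegral.integral_congr fun x hx => ?_
  rw [uIcc_of_le (ω.hi_lt_lo j).le] at hx
  exact stepIntegrand_of_mem _ ω.gap_unique _ hx

theorem integral_QW_step_seg (z : ℂ) (c : Fin (N + 1) → Fin d → ℂ) (i : Fin (N + 1)) :
    ∫ x in ω.lo i..ω.hi i, stepIntegrand (ω.QW z) ω.seg c x =
      matIntegral (ω.QW z) (ω.lo i) (ω.hi i) *ᵥ c i := by
  rw [← matIntegral_mulVec (F := ω.QW z) (ω.lo_lt_hi i).le fun k l =>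
    (ω.QW_integrable z k l).mono_set (ω.seg_subset i)]
  refine intervalIntegral.integral_congr fun x hx => ?_
  rw [uIcc_of_le (ω.lo_lt_hi i).le] at hx
  exact stepIntegrand_of_mem _ ω.seg_unique _ hx

theorem ext_apply (f : C(ω.Interval, Fin d → ℂ)) (x : ω.Interval) : ω.ext f x = f x :=
  IccExtend_val _ _ _

/-- The nodal values `U_i = u(a_i)`, `V_0 = v(a)`, `V_{i+1} = v(b_i)` satisfy the difference
equations. -/
def IsNodal (z : ℂ) (U : Fin (N + 1) → Fin d → ℂ) (V : Fin (N + 2) → Fin d → ℂ) : Prop :=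
  (∀ i, V i.succ - V i.castSucc = matIntegral (ω.QW z) (ω.lo i) (ω.hi i) *ᵥ U i) ∧
  ∀ j : Fin N, U j.succ - U j.castSucc =
    matIntegral ω.Pinv (ω.hi j.castSucc) (ω.lo j.succ) *ᵥ V j.succ.castSucc

/-- The nodal values of `v`. -/
def nodeV (v : C(ω.Interval, Fin d → ℂ)) : Fin (N + 2) → Fin d → ℂ :=
  Fin.cons (v ω.aPt) fun i => v (ω.hiPt i)

section Solution

variable {ω} {z : ℂ} {u v : C(ω.Interval, Fin d → ℂ)}

theorem IsSolution.sub_fst (h : ω.IsSolution z u v) (s t : ω.Interval) :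
    u t - u s = ∫ x in s..t, ω.Pinv x *ᵥ ω.ext v x := by
  rw [(h t).1, (h s).1, add_sub_add_left_eq_sub, intervalIntegral.integral_interval_sub_left]
  · exact ω.intervalIntegrable_mulVec ω.Pinv_integrable v t
  · exact ω.intervalIntegrable_mulVec ω.Pinv_integrable v s

theorem IsSolution.sub_snd (h : ω.IsSolution z u v) (s t : ω.Interval) :
    v t - v s = ∫ x in s..t, ω.QW z x *ᵥ ω.ext u x := by
  rw [(h t).2, (h s).2, add_sub_add_left_eq_sub, intervalIntegral.integral_interval_sub_left]
  · rfl
  · exact ω.intervalIntegrable_mulVec (ω.QW_integrable z) u t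
  · exact ω.intervalIntegrable_mulVec (ω.QW_integrable z) u s

theorem IsSolution.fst_eq (h : ω.IsSolution z u v) {i : Fin (N + 1)} {s t : ω.Interval}
    (hs : (s : ℝ) ∈ ω.seg i) (ht : (t : ℝ) ∈ ω.seg i) : u t = u s := by
  rw [← sub_eq_zero, h.sub_fst,
    ← intervalIntegral.integral_zero (a := (s : ℝ)) (b := t) (μ := volume)]
  refine intervalIntegral.integral_congr_ae ?_
  filter_upwards [ω.ae_Pinv_eq_zero] with x hx hxst
  rw [hx i (ordConnected_Icc.uIcc_subset hs ht (uIoc_subset_uIcc hxst)), Matrix.zero_mulVec]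

theorem IsSolution.snd_eq (h : ω.IsSolution z u v) {j : Fin N} {s t : ω.Interval}
    (hs : (s : ℝ) ∈ ω.gap j) (ht : (t : ℝ) ∈ ω.gap j) : v t = v s := by
  rw [← sub_eq_zero, h.sub_snd,
    ← intervalIntegral.integral_zero (a := (s : ℝ)) (b := t) (μ := volume)]
  refine intervalIntegral.integral_congr_ae ?_
  filter_upwards [ω.ae_QW_eq_zero z] with x hx hxst
  rw [hx j (ordConnected_Icc.uIcc_subset hs ht (uIoc_subset_uIcc hxst)), Matrix.zero_mulVec]

theorem IsSolution.ext_fst_eq (h : ω.IsSolution z u v) (i : Fin (N + 1)) (x : ℝ)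
    (hx : x ∈ ω.seg i) : ω.ext u x = u (ω.loPt i) := by
  have h1 := ω.ext_apply u ⟨x, ω.seg_subset i hx⟩
  rw [h1]
  exact h.fst_eq (left_mem_Icc.2 (ω.lo_lt_hi i).le) hx

theorem IsSolution.ext_snd_eq (h : ω.IsSolution z u v) (j : Fin N) (x : ℝ)
    (hx : x ∈ ω.gap j) : ω.ext v x = v (ω.hiPt j.castSucc) := by
  have h1 := ω.ext_apply v ⟨x, ω.gap_subset j hx⟩
  rw [h1]
  exact h.snd_eq (left_mem_Icc.2 (ω.hi_lt_lo j).le) hx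

theorem uIoc_subset_Icc (s t : ω.Interval) : uIoc (s : ℝ) t ⊆ Icc ω.a ω.b :=
  uIoc_subset_uIcc.trans (ordConnected_Icc.uIcc_subset s.2 t.2)

theorem IsSolution.sub_fst_eq_step (h : ω.IsSolution z u v) (s t : ω.Interval) :
    u t - u s = ∫ x in s..t, stepIntegrand ω.Pinv ω.gap (fun j => v (ω.hiPt j.castSucc)) x := by
  rw [h.sub_fst]
  refine intervalIntegral.integral_congr_ae ?_
  filter_upwards [ω.Pinv_mulVec_eq h.ext_snd_eq] with x hx hxst
  exact hx (uIoc_subset_Icc s t hxst)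

theorem IsSolution.sub_snd_eq_step (h : ω.IsSolution z u v) (s t : ω.Interval) :
    v t - v s = ∫ x in s..t, stepIntegrand (ω.QW z) ω.seg (fun i => u (ω.loPt i)) x := by
  rw [h.sub_snd]
  refine intervalIntegral.integral_congr_ae ?_
  filter_upwards [ω.QW_mulVec_eq z h.ext_fst_eq] with x hx hxst
  exact hx (uIoc_subset_Icc s t hxst)

theorem IsSolution.isNodal (h : ω.IsSolution z u v) :
    ω.IsNodal z (fun i => u (ω.loPt i)) (ω.nodeV v) := by
  -- For `i ≥ 1` the entry with index `i` is `v(b_{i-1})`, which is also `v(a_i)` because `v` is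
  -- constant on the gap between them.
  have hlo : ∀ i : Fin (N + 1), ω.nodeV v i.castSucc = v (ω.loPt i) := by
    intro i
    induction i using Fin.cases with
    | zero => rfl
    | succ j =>
      rw [← Fin.succ_castSucc, nodeV, Fin.cons_succ]
      exact (h.snd_eq (j := j) (s := ω.hiPt j.castSucc) (t := ω.loPt j.succ) (left_mem_Icc.2 (ω.hi_lt_lo j).le)
        (right_mem_Icc.2 (ω.hi_lt_lo j).le)).symm
  constructor
  · intro i
    rw [hlo]
    exact (h.sub_snd_eq_step (ω.loPt i) (ω.hiPt i)).trans (ω.integral_QW_step_seg z _ i)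
  · intro j
    have h1 : u (ω.loPt j.castSucc) = u (ω.hiPt j.castSucc) :=
      h.fst_eq (i := j.castSucc) (s := ω.hiPt j.castSucc) (t := ω.loPt j.castSucc) (right_mem_Icc.2 (ω.lo_lt_hi _).le)
        (left_mem_Icc.2 (ω.lo_lt_hi _).le)
    change u (ω.loPt j.succ) - u (ω.loPt j.castSucc) = _
    rw [h1, ← Fin.succ_castSucc, nodeV, Fin.cons_succ]
    exact (h.sub_fst_eq_step (ω.hiPt j.castSucc) (ω.loPt j.succ)).trans
      (ω.integral_Pinv_step_gap _ j)

/-- Injectivity of the passage to nodal values: the node values of `u` and `v(a)` determine `v` by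
integration, and then `v` and `u(a)` determine `u`. -/
theorem IsSolution.eq_zero (h : ω.IsSolution z u v) (hu : ∀ i, u (ω.loPt i) = 0)
    (hv : v ω.aPt = 0) : u = 0 ∧ v = 0 := by
  have hv0 : v = 0 := by
    ext1 t
    have h1 := h.sub_snd_eq_step ω.aPt t
    have h2 : (fun i => u (ω.loPt i)) = 0 := funext hu
    simp only [h2, stepIntegrand_zero, intervalIntegral.integral_zero, hv, sub_zero] at h1
    exact h1
  refine ⟨?_, hv0⟩
  ext1 t
  have h1 := h.sub_fst_eq_step ω.aPt t
  have h2 : (fun j : Fin N => v (ω.hiPt j.castSucc)) = 0 := by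
    rw [hv0]
    rfl
  have h3 : u ω.aPt = 0 := hu 0
  simp only [h2, stepIntegrand_zero, intervalIntegral.integral_zero, h3, sub_zero] at h1
  exact h1

/-- Integrate the step integrands built from `U` and `V`. The difference equations say that the
primitives take the values `U` on the segments and `V` on the gaps, so the step integrands are the
true right-hand sides. -/
theorem IsNodal.exists_isSolution {U : Fin (N + 1) → Fin d → ℂ} {V : Fin (N + 2) → Fin d → ℂ}
    (h : ω.IsNodal z U V) : ∃ u v : C(ω.Interval, Fin d → ℂ), ω.IsSolution z u v ∧
      (∀ i, u (ω.loPt i) = U i) ∧ v ω.aPt = V 0 ∧ v ω.bPt = V (Fin.last _) := by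
  set f := stepIntegrand ω.Pinv ω.gap fun j => V j.succ.castSucc with hf
  set g := stepIntegrand (ω.QW z) ω.seg U with hg
  have hfi : ∀ s t, IntervalIntegrable f volume s t :=
    fun s t => (ω.integrable_Pinv_step _).intervalIntegrable
  have hgi : ∀ s t, IntervalIntegrable g volume s t :=
    fun s t => (ω.integrable_QW_step z _).intervalIntegrable
  set u : ℝ → Fin d → ℂ := fun t => U 0 + ∫ x in ω.a..t, f x with hu
  set v : ℝ → Fin d → ℂ := fun t => V 0 + ∫ x in ω.a..t, g x with hv
  have hucont : Continuous u :=
    continuous_const.add (intervalIntegral.continuous_primitive hfi _)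
  have hvcont : Continuous v :=
    continuous_const.add (intervalIntegral.continuous_primitive hgi _)
  have husub : ∀ s t, u t = u s + ∫ x in s..t, f x := by
    intro s t
    rw [hu, add_assoc, intervalIntegral.integral_add_adjacent_intervals (hfi _ _) (hfi _ _)]
  have hvsub : ∀ s t, v t = v s + ∫ x in s..t, g x := by
    intro s t
    rw [hv, add_assoc, intervalIntegral.integral_add_adjacent_intervals (hgi _ _) (hgi _ _)]
  have huseg : ∀ i, u (ω.lo i) = U i → ∀ x ∈ ω.seg i, u x = U i := by
    intro i hi x hx
    rw [husub (ω.lo i) x, hi,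
      ω.integral_Pinv_step_seg _ (left_mem_Icc.2 (ω.lo_lt_hi i).le) hx, add_zero]
  have hulo : ∀ i, u (ω.lo i) = U i := by
    intro i
    induction i using Fin.induction with
    | zero =>
      change U 0 + ∫ x in ω.a..ω.a, f x = _
      simp
    | succ j ih =>
      rw [husub (ω.hi j.castSucc), huseg _ ih _ (right_mem_Icc.2 (ω.lo_lt_hi _).le), hf,
        integral_Pinv_step_gap, ← h.2 j]
      abel
  have hvhi : ∀ i, v (ω.lo i) = V i.castSucc → v (ω.hi i) = V i.succ := by
    intro i hi
    rw [hvsub (ω.lo i), hi, hg, integral_QW_step_seg, ← h.1 i]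
    abel
  have hvgap : ∀ j : Fin N, v (ω.lo j.castSucc) = V j.castSucc.castSucc →
      ∀ x ∈ ω.gap j, v x = V j.succ.castSucc := by
    intro j hj x hx
    rw [hvsub (ω.hi j.castSucc) x, hvhi _ hj,
      ω.integral_QW_step_gap z _ (left_mem_Icc.2 (ω.hi_lt_lo j).le) hx, add_zero,
      Fin.succ_castSucc]
  have hvlo : ∀ i, v (ω.lo i) = V i.castSucc := by
    intro i
    induction i using Fin.induction with
    | zero =>
      change V 0 + ∫ x in ω.a..ω.a, g x = _
      simp
    | succ j ih => exact hvgap j ih _ (right_mem_Icc.2 (ω.hi_lt_lo _).le)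
  let u' : C(ω.Interval, Fin d → ℂ) := ⟨fun t => u t, hucont.comp continuous_subtype_val⟩
  let v' : C(ω.Interval, Fin d → ℂ) := ⟨fun t => v t, hvcont.comp continuous_subtype_val⟩
  have hu' : ∀ x ∈ Icc ω.a ω.b, ω.ext u' x = u x := fun x hx => ω.ext_apply u' ⟨x, hx⟩
  have hv' : ∀ x ∈ Icc ω.a ω.b, ω.ext v' x = v x := fun x hx => ω.ext_apply v' ⟨x, hx⟩
  refine ⟨u', v', fun t => ⟨?_, ?_⟩, hulo, hvlo 0, hvhi _ (hvlo (Fin.last N))⟩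
  · change u t = u ω.a + _
    rw [husub ω.a t]
    congr 1
    refine intervalIntegral.integral_congr_ae ?_
    filter_upwards [ω.Pinv_mulVec_eq fun j => hvgap j (hvlo _)] with x hx hxt
    have hxab := uIoc_subset_Icc ω.aPt t hxt
    rw [hv' x hxab, hx hxab]
  · change v t = v ω.a + _
    rw [hvsub ω.a t]
    congr 1
    refine intervalIntegral.integral_congr_ae ?_
    filter_upwards [ω.QW_mulVec_eq z fun i => huseg i (hulo i)] with x hx hxt
    have hxab := uIoc_subset_Icc ω.aPt t hxt
    rw [hu' x hxab]
    exact (hx hxab).symm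

end Solution

end Equation

/-! ### The Hermitian pencil of an equation. -/

open scoped MatrixOrder in
theorem exists_conjTranspose_mul_self {m : Type} [Fintype m] [DecidableEq m] {M : Matrix m m ℂ}
    (hM : M.PosDef) : ∃ C : Matrix m m ℂ, IsUnit C ∧ M = Cᴴ * C := by
  obtain ⟨C, hC, rfl⟩ := CStarAlgebra.isStrictlyPositive_iff_eq_star_mul_self.1
    hM.isStrictlyPositive
  exact ⟨C, hC, rfl⟩

theorem isUnit_blockDiagonal {m o : Type} [Fintype m] [DecidableEq m] [Fintype o] [DecidableEq o]
    {C : o → Matrix m m ℂ} (hC : ∀ i, IsUnit (C i)) : IsUnit (Matrix.blockDiagonal C) := by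
  rw [Matrix.isUnit_iff_isUnit_det, Matrix.det_blockDiagonal, isUnit_iff_ne_zero,
    Finset.prod_ne_zero_iff]
  exact fun i _ => ((Matrix.isUnit_iff_isUnit_det _).1 (hC i)).ne_zero

theorem blockDiagonal_mulVec {m o : Type} [Fintype m] [Fintype o] [DecidableEq o]
    (M : o → Matrix m m ℂ) (u : m × o → ℂ) (k : m) (i : o) :
    (Matrix.blockDiagonal M *ᵥ u) (k, i) = (M i *ᵥ fun l => u (l, i)) k := by
  simp [Matrix.mulVec, dotProduct, Matrix.blockDiagonal_apply, Fintype.sum_prod_type]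

/-- The difference operator `(u_i) ↦ (u_{j+1} - u_j)`. -/
def diffMatrix (d N : ℕ) : Matrix (Fin d × Fin N) (Fin d × Fin (N + 1)) ℂ :=
  Matrix.of fun p q => if p.1 = q.1 then
    (if q.2 = p.2.succ then 1 else 0) - (if q.2 = p.2.castSucc then 1 else 0) else 0

theorem diffMatrix_mulVec {d N : ℕ} (u : Fin d × Fin (N + 1) → ℂ) (k : Fin d) (j : Fin N) :
    (diffMatrix d N *ᵥ u) (k, j) = u (k, j.succ) - u (k, j.castSucc) := by
  simp [diffMatrix, Matrix.mulVec, dotProduct, Fintype.sum_prod_type, sub_mul,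
    Finset.sum_sub_distrib, ite_mul]

theorem diffMatrix_conjTranspose_mulVec {d N : ℕ} (q : Fin d × Fin N → ℂ) (k : Fin d)
    (i : Fin (N + 1)) : ((diffMatrix d N)ᴴ *ᵥ q) (k, i) =
      (∑ j : Fin N, if i = j.succ then q (k, j) else 0) -
        ∑ j : Fin N, if i = j.castSucc then q (k, j) else 0 := by
  have h : ∀ (x : Fin d) (j : Fin N), star (if x = k then
      ((if i = j.succ then 1 else 0) - (if i = j.castSucc then 1 else 0) : ℂ) else 0) * q (x, j) =
      if x = k then (if i = j.succ then q (k, j) else 0) -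
        (if i = j.castSucc then q (k, j) else 0) else 0 := by
    intro x j
    by_cases hx : x = k
    · subst hx
      simp only [if_true]
      split_ifs <;> simp
    · simp [hx]
  simp only [diffMatrix, Matrix.mulVec, dotProduct, Fintype.sum_prod_type,
    Matrix.conjTranspose_apply, Matrix.of_apply, h]
  rw [Finset.sum_comm]
  simp [Finset.sum_sub_distrib]

/-- The boundary operator `u ↦ (-u_0, u_N)`. -/
def endMatrix (d N : ℕ) : Matrix (Idx d) (Fin d × Fin (N + 1)) ℂ :=
  Matrix.of fun s q => Sum.elim (fun k => if q = (k, 0) then -1 else 0)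
    (fun k => if q = (k, Fin.last N) then 1 else 0) s

theorem endMatrix_mulVec {d N : ℕ} (u : Fin d × Fin (N + 1) → ℂ) :
    endMatrix d N *ᵥ u = Sum.elim (-fun k => u (k, 0)) fun k => u (k, Fin.last N) := by
  ext (k | k) <;> simp [endMatrix, Matrix.mulVec, dotProduct, ite_mul]

theorem endMatrix_conjTranspose_mulVec {d N : ℕ} (z : Idx d → ℂ) (k : Fin d) (i : Fin (N + 1)) :
    ((endMatrix d N)ᴴ *ᵥ z) (k, i) =
      (if i = Fin.last N then z (Sum.inr k) else 0) - if i = 0 then z (Sum.inl k) else 0 := by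
  have h1 : ∀ (x : Fin d) (y : Fin (N + 1)) (c e : ℂ),
      star (if (k, i) = (x, y) then c else 0) * e = if k = x then
        (if i = y then star c * e else 0) else 0 := by
    intro x y c e
    by_cases h1 : k = x <;> by_cases h2 : i = y <;> simp [h1, h2]
  simp only [endMatrix, Matrix.mulVec, dotProduct, Fintype.sum_sum_type,
    Matrix.conjTranspose_apply, Matrix.of_apply, Sum.elim_inl, Sum.elim_inr, h1]
  simp only [Finset.sum_ite_eq, Finset.mem_univ, if_true]
  split_ifs <;> simp
  ring

/-- The first and the last node are distinct, so the rows are orthonormal. -/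
theorem endMatrix_mul_conjTranspose {d N : ℕ} (hN : 1 < N) :
    endMatrix d N * (endMatrix d N)ᴴ = 1 := by
  have h0 : (0 : Fin (N + 1)) ≠ Fin.last N := by
    rw [Ne, Fin.ext_iff, Fin.val_zero, Fin.val_last]
    omega
  refine Matrix.ext_of_mulVec_single fun s => ?_
  rw [← Matrix.mulVec_mulVec, endMatrix_mulVec, Matrix.one_mulVec]
  ext (k | k)
  · simp [endMatrix_conjTranspose_mulVec, h0]
  · simp [endMatrix_conjTranspose_mulVec, h0.symm]

namespace Equation

variable {d N : ℕ} (ω : Equation d N)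

theorem exists_factor (i : Fin (N + 1)) :
    ∃ C : Matrix (Fin d) (Fin d) ℂ, IsUnit C ∧ matIntegral ω.W (ω.lo i) (ω.hi i) = Cᴴ * C :=
  exists_conjTranspose_mul_self (ω.W_posDef i)

/-- The pencil of an equation of Atkinson type. -/
def pencil (hN : 1 < N) : Pencil d (Fin d × Fin (N + 1)) where
  -- The second summand comes from solving `u_{j+1} - u_j = (∫ P⁻¹) V_{j+1}` for the interior values
  -- of `v` and substituting them into the other difference equation.
  L := Matrix.blockDiagonal (fun i => matIntegral ω.Q (ω.lo i) (ω.hi i)) +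
    (diffMatrix d N)ᴴ * Matrix.blockDiagonal
      (fun j : Fin N => (matIntegral ω.Pinv (ω.hi j.castSucc) (ω.lo j.succ))⁻¹) * diffMatrix d N
  C := Matrix.blockDiagonal fun i => (ω.exists_factor i).choose
  G := endMatrix d N
  hermitian := by
    have hQ : ∀ i, (matIntegral ω.Q (ω.lo i) (ω.hi i)).IsHermitian := by
      intro i
      refine matIntegral_isHermitian (ω.lo_lt_hi i).le ?_
      filter_upwards [ω.hermitian] with x hx hxi
      exact (hx (ω.seg_subset i hxi)).2.1
    have hP : ∀ j : Fin N,
        ((matIntegral ω.Pinv (ω.hi j.castSucc) (ω.lo j.succ))⁻¹).IsHermitian := by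
      intro j
      refine Matrix.IsHermitian.inv (matIntegral_isHermitian (ω.hi_lt_lo j).le ?_)
      filter_upwards [ω.hermitian] with x hx hxj
      exact (hx (ω.gap_subset j hxj)).1
    refine Matrix.IsHermitian.add ?_ (Matrix.isHermitian_conjTranspose_mul_mul _ ?_)
    · rw [Matrix.IsHermitian, Matrix.blockDiagonal_conjTranspose]
      simp only [(hQ _).eq]
    · rw [Matrix.IsHermitian, Matrix.blockDiagonal_conjTranspose]
      simp only [(hP _).eq]
  isUnit := isUnit_blockDiagonal fun i => (ω.exists_factor i).choose_spec.1
  G_mul := endMatrix_mul_conjTranspose hN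

theorem matIntegral_QW (z : ℂ) (i : Fin (N + 1)) :
    matIntegral (ω.QW z) (ω.lo i) (ω.hi i) =
      matIntegral ω.Q (ω.lo i) (ω.hi i) - z • matIntegral ω.W (ω.lo i) (ω.hi i) := by
  ext k l
  have h := fun (F : ℝ → Matrix (Fin d) (Fin d) ℂ)
    (hF : ∀ k l, IntegrableOn (fun x => F x k l) (Icc (ω.lo 0) (ω.hi (Fin.last N)))) =>
    (intervalIntegrable_iff_integrableOn_Ioc_of_le (ω.lo_lt_hi i).le).2
      (((hF k l).mono_set (ω.seg_subset i)).mono_set Ioc_subset_Icc_self)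
  simp only [matIntegral, QW, Matrix.of_apply, Matrix.sub_apply, Matrix.smul_apply, smul_eq_mul]
  rw [intervalIntegral.integral_sub (h _ ω.Q_integrable) ((h _ ω.W_integrable).const_mul z),
    intervalIntegral.integral_const_mul]

/-- The difference equation in terms of the pencil. -/
theorem pencil_residual_apply (hN : 1 < N) (t : ℂ) (u : Fin d × Fin (N + 1) → ℂ)
    (V : Fin (N + 2) → Fin d → ℂ)
    (hV : ∀ j : Fin N, V j.succ.castSucc =
      (matIntegral ω.Pinv (ω.hi j.castSucc) (ω.lo j.succ))⁻¹ *ᵥ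
        ((fun k => u (k, j.succ)) - fun k => u (k, j.castSucc)))
    (k : Fin d) (i : Fin (N + 1)) :
    (ω.pencil hN).residual t (u, Sum.elim (V 0) (V (Fin.last _))) (k, i) =
      (matIntegral (ω.QW t) (ω.lo i) (ω.hi i) *ᵥ fun l => u (l, i)) k -
        (V i.succ - V i.castSucc) k := by
  rw [Pencil.residual_apply]
  simp only [pencil]
  rw [Matrix.mulVec_mulVec, Matrix.blockDiagonal_conjTranspose, ← Matrix.blockDiagonal_mul]
  have hW : ∀ i, ((ω.exists_factor i).choose)ᴴ * (ω.exists_factor i).choose =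
      matIntegral ω.W (ω.lo i) (ω.hi i) := fun i => (ω.exists_factor i).choose_spec.2.symm
  simp only [hW, Matrix.add_mulVec, ← Matrix.mulVec_mulVec, Pi.sub_apply, Pi.add_apply,
    Pi.smul_apply, blockDiagonal_mulVec, endMatrix_conjTranspose_mulVec,
    diffMatrix_conjTranspose_mulVec, matIntegral_QW, Matrix.sub_mulVec, Matrix.smul_mulVec,
    Sum.elim_inl, Sum.elim_inr, diffMatrix_mulVec]
  have h1 : ∀ j : Fin N, ((matIntegral ω.Pinv (ω.hi j.castSucc) (ω.lo j.succ))⁻¹ *ᵥ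
      fun l => u (l, j.succ) - u (l, j.castSucc)) k = V j.succ.castSucc k :=
    fun j => (congrFun (hV j) k).symm
  simp only [h1]
  -- Summation by parts: the adjoint difference of the interior values is `V_i - V_{i+1}`, except
  -- that `V_0` and `V_{N+1}` are missing at the two ends. The term `-G^* z` supplies exactly these.
  have h2 : (∑ j : Fin N, if i = j.succ then V j.succ.castSucc k else 0) =
      V i.castSucc k - if i = 0 then V 0 k else 0 := by
    induction i using Fin.cases with
    | zero => simp [(Fin.succ_ne_zero _).symm]
    | succ i => simp [Fin.succ_inj, Fin.succ_ne_zero]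
  have h3 : (∑ j : Fin N, if i = j.castSucc then V j.succ.castSucc k else 0) =
      V i.succ k - if i = Fin.last N then V (Fin.last _) k else 0 := by
    induction i using Fin.lastCases with
    | last => simp [(Fin.castSucc_ne_last _).symm]
    | cast i => simp [Fin.castSucc_inj, Fin.castSucc_ne_last]
  rw [h2, h3]
  ring

theorem isNodal_iff (hN : 1 < N) (t : ℂ) (u : Fin d × Fin (N + 1) → ℂ)
    (V : Fin (N + 2) → Fin d → ℂ) :
    ω.IsNodal t (fun i k => u (k, i)) V ↔
      (∀ j : Fin N, V j.succ.castSucc =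
        (matIntegral ω.Pinv (ω.hi j.castSucc) (ω.lo j.succ))⁻¹ *ᵥ
          ((fun k => u (k, j.succ)) - fun k => u (k, j.castSucc))) ∧
      (ω.pencil hN).residual t (u, Sum.elim (V 0) (V (Fin.last _))) = 0 := by
  rw [IsNodal, and_comm]
  have h1 : (∀ j : Fin N, (fun k => u (k, j.succ)) - (fun k => u (k, j.castSucc)) =
      matIntegral ω.Pinv (ω.hi j.castSucc) (ω.lo j.succ) *ᵥ V j.succ.castSucc) ↔
      ∀ j : Fin N, V j.succ.castSucc =
        (matIntegral ω.Pinv (ω.hi j.castSucc) (ω.lo j.succ))⁻¹ *ᵥ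
          ((fun k => u (k, j.succ)) - fun k => u (k, j.castSucc)) := by
    refine forall_congr' fun j => ?_
    have hdet := (Matrix.isUnit_iff_isUnit_det _).1 (ω.Pinv_invertible j)
    constructor
    · intro h
      rw [h, Matrix.mulVec_mulVec, Matrix.nonsing_inv_mul _ hdet, Matrix.one_mulVec]
    · intro h
      rw [h, Matrix.mulVec_mulVec, Matrix.mul_nonsing_inv _ hdet, Matrix.one_mulVec]
  rw [h1]
  refine and_congr_right fun hV => ?_
  constructor
  · intro h
    ext ⟨k, i⟩
    rw [ω.pencil_residual_apply hN t u V hV, h i, sub_self, Pi.zero_apply]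
  · intro h i
    ext k
    have h2 := congrFun h (k, i)
    rw [ω.pencil_residual_apply hN t u V hV, Pi.zero_apply, sub_eq_zero] at h2
    exact h2.symm

/-- The nodal values of a solution. -/
def nodes : (C(ω.Interval, Fin d → ℂ) × C(ω.Interval, Fin d → ℂ)) →ₗ[ℂ]
    (Fin d × Fin (N + 1) → ℂ) × (Idx d → ℂ) where
  toFun p := (fun q => p.1 (ω.loPt q.2) q.1, Sum.elim (p.2 ω.aPt) (p.2 ω.bPt))
  map_add' p p' := by
    refine Prod.ext rfl ?_
    ext (k | k) <;> rfl
  map_smul' c p := by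
    refine Prod.ext rfl ?_
    ext (k | k) <;> rfl

theorem holds_nodes_iff {κ : BoundarySpace d} {z : ℂ} {u v : C(ω.Interval, Fin d → ℂ)}
    (h : ω.IsSolution z u v) :
    κ.Holds (Sum.elim (-u ω.aPt) (u ω.bPt)) (Sum.elim (v ω.aPt) (v ω.bPt)) ↔
      κ.Holds (endMatrix d N *ᵥ (ω.nodes (u, v)).1) (ω.nodes (u, v)).2 := by
  have h1 : u ω.bPt = u (ω.loPt (Fin.last N)) :=
    h.fst_eq (i := Fin.last N) (s := ω.loPt (Fin.last N)) (t := ω.bPt)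
      (left_mem_Icc.2 (ω.lo_lt_hi _).le) (right_mem_Icc.2 (ω.lo_lt_hi _).le)
  rw [endMatrix_mulVec, h1]
  rfl

/-- The nodal map is the isomorphism. It holds for every complex `z`, so reality and finiteness of
the spectrum can be proved for the pencil. -/
theorem nonempty_eigenspace_equiv (hN : 1 < N) (κ : BoundarySpace d) (z : ℂ) :
    Nonempty (ω.eigenspace κ z ≃ₗ[ℂ] (ω.pencil hN).eigenspace κ z) := by
  have hmaps : ∀ p ∈ ω.eigenspace κ z, ω.nodes p ∈ (ω.pencil hN).eigenspace κ z := by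
    rintro ⟨u, v⟩ ⟨h1, h2⟩
    refine ⟨(ω.pencil hN).mem_domain.2 ((ω.holds_nodes_iff h1).1 h2), ?_⟩
    exact ((ω.isNodal_iff hN z (ω.nodes (u, v)).1 (ω.nodeV v)).1 h1.isNodal).2
  refine ⟨LinearEquiv.ofBijective (ω.nodes.restrict hmaps) ⟨?_, ?_⟩⟩
  · rintro ⟨p, hp⟩ ⟨q, hq⟩ h
    have h1 : ω.nodes (p - q) = 0 := by
      rw [map_sub, sub_eq_zero]
      exact congrArg Subtype.val h
    have h2 := ((ω.eigenspace κ z).sub_mem hp hq).1.eq_zero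
      (fun i => funext fun k => congrFun (congrArg Prod.fst h1) (k, i))
      (funext fun k => congrFun (congrArg Prod.snd h1) (Sum.inl k))
    exact Subtype.ext (sub_eq_zero.1 (Prod.ext h2.1 h2.2))
  · rintro ⟨⟨x, y⟩, h1, h2⟩
    -- The two ends of `V` are the boundary values of `v`; the interior entries are forced by the
    -- differences of `x`.
    set V : Fin (N + 2) → Fin d → ℂ := Fin.cons (fun k => y (Sum.inl k))
      (Fin.snoc (fun j : Fin N => (matIntegral ω.Pinv (ω.hi j.castSucc) (ω.lo j.succ))⁻¹ *ᵥ
          ((fun k => x (k, j.succ)) - fun k => x (k, j.castSucc))) fun k => y (Sum.inr k)) with hV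
    have hV0 : V 0 = fun k => y (Sum.inl k) := rfl
    have hVl : V (Fin.last _) = fun k => y (Sum.inr k) := by
      rw [hV, ← Fin.succ_last, Fin.cons_succ, Fin.snoc_last]
    have hy : y = Sum.elim (V 0) (V (Fin.last _)) := by
      rw [hV0, hVl]
      ext (k | k) <;> rfl
    have hnodal : ω.IsNodal z (fun i k => x (k, i)) V := by
      rw [ω.isNodal_iff hN]
      refine ⟨fun j => ?_, ?_⟩
      · rw [hV, ← Fin.succ_castSucc, Fin.cons_succ, Fin.snoc_castSucc]
      · rw [← hy]
        exact h2
    obtain ⟨u, v, huv, hu, hva, hvb⟩ := hnodal.exists_isSolution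
    have hnodes : ω.nodes (u, v) = (x, y) := by
      refine Prod.ext ?_ ?_
      · ext ⟨k, i⟩
        exact congrFun (hu i) k
      · rw [hy, ← hva, ← hvb]
        rfl
    refine ⟨⟨(u, v), huv, ?_⟩, Subtype.ext hnodes⟩
    rw [ω.holds_nodes_iff huv, hnodes]
    exact h1

end Equation

/-! ### The ordered eigenvalues -/

/-- In a sorted list the entries less than `t` form an initial segment. -/
theorem getElem_lt_iff_lt_countP (t : ℝ) {l : List ℝ} (hl : l.Pairwise (· ≤ ·)) {i : ℕ}
    (hi : i < l.length) : l[i] < t ↔ i < l.countP fun x => decide (x < t) := by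
  induction l generalizing i with
  | nil => simp at hi
  | cons a l ih =>
    rw [List.pairwise_cons] at hl
    rw [List.countP_cons]
    by_cases ha : a < t
    · rw [if_pos (by simpa using ha)]
      cases i with
      | zero => simpa using ha
      | succ i => simpa using ih hl.2 (by simpa using hi)
    · have h0 : l.countP (fun x => decide (x < t)) = 0 := by
        rw [List.countP_eq_zero]
        intro x hx
        simpa using (not_lt.1 ha).trans (hl.1 x hx)
      rw [if_neg (by simpa using ha), h0]
      simp only [add_zero, not_lt_zero, iff_false]
      cases i with
      | zero => simpa using ha
      | succ i =>
        exact ((not_lt.1 ha).trans (hl.1 _ (List.getElem_mem _))).not_gt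

theorem finsum_replicate_count (s : Multiset ℝ) :
    ∑ᶠ x : ℝ, Multiset.replicate (s.count x) x = s := by
  rw [finsum_eq_sum_of_support_subset (s := s.toFinset)]
  · simp only [← Multiset.nsmul_singleton]
    exact s.toFinset_sum_count_nsmul_eq
  · intro x hx
    rw [Function.mem_support] at hx
    by_contra h
    refine hx ?_
    rw [Multiset.count_eq_zero.2 (by simpa using h), Multiset.replicate_zero]

namespace Equation

variable {d N : ℕ} (ω : Equation d N)

theorem multiplicity_eq (hN : 1 < N) (κ : BoundarySpace d) (z : ℂ) : ω.multiplicity κ z =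
    (Finset.univ.filter fun i => ((ω.pencil hN).eigenvalue κ i : ℂ) = z).card := by
  rw [multiplicity, (ω.nonempty_eigenspace_equiv hN κ z).some.finrank_eq, Pencil.finrank_eigenspace]

theorem eigenvalues_eq (hN : 1 < N) (κ : BoundarySpace d) :
    ω.eigenvalues κ = Finset.univ.val.map ((ω.pencil hN).eigenvalue κ) := by
  rw [eigenvalues, ← finsum_replicate_count (Finset.univ.val.map ((ω.pencil hN).eigenvalue κ))]
  refine finsum_congr fun x => ?_
  rw [multiplicity_eq ω hN, Multiset.count_map]
  congr 1
  rw [Finset.card_def, Finset.filter_val]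
  congr 2
  ext i
  rw [Complex.ofReal_inj, eq_comm]

theorem count_eq_numEigenvalues (hN : 1 < N) (κ : BoundarySpace d) :
    ω.count κ = (ω.pencil hN).numEigenvalues κ := by
  rw [count, ω.eigenvalues_eq hN]
  simp

theorem count_add_nullityB (hN : 1 < N) (κ : BoundarySpace d) :
    ω.count κ + κ.nullityB = (N + 1) * d := by
  rw [ω.count_eq_numEigenvalues hN, Pencil.numEigenvalues_add]
  simp [mul_comm]

theorem spectrum_subset (hN : 1 < N) (κ : BoundarySpace d) :
    ω.spectrum κ ⊆ Set.range fun i => ((ω.pencil hN).eigenvalue κ i : ℂ) := by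
  intro z hz
  have h1 : Module.finrank ℂ ((ω.pencil hN).eigenspace κ z) ≠ 0 := by
    rw [Submodule.finrank_eq_zero.ne]
    intro h
    refine hz ((Submodule.eq_bot_iff _).2 fun p hp => ?_)
    obtain ⟨φ⟩ := ω.nonempty_eigenspace_equiv hN κ z
    have h3 : φ ⟨p, hp⟩ = 0 := Subtype.ext ((Submodule.eq_bot_iff _).1 h _ (φ ⟨p, hp⟩).2)
    exact congrArg Subtype.val (φ.map_eq_zero_iff.1 h3)
  rw [Pencil.finrank_eigenspace, Finset.card_ne_zero] at h1
  obtain ⟨i, hi⟩ := h1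
  exact ⟨i, (Finset.mem_filter.1 hi).2⟩

/-- The bridge from ordered eigenvalues to the counting function. The bounds on `n` keep the list
index `n - 1` in range, so the default value `0` never appears. -/
theorem eigenvalue_lt_iff (hN : 1 < N) {κ : BoundarySpace d} {n : ℕ} (h1 : 1 ≤ n)
    (h2 : n ≤ ω.count κ) (t : ℝ) :
    ω.eigenvalue n κ < t ↔ n ≤ (ω.pencil hN).below κ t := by
  have hlen : n - 1 < ((ω.eigenvalues κ).sort).length := by
    rw [Multiset.length_sort]
    change n - 1 < ω.count κ
    omega
  have h3 : ((ω.eigenvalues κ).sort).countP (fun x => decide (x < t)) =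
      (ω.pencil hN).below κ t := by
    have h4 : ((ω.eigenvalues κ).sort).countP (fun x => decide (x < t)) =
        (ω.eigenvalues κ).countP fun x => x < t := by
      conv_rhs => rw [← Multiset.sort_eq (ω.eigenvalues κ) (· ≤ ·)]
      rw [Multiset.coe_countP]
    rw [h4, ω.eigenvalues_eq hN, Multiset.countP_map]
    rfl
  rw [eigenvalue, List.getD_eq_getElem _ _ hlen,
    getElem_lt_iff_lt_countP t (Multiset.pairwise_sort _ _) hlen, h3]
  omega

theorem below_le_count (hN : 1 < N) (κ : BoundarySpace d) (t : ℝ) :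
    (ω.pencil hN).below κ t ≤ ω.count κ := by
  rw [ω.count_eq_numEigenvalues hN, Pencil.below]
  exact (Finset.card_filter_le _ _).trans_eq (by simp)

theorem tendsto_eigenvalue_atBot {ω : Equation d N} (hN : 1 < N) {κ : BoundarySpace d}
    {F : Filter (BoundarySpace d)} {p c n : ℕ}
    (hF : ∀ t : ℝ, (∀ i, (ω.pencil hN).eigenvalue κ i ≠ t) →
      ∀ᶠ κ' in F, (ω.pencil hN).below κ' t = (ω.pencil hN).below κ t + p)
    (hc : ∀ᶠ κ' in F, ω.count κ' = c) 
    (h1 : 1 ≤ n) (h2 : n ≤ p) (h3 : n ≤ c) :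
    Tendsto (ω.eigenvalue n) F atBot := by
  rw [tendsto_atBot]
  intro b
  obtain ⟨m, hm⟩ := (Set.finite_range ((ω.pencil hN).eigenvalue κ)).bddBelow
  -- Such a `t` lies below every eigenvalue at `κ`, yet nearby `p ≥ n` eigenvalues are less than
  -- `t`.
  set t := min b (m - 1) with ht
  filter_upwards [hF t fun i h => by
    have := hm ⟨i, rfl⟩
    have := min_le_right b (m - 1)
    linarith, hc] with κ' h4 h5
  have h6 := (ω.eigenvalue_lt_iff hN h1 (h3.trans_eq h5.symm) t).2 (by omega)
  exact h6.le.trans (min_le_left _ _)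

theorem tendsto_eigenvalue_atTop {ω : Equation d N} (hN : 1 < N) {κ : BoundarySpace d}
    {F : Filter (BoundarySpace d)} {p c n : ℕ}
    (hF : ∀ t : ℝ, (∀ i, (ω.pencil hN).eigenvalue κ i ≠ t) →
      ∀ᶠ κ' in F, (ω.pencil hN).below κ' t = (ω.pencil hN).below κ t + p)
    (hc : ∀ᶠ κ' in F, ω.count κ' = c) 
    (h2 : p + ω.count κ < n) (h3 : n ≤ c) :
    Tendsto (ω.eigenvalue n) F atTop := by
  rw [tendsto_atTop]
  intro b
  obtain ⟨m, hm⟩ := (Set.finite_range ((ω.pencil hN).eigenvalue κ)).bddAbove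
  -- Such a `t` lies above every eigenvalue at `κ`, yet nearby at most `p + count κ < n` eigenvalues
  -- are less than `t`.
  set t := max b (m + 1) with ht
  filter_upwards [hF t fun i h => by
    have := hm ⟨i, rfl⟩
    have := le_max_right b (m + 1)
    linarith, hc] with κ' h4 h5
  have h6 := (ω.eigenvalue_lt_iff hN (by omega) (h3.trans_eq h5.symm) t).not.2 (by
    have := ω.below_le_count hN κ t
    omega)
  exact (le_max_left _ _).trans (not_lt.1 h6)

theorem tendsto_eigenvalue_nhds {ω : Equation d N} (hN : 1 < N) {κ : BoundarySpace d}
    {F : Filter (BoundarySpace d)} {p c n : ℕ}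
    (hF : ∀ t : ℝ, (∀ i, (ω.pencil hN).eigenvalue κ i ≠ t) →
      ∀ᶠ κ' in F, (ω.pencil hN).below κ' t = (ω.pencil hN).below κ t + p)
    (hc : ∀ᶠ κ' in F, ω.count κ' = c) 
    (h1 : p < n) (h2 : n ≤ p + ω.count κ) (h3 : n ≤ c) :
    Tendsto (ω.eigenvalue n) F (𝓝 (ω.eigenvalue (n - p) κ)) := by
  -- The counting hypothesis is available only off the finite spectrum at `κ`, so the limit is
  -- enclosed between admissible values of `t`, which are dense.
  have hex : ∀ a b : ℝ, a < b → ∃ t, a < t ∧ t < b ∧ ∀ i, (ω.pencil hN).eigenvalue κ i ≠ t := by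
    intro a b hab
    obtain ⟨t, h4, h5⟩ := (Set.Ioo_infinite hab).exists_notMem_finset
      (Finset.univ.image ((ω.pencil hN).eigenvalue κ))
    exact ⟨t, h4.1, h4.2, fun i hi => h5 (Finset.mem_image.2 ⟨i, Finset.mem_univ i, hi⟩)⟩
  rw [tendsto_order]
  constructor
  · intro a ha
    obtain ⟨t, hat, htL, ht⟩ := hex a _ ha
    filter_upwards [hF t ht, hc] with κ' h4 h5
    have h6 := (ω.eigenvalue_lt_iff hN (κ := κ) (n := n - p) (by omega) (by omega) t).not.1
      htL.not_gt
    have h7 := (ω.eigenvalue_lt_iff hN (by omega) (h3.trans_eq h5.symm) t).not.2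
      (show ¬ n ≤ _ by omega)
    exact hat.trans_le (not_lt.1 h7)
  · intro b hb
    obtain ⟨t, hLt, htb, ht⟩ := hex _ b hb
    filter_upwards [hF t ht, hc] with κ' h4 h5
    have h6 := (ω.eigenvalue_lt_iff hN (κ := κ) (n := n - p) (by omega) (by omega) t).1 hLt
    have h7 := (ω.eigenvalue_lt_iff hN (by omega) (h3.trans_eq h5.symm) t).2
      (show n ≤ _ by omega)
    exact h7.trans htb

end Equation

/-! ### Asymptotics on areas, continuity on layers, and the singular set. -/

theorem nullityB_of_mem_area {d : ℕ} {K : Finset (Idx d)} {r₀ rp rm : ℕ} {κ : BoundarySpace d}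
    (h : κ ∈ area K r₀ rp rm) : κ.nullityB = r₀ := by
  obtain ⟨S, hS, rfl, h0, -⟩ := h
  rw [nullityB_chart, h0]

/-- The chart with `S_K = 0` makes `κ` a point of the most degenerate area `J_K^{(#K, 0, 0)}`. Near
`κ` the layer stays inside this area, by `mem_area_of_nullityB_eq_card`. -/
theorem exists_mem_area_nullityB {d : ℕ} (κ : BoundarySpace d) :
    ∃ K : Finset (Idx d), K.card = κ.nullityB ∧ chartDomain K ∈ 𝓝 κ ∧
      κ ∈ area K κ.nullityB 0 0 := by
  obtain ⟨K, S, hS, hK, hκ, -⟩ := exists_chart_compress_eq_zero κ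
  refine ⟨K, hK, hκ ▸ chartDomain_mem_nhds hS, S, hS, hκ, ?_⟩
  have h1 := rPos_add_rNeg_add_rZero (compress_isHermitian K hS)
  have h2 := nullityB_chart K hS
  rw [← hκ] at h2
  rw [Fintype.card_coe] at h1
  omega

theorem mem_area_of_nullityB_eq_card {d : ℕ} {K : Finset (Idx d)} {κ : BoundarySpace d}
    (h : κ ∈ chartDomain K) (hκ : κ.nullityB = K.card) : κ ∈ area K K.card 0 0 := by
  obtain ⟨S, hS, rfl⟩ := h
  rw [nullityB_chart] at hκ
  have h1 := rPos_add_rNeg_add_rZero (compress_isHermitian K hS)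
  rw [Fintype.card_coe] at h1
  exact ⟨S, hS, rfl, by omega, by omega, by omega⟩

namespace Equation

variable {d N : ℕ} (ω : Equation d N)

/-- Local constancy of `below + r^- + r^0` is that of `below - r^+`, since the three indices add up
to `#K`. -/
theorem eventually_below_area (hN : 1 < N) {K : Finset (Idx d)} {r₀ rp rm s₀ sp sm : ℕ}
    (hr : r₀ + rp + rm = K.card) (hs : s₀ + sp + sm = K.card) (hp : sp ≤ rp)
    {κ : BoundarySpace d} (hκ : κ ∈ area K s₀ sp sm) (t : ℝ)
    (ht : ∀ i, (ω.pencil hN).eigenvalue κ i ≠ t) :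
    ∀ᶠ κ' in 𝓝[area K r₀ rp rm] κ,
      (ω.pencil hN).below κ' t = (ω.pencil hN).below κ t + (rp - sp) := by
  obtain ⟨S, hS, rfl, h0, h1, h2⟩ := hκ
  filter_upwards [mem_nhdsWithin_of_mem_nhds
    ((ω.pencil hN).eventually_below_add_eq K hS ht), self_mem_nhdsWithin] with κ' h3 h4
  obtain ⟨S', hS', h5, h6, h7, h8⟩ := h4
  have h9 := h3 S' hS' h5
  omega

theorem count_eq (hN : 1 < N) (κ : BoundarySpace d) :
    ω.count κ = (N + 1) * d - κ.nullityB := by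
  have := ω.count_add_nullityB hN κ
  omega

/-- As `#K ≤ 2d`, the truncated subtractions from `(N + 1) * d` are genuine, and every boundary
condition keeps at least `d` eigenvalues. -/
theorem two_mul_add_le (hN : 1 < N) : 2 * d + d ≤ (N + 1) * d := by
  have : 3 * d ≤ (N + 1) * d := Nat.mul_le_mul_right d (by omega)
  omega

theorem continuousOn_layer (hN : 1 < N) {k n : ℕ} (h1 : 1 ≤ n) (h2 : n ≤ (N + 1) * d - k) :
    ContinuousOn (ω.eigenvalue n) (layer d k) := by
  rintro κ rfl
  obtain ⟨K, hK, hdom, hκ⟩ := exists_mem_area_nullityB κ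
  -- Within the layer the inertia of `S_K` does not change near `κ`, so the limit theorem applies
  -- with index shift `0`.
  have hle : 𝓝[layer d κ.nullityB] κ ≤ 𝓝[area K κ.nullityB 0 0] κ := by
    refine le_inf inf_le_left (le_principal_iff.2 ?_)
    filter_upwards [mem_nhdsWithin_of_mem_nhds hdom, self_mem_nhdsWithin] with κ' h3 h4
    rw [← hK]
    exact mem_area_of_nullityB_eq_card h3 (Eq.trans h4 hK.symm)
  have hr : κ.nullityB + 0 + 0 = K.card := by omega
  have h := (tendsto_eigenvalue_nhds (n := n) hN
    (ω.eventually_below_area hN hr hr le_rfl hκ) (c := (N + 1) * d - κ.nullityB) (by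
      filter_upwards [self_mem_nhdsWithin] with κ' h3
      rw [ω.count_eq hN, nullityB_of_mem_area h3]) (by omega)
    (by rw [ω.count_eq hN]; omega) (by omega))
  exact h.mono_left hle

theorem chartDomain_empty_subset : chartDomain (∅ : Finset (Idx d)) ⊆ layer d 0 := by
  rintro _ ⟨S, hS, rfl⟩
  change _ = 0
  rw [nullityB_chart]
  have := rPos_add_rNeg_add_rZero (compress_isHermitian ∅ hS)
  rw [Fintype.card_coe, Finset.card_empty] at this
  omega

theorem area_asymptotics (hN : 1 < N) {K : Finset (Idx d)} {r₀ rp rm s₀ sp sm : ℕ}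
    (hr : r₀ + rp + rm = K.card) (hs : s₀ + sp + sm = K.card) (hp : sp ≤ rp) (hm : sm ≤ rm)
    {κ : BoundarySpace d} (hκ : κ ∈ area K s₀ sp sm) :
    (∀ n : ℕ, 1 ≤ n → n ≤ rp - sp →
      Tendsto (ω.eigenvalue n) (𝓝[area K r₀ rp rm] κ) atBot) ∧
    (∀ n : ℕ, rp - sp < n → n ≤ (N + 1) * d - r₀ - (rm - sm) →
      Tendsto (ω.eigenvalue n) (𝓝[area K r₀ rp rm] κ)
        (𝓝 (ω.eigenvalue (n - (rp - sp)) κ))) ∧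
    (∀ n : ℕ, (N + 1) * d - r₀ - (rm - sm) < n → n ≤ (N + 1) * d - r₀ →
      Tendsto (ω.eigenvalue n) (𝓝[area K r₀ rp rm] κ) atTop) := by
  have hF := ω.eventually_below_area hN hr hs hp hκ
  have hc : ∀ᶠ κ' in 𝓝[area K r₀ rp rm] κ, ω.count κ' = (N + 1) * d - r₀ := by
    filter_upwards [self_mem_nhdsWithin] with κ' h3
    rw [ω.count_eq hN, nullityB_of_mem_area h3]
  have hcκ := ω.count_eq hN κ
  rw [nullityB_of_mem_area hκ] at hcκ
  have h3 := two_mul_add_le (d := d) hN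
  have h4 : K.card ≤ 2 * d := (Finset.card_le_univ K).trans_eq card_idx
  exact ⟨fun n h5 h6 => tendsto_eigenvalue_atBot hN hF hc h5 h6 (by omega),
    fun n h5 h6 => tendsto_eigenvalue_nhds hN hF hc h5 (by omega) (by omega),
    fun n h5 h6 => tendsto_eigenvalue_atTop hN hF hc (by omega) h6⟩

theorem singularSet_eq (hN : 1 < N) :
    ω.singularSet = ⋃ k ∈ Set.Icc 1 (2 * d), layer d k := by
  have hN' := two_mul_add_le (d := d) hN
  ext κ
  simp only [mem_iUnion, mem_Icc, exists_prop]
  have hle := nullityB_le κ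
  constructor
  · rintro ⟨n, h1, h2, h3⟩
    refine ⟨κ.nullityB, ⟨?_, hle⟩, rfl⟩
    by_contra h0
    have h0 : κ.nullityB = 0 := by omega
    obtain ⟨K, hK, hdom, -⟩ := exists_mem_area_nullityB κ
    rw [h0, Finset.card_eq_zero] at hK
    subst hK
    -- With nullity `0` the chart has `K = ∅`; it is a neighbourhood of `κ` inside the layer, so
    -- continuity on the layer is continuity at `κ`.
    refine h3 (ContinuousAt.continuousWithinAt ?_)
    rw [ω.count_eq hN, h0] at h2
    exact (ω.continuousOn_layer hN h1 h2).continuousAt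
      (mem_of_superset hdom chartDomain_empty_subset)
  · rintro ⟨k, ⟨h1, h2⟩, rfl⟩
    obtain ⟨K, hK, -, hκ⟩ := exists_mem_area_nullityB κ
    refine ⟨1, le_rfl, by rw [ω.count_eq hN]; omega, fun hcont => ?_⟩
    -- Approach `κ` through the area where one zero eigenvalue of `S_K` has become positive. It
    -- accumulates at `κ`, and along it `λ_1` is defined and tends to `-∞`, against continuity at
    -- `κ`.
    have hr : (κ.nullityB - 1) + 1 + 0 = K.card := by omega
    have hs : κ.nullityB + 0 + 0 = K.card := by omega
    have hcl := mem_closure_area K hr hs (Nat.zero_le _) le_rfl hκ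
    have hne := mem_closure_iff_nhdsWithin_neBot.1 hcl
    have hbot := (ω.area_asymptotics hN hr hs (Nat.zero_le _) le_rfl hκ).1 1 le_rfl le_rfl
    refine not_tendsto_nhds_of_tendsto_atBot hbot _ (hcont.mono_left (nhdsWithin_mono κ ?_))
    intro κ' hκ'
    change 1 ≤ ω.count κ'
    rw [ω.count_eq hN, nullityB_of_mem_area hκ']
    omega

end Equation

end AtkinsonSL

end

theorem mainTheorem3 (d N : ℕ) (hd : 1 ≤ d) (hN : 1 < N) (ω : AtkinsonSL.Equation d N) :
    -- the spectrum is real and finite, so that its elements can be listed in order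
    (∀ κ : AtkinsonSL.BoundarySpace d,
      (ω.spectrum κ).Finite ∧ ∀ z ∈ ω.spectrum κ, z.im = 0) ∧
    -- (1) continuity on the layers and on the chart of the empty set
    (∀ k : ℕ, k ≤ 2 * d →
      (∀ κ ∈ AtkinsonSL.layer d k, ω.count κ = (N + 1) * d - k) ∧
      ∀ n : ℕ, 1 ≤ n → n ≤ (N + 1) * d - k →
        ContinuousOn (ω.eigenvalue n) (AtkinsonSL.layer d k)) ∧
    ((∀ κ ∈ AtkinsonSL.chartDomain (∅ : Finset (AtkinsonSL.Idx d)), ω.count κ = (N + 1) * d) ∧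
      ∀ n : ℕ, 1 ≤ n → n ≤ (N + 1) * d →
        ContinuousOn (ω.eigenvalue n)
          (AtkinsonSL.chartDomain (∅ : Finset (AtkinsonSL.Idx d)))) ∧
    -- (2) asymptotic behaviour on the other charts
    (∀ K : Finset (AtkinsonSL.Idx d), K.Nonempty →
      ∀ r₀ rp rm s₀ sp sm : ℕ,
        r₀ + rp + rm = K.card → s₀ + sp + sm = K.card → r₀ < s₀ → sp ≤ rp → sm ≤ rm →
        ∀ κ ∈ AtkinsonSL.area K s₀ sp sm,
          κ ∈ closure (AtkinsonSL.area K r₀ rp rm) ∧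
          (∀ κ' ∈ AtkinsonSL.area K r₀ rp rm, ω.count κ' = (N + 1) * d - r₀) ∧
          ω.count κ = (N + 1) * d - s₀ ∧
          (∀ n : ℕ, 1 ≤ n → n ≤ rp - sp →
            Tendsto (ω.eigenvalue n) (𝓝[AtkinsonSL.area K r₀ rp rm] κ) atBot) ∧
          (∀ n : ℕ, rp - sp < n → n ≤ (N + 1) * d - r₀ - (rm - sm) →
            Tendsto (ω.eigenvalue n) (𝓝[AtkinsonSL.area K r₀ rp rm] κ)
              (𝓝 (ω.eigenvalue (n - (rp - sp)) κ))) ∧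
          (∀ n : ℕ, (N + 1) * d - r₀ - (rm - sm) < n → n ≤ (N + 1) * d - r₀ →
            Tendsto (ω.eigenvalue n) (𝓝[AtkinsonSL.area K r₀ rp rm] κ) atTop)) ∧
    -- the singular set, which does not depend on `ω`
    ω.singularSet = ⋃ k ∈ Set.Icc 1 (2 * d), AtkinsonSL.layer d k := by
  refine ⟨fun κ => ⟨(Set.finite_range _).subset (ω.spectrum_subset hN κ), fun z hz => ?_⟩,
    fun k hk => ⟨?_, fun n h1 h2 => ω.continuousOn_layer hN h1 h2⟩,
    ⟨fun κ hκ => ?_, fun n h1 h2 => (ω.continuousOn_layer hN h1 h2).mono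
      AtkinsonSL.Equation.chartDomain_empty_subset⟩,
    fun K _ r₀ rp rm s₀ sp sm hr hs _ hp hm κ hκ =>
      ⟨AtkinsonSL.mem_closure_area K hr hs hp hm hκ, fun κ' hκ' => ?_, ?_,
        ω.area_asymptotics hN hr hs hp hm hκ⟩,
    ω.singularSet_eq hN⟩
  · obtain ⟨i, rfl⟩ := ω.spectrum_subset hN κ hz
    exact Complex.ofReal_im _
  · rintro κ rfl
    exact ω.count_eq hN κ
  · have h0 : κ.nullityB = 0 := AtkinsonSL.Equation.chartDomain_empty_subset hκ
    rw [ω.count_eq hN, h0, Nat.sub_zero]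
  · rw [ω.count_eq hN, AtkinsonSL.nullityB_of_mem_area hκ']
  · rw [ω.count_eq hN, AtkinsonSL.nullityB_of_mem_area hκ]
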